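/- **Setting.** Let $F=0$ be a scalar second order PDE in the plane, $F$ smooth on an open subset of $J^2(\mathbb R^2,\mathbb R)$ with coordinates $(x,y,z,p,q,r,s,t)$, with a nondegenerate parametrization $i_F:\Sigma_7\to J^2(\mathbb R^2,\mathbb R)$: $\Sigma_7\subset\mathbb R^7$ is open, $i_F$ is smooth with values in $\{F=0\}$, has rank $7$, and is transverse to the fibres of $J^2\to J^1$. Let $I_F$ be the Pfaffian system on $\Sigma_7$ generated by the pullbacks of $dz-p\,dx-q\,dy$, $dp-r\,dx-s\,dy$, $dq-s\,dx-t\,dy$. Assume that $F=0$ is hyperbolic, i.e. $F_rF_t-\tfrac14F_s^2<0$ along $i_F$. Let $M_1,M_2$ be a labelling of the two smooth rank two subsystems of $I_F$ that are isotropic for the conformal symmetric bilinear form $\langle\varphi,\psi\rangle\,\mathrm{Vol}=d\varphi\wedge d\psi\wedge\theta^1\wedge\theta^2\wedge\theta^3$ on $I_F=\{\theta^1,\theta^2,\theta^3\}$. Assume that $F=0$ is generic: at every point the Cartan systems of $M_1$ and of $M_2$ both have rank $7$. Assume finally that the contact symmetry group is $9$-dimensional, i.e. at every point of $\Sigma_7$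 the Lie algebra of germs of smooth vector fields $X$ with $\mathcal L_XI_F\subset I_F$ has dimension $9$. **Notation.** For a Pfaffian system $I$, $I^{(1)}=\{\theta\in I: d\theta\equiv0 \bmod I\}$ and $I^{(2)}=(I^{(1)})^{(1)}$; $I$ is completely integrable if $I^{(1)}=I$. Put $\mathrm{Char}(I_F,dM_i)=\{X\in I_F^\perp: X\lrcorner\, d\theta\in I_F \text{ for all } \theta\in M_i\}$ and $C(I_F,dM_i)=\mathrm{Char}(I_F,dM_i)^\perp$. $I_F$ is Darboux integrable (at level two) if each of $C(I_F,dM_1)$, $C(I_F,dM_2)$ contains a completely integrable rank two subsystem that meets $I_F$ only in $0$. **Theorem.** Under these assumptions: 1. $C(I_F,dM_1)^{(2)}$ and $C(I_F,dM_2)^{(2)}$ are smooth systems of rank two and are completely integrable; hence $I_F$ is Darboux integrable. 2. They contain, locally, completely integrable rank one subsystems. More precisely, every point of $\Sigma_7$ has an open neighbourhood with an $\epsilon\in\{1,-1\}$ and a smooth coframe $\omega^1,\dots,\omega^7$ such that $$I_F=\{\omega^1,\omega^2,\omega^3\},\quad I_F^{(1)}=\{\omega^1\},\quad M_1=\{\omega^1,\omega^2\},\quad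 M_2=\{\omega^1,\omega^3\},$$ $$d\omega^1\equiv\omega^3\wedge\omega^6+\omega^2\wedge\omega^4 \bmod \{\omega^1\},$$ $$d\omega^2\equiv\omega^4\wedge\omega^5+\omega^3\wedge\omega^7 \bmod \{\omega^1,\omega^2\},$$ $$d\omega^3\equiv\omega^6\wedge\omega^7+\epsilon\,\omega^2\wedge\omega^5 \bmod \{\omega^1,\omega^3\},$$ $$C(I_F,dM_1)=\{\omega^1,\dots,\omega^5\},\quad C(I_F,dM_1)^{(1)}=\{\omega^1,\omega^2,\omega^4,\omega^5\},\quad C(I_F,dM_1)^{(2)}=\{\omega^4,\omega^5\},$$ $$C(I_F,dM_2)=\{\omega^1,\omega^2,\omega^3,\omega^6,\omega^7\},\quad C(I_F,dM_2)^{(1)}=\{\omega^1,\omega^3,\omega^6,\omega^7\},\quad C(I_F,dM_2)^{(2)}=\{\omega^6,\omega^7\},$$ and the rank one subsystems $\{\omega^5\}$ and $\{\omega^7\}$ are completely integrable. -/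

import Mathlib

open Filter Topology
open scoped ContDiff

noncomputable section

section Pfaffian

variable {E : Type*} [NormedAddCommGroup E] [NormedSpace ℝ E]

/-- Differential 1-forms on (open subsets of) `E`. -/
abbrev OneForm (E : Type*) [NormedAddCommGroup E] [NormedSpace ℝ E] : Type _ :=
  E → E →L[ℝ] ℝ

/-- A field of subspaces of the cotangent spaces.  A Pfaffian system (submodule of 1-forms) of
constant rank is represented by the subspaces that its 1-forms span at each point. -/
abbrev CotangentField (E : Type*) [NormedAddCommGroup E] [NormedSpace ℝ E] : Type _ :=
  E → Submodule ℝ (E →L[ℝ] ℝ)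

/-- The value `(dθ)_x (v, w)` of the exterior derivative of a 1-form. -/
def dOne (θ : OneForm E) (x v w : E) : ℝ :=
  extDeriv (fun y => ContinuousAlternatingMap.ofSubsingleton ℝ E ℝ (0 : Fin 1) (θ y)) x ![v, w]

theorem dOne_eq {θ : OneForm E} {x : E} (h : DifferentiableAt ℝ θ x) (v w : E) :
    dOne θ x v w = fderiv ℝ θ x v w - fderiv ℝ θ x w v := by
  have key : ∀ u : E,
      fderiv ℝ (fun y => ContinuousAlternatingMap.ofSubsingleton ℝ E ℝ (0 : Fin 1) (θ y)) x u
        = ContinuousAlternatingMap.ofSubsingleton ℝ E ℝ (0 : Fin 1) (fderiv ℝ θ x u) := by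
    intro u
    have h1 := ((ContinuousAlternatingMap.ofSubsingletonLIE (𝕜 := ℝ) (E := E) (F := ℝ)
      (0 : Fin 1)).toContinuousLinearEquiv.hasFDerivAt (x := θ x)).comp x h.hasFDerivAt
    have h2 := h1.fderiv
    exact congrArg (fun L => L u) h2
  unfold dOne
  rw [extDeriv, ContinuousAlternatingMap.alternatizeUncurryFin_apply]
  have h1 : Fin.removeNth 1 ![v, w] 0 = v := rfl
  simp [Fin.sum_univ_two, key, sub_eq_add_neg, h1]

/-- `v` is annihilated by every covector in `W`, i.e. `v ∈ W^⊥`. -/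
def InAnn (W : Submodule ℝ (E →L[ℝ] ℝ)) (v : E) : Prop := ∀ α ∈ W, α v = 0

/-- `θ` is, near `x`, a smooth section of `D` (a local 1-form belonging to the system `D`). -/
def IsLocalSection (D : CotangentField E) (x : E) (θ : OneForm E) : Prop :=
  ∀ᶠ y in 𝓝 x, ContDiffAt ℝ ∞ θ y ∧ θ y ∈ D y

/-- `D` is a smooth Pfaffian system of constant rank `k` on `S`. -/
def IsPfaffianSystem (D : CotangentField E) (k : ℕ) (S : Set E) : Prop :=
  ∀ x ∈ S, ∃ η : Fin k → OneForm E, ∀ᶠ y in 𝓝 x,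
    (∀ i, ContDiffAt ℝ ∞ (η i) y) ∧ LinearIndependent ℝ (fun i => η i y) ∧
      D y = Submodule.span ℝ (Set.range fun i => η i y)

/-- `dθ ≡ 0 mod D` at the point `x`: the 2-form `(dθ)_x` lies in the algebraic ideal generated by
`D x`, i.e. it vanishes on `(D x)^⊥`. -/
def DCongZero (D : CotangentField E) (θ : OneForm E) (x : E) : Prop :=
  ∀ v w : E, InAnn (D x) v → InAnn (D x) w → dOne θ x v w = 0

/-- The (first) derived system `D^{(1)} = {θ ∈ D : dθ ≡ 0 mod D}`. -/
def derivedSystem (D : CotangentField E) : CotangentField E := fun x =>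
  { carrier := {α | ∃ θ : OneForm E, IsLocalSection D x θ ∧
      (∀ᶠ y in 𝓝 x, DCongZero D θ y) ∧ θ x = α}
    add_mem' := by
      rintro _ _ ⟨θ, h1, h2, rfl⟩ ⟨ζ, k1, k2, rfl⟩
      refine ⟨fun y => θ y + ζ y, ?_, ?_, rfl⟩
      · filter_upwards [h1, k1] with y hy ky
        exact ⟨hy.1.add ky.1, (D y).add_mem hy.2 ky.2⟩
      · filter_upwards [h1, k1, h2, k2] with y h1y k1y h2y k2y v w hv hw
        have a := h1y.1.differentiableAt (by simp)
        have b := k1y.1.differentiableAt (by simp)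
        have e1 := h2y v w hv hw
        have e2 := k2y v w hv hw
        rw [dOne_eq a] at e1
        rw [dOne_eq b] at e2
        rw [dOne_eq (a.fun_add b), fderiv_fun_add a b]
        simp only [add_apply]
        linarith
    zero_mem' := by
      refine ⟨fun _ => 0, ?_, ?_, rfl⟩
      · exact Eventually.of_forall fun y => ⟨contDiffAt_const, (D y).zero_mem⟩
      · refine Eventually.of_forall fun y v w _ _ => ?_
        rw [dOne_eq (differentiableAt_const _)]
        simp
    smul_mem' := by
      rintro c _ ⟨θ, h1, h2, rfl⟩
      refine ⟨fun y => c • θ y, ?_, ?_, rfl⟩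
      · filter_upwards [h1] with y hy
        exact ⟨hy.1.const_smul c, (D y).smul_mem c hy.2⟩
      · filter_upwards [h1, h2] with y h1y h2y v w hv hw
        have a := h1y.1.differentiableAt (by simp)
        have e1 := h2y v w hv hw
        rw [dOne_eq a] at e1
        rw [dOne_eq (a.fun_const_smul c), fderiv_fun_const_smul a c]
        simp only [smul_apply, smul_eq_mul]
        rw [← mul_sub, e1, mul_zero] }

/-- Complete integrability in the sense of Frobenius on `S`: `D^{(1)} = D`. -/
def CompletelyIntegrableOn (D : CotangentField E) (S : Set E) : Prop :=
  ∀ x ∈ S, derivedSystem D x = D x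

/-- `v ∈ Char(I, dM)_x`: `v ∈ I^⊥` and `v ⌟ dθ ∈ I` at `x` for every 1-form `θ` of `M`. -/
def IsChar (I M : CotangentField E) (x v : E) : Prop :=
  InAnn (I x) v ∧ ∀ θ : OneForm E, IsLocalSection M x θ → ∃ β ∈ I x, ∀ w, β w = dOne θ x v w

/-- The characteristic system `C(I, dM) = Char(I, dM)^⊥`.  For `M = I`, `Char(I, dI)` is the Cauchy
characteristic space and `C(I, dI)` is the Cartan system of `I`. -/
def charSystem (I M : CotangentField E) : CotangentField E := fun x =>
  { carrier := {α | ∀ v, IsChar I M x v → α v = 0}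
    add_mem' := by
      intro α β ha hb v hv
      simp [ha v hv, hb v hv]
    zero_mem' := by
      intro v _
      simp
    smul_mem' := by
      intro c α ha v hv
      simp [ha v hv] }

/-- The class of a Pfaffian system at a point: the rank of its Cartan system. -/
def classAt (D : CotangentField E) (x : E) : ℕ := Module.finrank ℝ (charSystem D D x)

/-- The Lie derivative `L_X θ` of a 1-form along a vector field:
`(L_X θ)(w) = (D_X θ)(w) + θ (D_w X)`. -/
def lieDerivOneForm (X : E → E) (θ : OneForm E) : OneForm E := fun x =>
  fderiv ℝ θ x (X x) + (θ x).comp (fderiv ℝ X x)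

/-- `X` is, near `p`, a smooth infinitesimal symmetry of `D`: `L_X θ ∈ D` for all `θ ∈ D`. -/
def IsInfSymmetryNear (D : CotangentField E) (p : E) (X : E → E) : Prop :=
  ∀ᶠ y in 𝓝 p, ContDiffAt ℝ ∞ X y ∧
    ∀ θ : OneForm E, IsLocalSection D y θ → lieDerivOneForm X θ y ∈ D y

/-- The real vector space of germs at `p` of infinitesimal symmetries of `D`. -/
def symmetryAlgebra (D : CotangentField E) (p : E) : Submodule ℝ (Germ (𝓝 p) E) :=
  { carrier := {g | ∃ X : E → E, IsInfSymmetryNear D p X ∧ (X : Germ (𝓝 p) E) = g}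
    add_mem' := by
      rintro _ _ ⟨X, hX, rfl⟩ ⟨Y, hY, rfl⟩
      refine ⟨X + Y, ?_, rfl⟩
      filter_upwards [hX, hY] with y hx hy
      refine ⟨hx.1.add hy.1, fun θ hθ => ?_⟩
      have a := hx.1.differentiableAt (by simp)
      have b := hy.1.differentiableAt (by simp)
      have e : lieDerivOneForm (X + Y) θ y = lieDerivOneForm X θ y + lieDerivOneForm Y θ y := by
        ext w
        simp [lieDerivOneForm, fderiv_add a b, add_add_add_comm]
      rw [e]
      exact (D y).add_mem (hx.2 θ hθ) (hy.2 θ hθ)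
    zero_mem' := by
      refine ⟨0, Eventually.of_forall fun y => ⟨contDiffAt_const, fun θ _ => ?_⟩, rfl⟩
      have e : lieDerivOneForm (0 : E → E) θ y = 0 := by
        ext w
        simp [lieDerivOneForm]
      rw [e]
      exact (D y).zero_mem
    smul_mem' := by
      rintro c _ ⟨X, hX, rfl⟩
      refine ⟨c • X, ?_, rfl⟩
      filter_upwards [hX] with y hx
      refine ⟨hx.1.const_smul c, fun θ hθ => ?_⟩
      have a := hx.1.differentiableAt (by simp)
      have e : lieDerivOneForm (c • X) θ y = c • lieDerivOneForm X θ y := by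
        ext w
        simp [lieDerivOneForm, fderiv_const_smul a c]
      rw [e]
      exact (D y).smul_mem c (hx.2 θ hθ) }

/-- The wedge product of two covectors, evaluated on `(v, w)`. -/
def wedge (α β : E →L[ℝ] ℝ) (v w : E) : ℝ := α v * β w - α w * β v

/-- The wedge product of two 2-forms, evaluated on `(a, b, c, d)`. -/
def wedgeTwo (A B : E → E → ℝ) (a b c d : E) : ℝ :=
  A a b * B c d - A a c * B b d + A a d * B b c + A b c * B a d - A b d * B a c + A c d * B a b

/-- `dθ ≡ Ω mod W` at `x`, for a 2-form `Ω` at `x` and a space `W` of covectors at `x`. -/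
def DCong (θ : OneForm E) (x : E) (Ω : E → E → ℝ) (W : Submodule ℝ (E →L[ℝ] ℝ)) : Prop :=
  ∀ v w : E, InAnn W v → InAnn W w → dOne θ x v w = Ω v w

end Pfaffian

/-- The space `J²(ℝ², ℝ)` of 2-jets, with coordinates `(x, y, z, p, q, r, s, t)`. -/
abbrev Jet2 : Type := Fin 8 → ℝ

/-- The parameter space containing `Σ₇`. -/
abbrev Param : Type := Fin 7 → ℝ

/-- The coordinate differential `dj_k` on `J²`. -/
def dCoord (k : Fin 8) : Jet2 →L[ℝ] ℝ := ContinuousLinearMap.proj k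

/-- The contact forms `dz - p dx - q dy`, `dp - r dx - s dy`, `dq - s dx - t dy` on `J²`. -/
def contactForm : Fin 3 → OneForm Jet2 :=
  ![fun j => dCoord 2 - j 3 • dCoord 0 - j 4 • dCoord 1,
    fun j => dCoord 3 - j 5 • dCoord 0 - j 6 • dCoord 1,
    fun j => dCoord 4 - j 6 • dCoord 0 - j 7 • dCoord 1]

/-- The Pfaffian system `I_F = i_F^* (contact system)` on `Σ₇`. -/
def pdeSystem (i : Param → Jet2) : CotangentField Param := fun x =>
  Submodule.span ℝ (Set.range fun k => (contactForm k (i x)).comp (fderiv ℝ i x))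

/-- The projection `J² → J¹`, `(x, y, z, p, q, r, s, t) ↦ (x, y, z, p, q)`. -/
def jetProj : Jet2 →ₗ[ℝ] (Fin 5 → ℝ) := LinearMap.funLeft ℝ ℝ (Fin.castLE (by norm_num : 5 ≤ 8))

/-- `i` is a nondegenerate parametrization, on the open set `S`, of the equation `F = 0`, where `F`
is smooth on the open set `W`: `i` maps into the locus, has maximal rank and is transverse to the
fibres of `J² → J¹`. -/
structure IsNondegParam (F : Jet2 → ℝ) (W : Set Jet2) (S : Set Param) (i : Param → Jet2) :
    Prop where
  isOpen_dom : IsOpen W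
  smooth_eqn : ContDiffOn ℝ ∞ F W
  isOpen_param : IsOpen S
  smooth_param : ContDiffOn ℝ ∞ i S
  maps_to : ∀ x ∈ S, i x ∈ W ∧ F (i x) = 0
  max_rank : ∀ x ∈ S, Function.Injective (fderiv ℝ i x)
  transverse : ∀ x ∈ S,
    LinearMap.range (fderiv ℝ i x : Param →ₗ[ℝ] Jet2) ⊔ LinearMap.ker jetProj = ⊤

/-- The partial derivative of `F` in the `k`-th jet coordinate. -/
def partialJet (F : Jet2 → ℝ) (k : Fin 8) (j : Jet2) : ℝ := fderiv ℝ F j (Pi.single k 1)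

/-- Hyperbolicity on `S`: `Δ = F_r F_t - F_s² / 4 < 0` along the parametrized locus. -/
def IsHyperbolicOn (F : Jet2 → ℝ) (S : Set Param) (i : Param → Jet2) : Prop :=
  ∀ x ∈ S, partialJet F 5 (i x) * partialJet F 7 (i x) - partialJet F 6 (i x) ^ 2 / 4 < 0

/-- `M` is isotropic on `S` for the conformal symmetric bilinear form
`⟨φ, ψ⟩ Vol = dφ ∧ dψ ∧ ω¹ ∧ ω² ∧ ω³` on `I = {ω¹, ω², ω³}`.  The vanishing of this 7-form says that
the 4-form `dφ ∧ dψ` is `0` modulo `I`, i.e. that it vanishes on `I^⊥`. -/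
def IsIsotropicOn (I M : CotangentField Param) (S : Set Param) : Prop :=
  ∀ x ∈ S, ∀ φ ψ : OneForm Param, IsLocalSection M x φ → IsLocalSection M x ψ →
    ∀ a b c d : Param, InAnn (I x) a → InAnn (I x) b → InAnn (I x) c → InAnn (I x) d →
      wedgeTwo (dOne φ x) (dOne ψ x) a b c d = 0

/-- `M₁`, `M₂` is a labelling of the two rank two (maximally) isotropic subsystems of `I`. -/
structure IsCharacteristicPair (I M₁ M₂ : CotangentField Param) (S : Set Param) : Prop where
  rank_one : IsPfaffianSystem M₁ 2 S
  rank_two : IsPfaffianSystem M₂ 2 S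
  le_one : ∀ x ∈ S, M₁ x ≤ I x
  le_two : ∀ x ∈ S, M₂ x ≤ I x
  isotropic_one : IsIsotropicOn I M₁ S
  isotropic_two : IsIsotropicOn I M₂ S
  distinct : ∀ x ∈ S, M₁ x ≠ M₂ x

/-- Generic (class 7-7) type: `class(M₁) = class(M₂) = 7` at every point. -/
def IsGenericOn (M₁ M₂ : CotangentField Param) (S : Set Param) : Prop :=
  ∀ x ∈ S, classAt M₁ x = 7 ∧ classAt M₂ x = 7

/-- The system `C(I, dM)` contains a completely integrable rank two subsystem that is independent
from `I`. -/
def HasDarbouxSubsystem (I M : CotangentField Param) (S : Set Param) : Prop :=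
  ∃ J : CotangentField Param, IsPfaffianSystem J 2 S ∧ (∀ x ∈ S, J x ≤ charSystem I M x) ∧
    CompletelyIntegrableOn J S ∧ ∀ x ∈ S, J x ⊓ I x = ⊥

/-- Darboux integrability (at level two) of `I` with characteristic systems `M₁`, `M₂`. -/
def IsDarbouxIntegrable (I M₁ M₂ : CotangentField Param) (S : Set Param) : Prop :=
  HasDarbouxSubsystem I M₁ S ∧ HasDarbouxSubsystem I M₂ S

/-- The system generated at each point by the forms `η k`, `k ∈ K`. -/
def genBy (η : Fin 7 → OneForm Param) (K : Set (Fin 7)) : CotangentField Param := fun x =>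
  Submodule.span ℝ ((fun k => η k x) '' K)

/-- `η = (η¹, …, η⁷)` (indexed from `0` to `6`) is, at the point `y`, a coframe adapted to a generic
hyperbolic system `I` with characteristic systems `M₁`, `M₂` and contact invariant `ε`. -/
structure IsAdaptedCoframeAt (I M₁ M₂ : CotangentField Param) (ε : ℝ)
    (η : Fin 7 → OneForm Param) (y : Param) : Prop where
  smooth : ∀ k, ContDiffAt ℝ ∞ (η k) y
  indep : LinearIndependent ℝ (fun k => η k y)
  span_I : I y = genBy η {0, 1, 2} y
  span_I_derived : derivedSystem I y = genBy η {0} y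
  span_M₁ : M₁ y = genBy η {0, 1} y
  span_M₂ : M₂ y = genBy η {0, 2} y
  d_one : DCong (η 0) y
    (fun v w => wedge (η 2 y) (η 5 y) v w + wedge (η 1 y) (η 3 y) v w) (genBy η {0} y)
  d_two : DCong (η 1) y
    (fun v w => wedge (η 3 y) (η 4 y) v w + wedge (η 2 y) (η 6 y) v w) (genBy η {0, 1} y)
  d_three : DCong (η 2) y
    (fun v w => wedge (η 5 y) (η 6 y) v w + ε * wedge (η 1 y) (η 4 y) v w) (genBy η {0, 2} y)
  char_one : charSystem I M₁ y = genBy η {0, 1, 2, 3, 4} y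
  char_two : charSystem I M₂ y = genBy η {0, 1, 2, 5, 6} y
  char_one_derived : derivedSystem (charSystem I M₁) y = genBy η {0, 1, 3, 4} y
  char_two_derived : derivedSystem (charSystem I M₂) y = genBy η {0, 2, 5, 6} y
  char_one_derived₂ : derivedSystem (derivedSystem (charSystem I M₁)) y = genBy η {3, 4} y
  char_two_derived₂ : derivedSystem (derivedSystem (charSystem I M₂)) y = genBy η {5, 6} y

end

noncomputable section

/-! ### Exterior derivatives of 1-forms -/

/-! Indices start at 0, so `η 3`, `η 4` stand for ω⁴, ω⁵ and `η 5`, `η 6` for ω⁶, ω⁷. Write e_j for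
the dual frame and c^i_jk for the components of dη^i.

Hyperbolicity makes the conformal form nondegenerate on I modulo its derived line, and M₁, M₂
project to its two null lines. This yields a coframe with dη⁰ normalized modulo η⁰
(`exists_contactCoframe`). Identities from d² = 0 and absorption of torsion reduce it further. Class
7 makes the two remaining essential coefficients nonzero, so they scale to 1 and ε = ±1
(`exists_genericCoframe`).

A symmetry X preserves I; the Lie derivatives of the structure equations then force it to act on
such a coframe through three parameters: a dilation a, giving η⁰,…,η⁶ the weights 2, 1, 1, 1, 0, 1,
0, and two nilpotent parameters h, h' (`lieCoeff_eq_symMatrix`). The same equations bound the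
derivatives of (X, a, h, h') linearly by these functions, so their values at one point determine the
germ of X (`eventually_eq_zero_of_symData`). At a zero of X with a = 0, the parameters h and h'
vanish together (`isotropy_relations`). Hence the symmetry algebra injects into the nine-dimensional
space of values (X, a, h'), and dimension 9 means that all of these occur (`exists_symmetry`).

Isotropy must preserve the torsion. The dilation kills every component of dη³, dη⁴ off {η³, η⁴}
whose weights do not balance; the only balanced one, η¹∧η⁶ in dη³, is killed by the nilpotent part.
So {η³, η⁴} is integrable (`structFn_eq_zero_of_isotropy`), and it is the second derived system of
C(I, dM₁) (`derivedSystem_derivedSystem_charSystem_one`).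

For the rank one subsystem, take a symmetry X equal to e_3 at the given point and the combination θ
= η⁴ + sη³ with θ(X) = 0. Then X⌟dθ = L_Xθ is a multiple of η³, and with the integrability of {η³,
η⁴} this makes θ integrable (`dOne_eq_zero_of_symmetry`). A shear of the coframe puts θ in the place
of η⁴ without touching η⁶, and the interchange `IsGenericFor.swap` of the characteristic systems
does the rest. -/

theorem update_pair {E : Type*} (v w z : E) : Function.update ![v, w] 0 z = ![z, w] := by
  ext k; fin_cases k <;> simp

section Calculus

variable {E : Type*} [NormedAddCommGroup E] [NormedSpace ℝ E]

theorem dOne_add_left (θ : OneForm E) (x u v w : E) :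
    dOne θ x (u + v) w = dOne θ x u w + dOne θ x v w := by
  have h := (extDeriv (fun y => ContinuousAlternatingMap.ofSubsingleton ℝ E ℝ (0 : Fin 1) (θ y))
    x).map_update_add ![u, w] 0 u v
  rw [update_pair, update_pair, update_pair] at h
  exact h

theorem dOne_smul_left (θ : OneForm E) (x : E) (c : ℝ) (v w : E) :
    dOne θ x (c • v) w = c * dOne θ x v w := by
  have h := (extDeriv (fun y => ContinuousAlternatingMap.ofSubsingleton ℝ E ℝ (0 : Fin 1) (θ y))
    x).map_update_smul ![v, w] 0 c v
  rw [update_pair, update_pair] at h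
  exact h

theorem dOne_swap (θ : OneForm E) (x v w : E) : dOne θ x v w = - dOne θ x w v := by
  have h := (extDeriv (fun y => ContinuousAlternatingMap.ofSubsingleton ℝ E ℝ (0 : Fin 1) (θ y))
    x).map_swap ![w, v] (i := 0) (j := 1) (by decide)
  have e : (![w, v] ∘ (Equiv.swap (0 : Fin 2) 1)) = ![v, w] := by
    ext k; fin_cases k <;> simp
  rw [e] at h
  simpa [dOne] using h

theorem dOne_self (θ : OneForm E) (x v : E) : dOne θ x v v = 0 := by
  have := dOne_swap θ x v v
  linarith

theorem dOne_add_right (θ : OneForm E) (x u v w : E) :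
    dOne θ x w (u + v) = dOne θ x w u + dOne θ x w v := by
  rw [dOne_swap, dOne_add_left, dOne_swap θ x u w, dOne_swap θ x v w]; ring

theorem dOne_smul_right (θ : OneForm E) (x : E) (c : ℝ) (v w : E) :
    dOne θ x w (c • v) = c * dOne θ x w v := by
  rw [dOne_swap, dOne_smul_left, dOne_swap θ x v w]; ring

/-- The exterior derivative of a 1-form at a point as a bilinear map. -/
def dOneBilin (θ : OneForm E) (x : E) : E →ₗ[ℝ] E →ₗ[ℝ] ℝ :=
  LinearMap.mk₂ ℝ (dOne θ x) (fun u v w => dOne_add_left θ x u v w)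
    (fun c v w => dOne_smul_left θ x c v w) (fun w u v => dOne_add_right θ x u v w)
    (fun c w v => dOne_smul_right θ x c v w)

theorem dOneBilin_apply (θ : OneForm E) (x v w : E) : dOneBilin θ x v w = dOne θ x v w := rfl

theorem dOne_add {θ ζ : OneForm E} {x : E} (h : DifferentiableAt ℝ θ x)
    (k : DifferentiableAt ℝ ζ x) (v w : E) :
    dOne (fun y => θ y + ζ y) x v w = dOne θ x v w + dOne ζ x v w := by
  rw [dOne_eq h, dOne_eq k, dOne_eq (h.fun_add k), fderiv_fun_add h k]
  simp only [add_apply]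
  ring

theorem dOne_mul {f : E → ℝ} {θ : OneForm E} {x : E} (hf : DifferentiableAt ℝ f x)
    (h : DifferentiableAt ℝ θ x) (v w : E) :
    dOne (fun y => f y • θ y) x v w
      = f x * dOne θ x v w + (fderiv ℝ f x v * θ x w - fderiv ℝ f x w * θ x v) := by
  rw [dOne_eq h, dOne_eq (hf.fun_smul h), fderiv_fun_smul hf h]
  simp
  ring

theorem ContDiffAt.eventually_smooth {F : Type*} [NormedAddCommGroup F] [NormedSpace ℝ F]
    {f : E → F} {x : E} (h : ContDiffAt ℝ ∞ f x) {n : ℕ} :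
    ∀ᶠ y in 𝓝 x, ContDiffAt ℝ n f y :=
  (h.of_le (by exact_mod_cast le_top)).eventually (by simp)

theorem ContDiffAt.smooth_fderiv {F : Type*} [NormedAddCommGroup F] [NormedSpace ℝ F]
    {f : E → F} {x : E} (h : ContDiffAt ℝ ∞ f x) : ContDiffAt ℝ ∞ (fderiv ℝ f) x :=
  h.fderiv_right (by simp)

theorem ContDiffAt.isSymm {F : Type*} [NormedAddCommGroup F] [NormedSpace ℝ F]
    {f : E → F} {x : E} (h : ContDiffAt ℝ ∞ f x) (v w : E) :
    fderiv ℝ (fderiv ℝ f) x v w = fderiv ℝ (fderiv ℝ f) x w v :=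
  (h.isSymmSndFDerivAt (n := ∞) (by simpa using WithTop.coe_le_coe.2 (le_top (a := (2 : ℕ∞))))).eq v w

theorem ContDiffAt.dAt {F : Type*} [NormedAddCommGroup F] [NormedSpace ℝ F]
    {f : E → F} {x : E} (h : ContDiffAt ℝ ∞ f x) : DifferentiableAt ℝ f x :=
  h.differentiableAt (by simp)

/-- `dOne θ` as a function of the base point, evaluated on vector fields, near a point. -/
theorem dOne_eventuallyEq {θ : OneForm E} {x : E} (h : ContDiffAt ℝ ∞ θ x) (V W : E → E) :
    (fun y => dOne θ y (V y) (W y)) =ᶠ[𝓝 x]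
      fun y => fderiv ℝ θ y (V y) (W y) - fderiv ℝ θ y (W y) (V y) := by
  filter_upwards [h.eventually_smooth (n := 1)] with y hy
  exact dOne_eq (hy.differentiableAt (by simp)) _ _

theorem contDiffAt_dOne {θ : OneForm E} {x : E} {V W : E → E} (h : ContDiffAt ℝ ∞ θ x)
    (hV : ContDiffAt ℝ ∞ V x) (hW : ContDiffAt ℝ ∞ W x) :
    ContDiffAt ℝ ∞ (fun y => dOne θ y (V y) (W y)) x := by
  refine ContDiffAt.congr_of_eventuallyEq ?_ (dOne_eventuallyEq h V W)
  exact ((h.smooth_fderiv.clm_apply hV).clm_apply hW).sub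
    ((h.smooth_fderiv.clm_apply hW).clm_apply hV)

/-- The derivative of `dθ (V, W)` along `u`. -/
theorem fderiv_dOne {θ : OneForm E} {x : E} {V W : E → E} (h : ContDiffAt ℝ ∞ θ x)
    (hV : DifferentiableAt ℝ V x) (hW : DifferentiableAt ℝ W x) (u : E) :
    fderiv ℝ (fun y => dOne θ y (V y) (W y)) x u
      = (fderiv ℝ (fderiv ℝ θ) x u (V x) (W x) - fderiv ℝ (fderiv ℝ θ) x u (W x) (V x))
        + dOne θ x (fderiv ℝ V x u) (W x) + dOne θ x (V x) (fderiv ℝ W x u) := by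
  have hD := h.smooth_fderiv.dAt.hasFDerivAt
  have h1 := (hD.clm_apply hV.hasFDerivAt).clm_apply hW.hasFDerivAt
  have h2 := (hD.clm_apply hW.hasFDerivAt).clm_apply hV.hasFDerivAt
  rw [(dOne_eventuallyEq h V W).fderiv_eq, (h1.fun_sub h2).fderiv, dOne_eq h.dAt, dOne_eq h.dAt]
  simp
  ring

/-- Cartan's formula for the exterior derivative of a 1-form on two vector fields. -/
theorem fderiv_apply_sub {θ : OneForm E} {x : E} {V W : E → E} (h : DifferentiableAt ℝ θ x)
    (hV : DifferentiableAt ℝ V x) (hW : DifferentiableAt ℝ W x) :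
    fderiv ℝ (fun y => θ y (W y)) x (V x) - fderiv ℝ (fun y => θ y (V y)) x (W x)
      = dOne θ x (V x) (W x) + θ x (fderiv ℝ W x (V x) - fderiv ℝ V x (W x)) := by
  rw [(h.hasFDerivAt.clm_apply hW.hasFDerivAt).fderiv,
    (h.hasFDerivAt.clm_apply hV.hasFDerivAt).fderiv, dOne_eq h]
  simp
  ring

theorem contDiffAt_lieDeriv {θ : OneForm E} {X : E → E} {x : E} (h : ContDiffAt ℝ ∞ θ x)
    (hX : ContDiffAt ℝ ∞ X x) : ContDiffAt ℝ ∞ (lieDerivOneForm X θ) x :=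
  (h.smooth_fderiv.clm_apply hX).add (h.clm_comp hX.smooth_fderiv)

/-- The exterior derivative commutes with the Lie derivative. -/
theorem dOne_lieDeriv {θ : OneForm E} {X : E → E} {x : E} (h : ContDiffAt ℝ ∞ θ x)
    (hX : ContDiffAt ℝ ∞ X x) (v w : E) :
    dOne (lieDerivOneForm X θ) x v w
      = (fderiv ℝ (fderiv ℝ θ) x (X x) v w - fderiv ℝ (fderiv ℝ θ) x (X x) w v)
        + dOne θ x (fderiv ℝ X x v) w + dOne θ x v (fderiv ℝ X x w) := by
  have h1 := h.smooth_fderiv.dAt.hasFDerivAt.clm_apply hX.dAt.hasFDerivAt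
  have h2 := h.dAt.hasFDerivAt.clm_comp hX.smooth_fderiv.dAt.hasFDerivAt
  have h3 : fderiv ℝ (lieDerivOneForm X θ) x = _ := (h1.fun_add h2).fderiv
  rw [dOne_eq (contDiffAt_lieDeriv h hX).dAt, h3, dOne_eq h.dAt, dOne_eq h.dAt]
  simp
  rw [h.isSymm v (X x), h.isSymm w (X x), hX.isSymm v w]
  ring

end Calculus

/-! ### Coframes and structure functions -/

/-- The linear map with components `η k y`. -/
def coLin (η : Fin 7 → OneForm Param) (y : Param) : Param →L[ℝ] (Fin 7 → ℝ) :=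
  ContinuousLinearMap.pi fun k => η k y

/-- The frame dual to a coframe. -/
def frame (η : Fin 7 → OneForm Param) (j : Fin 7) (y : Param) : Param :=
  -- `ContinuousLinearMap.inverse` is 0 at a map that is not invertible, so the duality relations
  -- below require linear independence.
  (coLin η y).inverse (Pi.single j 1)

/-- `η` is a smooth coframe at `y`. -/
structure IsCoframeAt (η : Fin 7 → OneForm Param) (y : Param) : Prop where
  smooth : ∀ k, ContDiffAt ℝ ∞ (η k) y
  indep : LinearIndependent ℝ (fun k => η k y)

/-- The structure functions of a coframe. -/
def structFn (η : Fin 7 → OneForm Param) (i j k : Fin 7) (y : Param) : ℝ :=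
  dOne (η i) y (frame η j y) (frame η k y)

/-- The components `(L_X η^i) (e_j)`. -/
def lieCoeff (X : Param → Param) (η : Fin 7 → OneForm Param) (i j : Fin 7) (y : Param) : ℝ :=
  lieDerivOneForm X (η i) y (frame η j y)

theorem finrank_dual_param : Module.finrank ℝ (Param →L[ℝ] ℝ) = 7 := by
  have e : (Param →L[ℝ] ℝ) ≃ₗ[ℝ] (Param →ₗ[ℝ] ℝ) := LinearMap.toContinuousLinearMap.symm
  rw [e.finrank_eq]
  simp

instance : FiniteDimensional ℝ (Param →L[ℝ] ℝ) :=
  FiniteDimensional.of_finrank_pos (by rw [finrank_dual_param]; norm_num)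

section Coframe

variable {η : Fin 7 → OneForm Param} {y : Param}

theorem span_eq_top_of_indep (h : LinearIndependent ℝ (fun k => η k y)) :
    Submodule.span ℝ (Set.range fun k => η k y) = ⊤ :=
  h.span_eq_top_of_card_eq_finrank' (by rw [finrank_dual_param]; simp)

theorem eq_zero_of_coframe (h : LinearIndependent ℝ (fun k => η k y)) {v : Param}
    (hv : ∀ k, η k y v = 0) : v = 0 := by
  have key : ∀ α : Param →L[ℝ] ℝ, α v = 0 := by
    intro α
    have hα : α ∈ Submodule.span ℝ (Set.range fun k => η k y) := by
      rw [span_eq_top_of_indep h]; trivial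
    induction hα using Submodule.span_induction with
    | mem _ hx => obtain ⟨k, rfl⟩ := hx; exact hv k
    | zero => rfl
    | add a b _ _ ha hb => simp [ha, hb]
    | smul c a _ ha => simp [ha]
  funext j
  exact key (ContinuousLinearMap.proj j)

theorem exists_equiv_of_coframe (h : LinearIndependent ℝ (fun k => η k y)) :
    ∃ e : Param ≃L[ℝ] (Fin 7 → ℝ), (e : Param →L[ℝ] (Fin 7 → ℝ)) = coLin η y := by
  have inj : Function.Injective (coLin η y : Param →ₗ[ℝ] Param) := by
    rw [injective_iff_map_eq_zero]
    intro v hv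
    exact eq_zero_of_coframe h fun k => congrFun hv k
  refine ⟨(LinearEquiv.ofInjectiveEndo _ inj).toContinuousLinearEquiv, ?_⟩
  ext v k
  rfl

theorem coframe_frame (h : LinearIndependent ℝ (fun k => η k y)) (i j : Fin 7) :
    η i y (frame η j y) = if i = j then 1 else 0 := by
  obtain ⟨e, he⟩ := exists_equiv_of_coframe h
  have : coLin η y (frame η j y) = Pi.single j 1 := by
    rw [frame, ← he, ContinuousLinearMap.inverse_equiv]
    simp
  have := congrFun this i
  rw [Pi.single_apply] at this
  exact this

theorem sum_frame (h : LinearIndependent ℝ (fun k => η k y)) (v : Param) :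
    ∑ j, η j y v • frame η j y = v := by
  rw [← sub_eq_zero]
  apply eq_zero_of_coframe h
  intro k
  simp [coframe_frame h]

theorem sum_coframe (h : LinearIndependent ℝ (fun k => η k y)) (α : Param →L[ℝ] ℝ) :
    ∑ j, α (frame η j y) • η j y = α := by
  ext v
  conv_rhs => rw [← sum_frame h v]
  simp [mul_comm]

theorem IsCoframeAt.eventually (h : IsCoframeAt η y) :
    ∀ᶠ z in 𝓝 y, LinearIndependent ℝ (fun k => η k z) := by
  have hc : ContinuousAt (fun z => fun k => η k z) y :=
    continuousAt_pi.2 fun k => (h.smooth k).continuousAt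
  exact hc.eventually (isOpen_setOfPred_linearIndependent.mem_nhds h.indep)

/-- Inversion of continuous linear maps is smooth at an invertible map, and `coLin η` depends
smoothly on the point. -/
theorem contDiffAt_frame (h : IsCoframeAt η y) (j : Fin 7) : ContDiffAt ℝ ∞ (frame η j) y := by
  obtain ⟨e, he⟩ := exists_equiv_of_coframe h.indep
  have h1 : ContDiffAt ℝ ∞ (coLin η) y := by
    have : coLin η = fun z => ∑ k, (ContinuousLinearMap.compL ℝ Param ℝ (Fin 7 → ℝ)
        (ContinuousLinearMap.single ℝ (fun _ : Fin 7 => ℝ) k)) (η k z) := by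
      funext z
      ext v k
      simp [coLin, Finset.sum_apply, Pi.single_apply]
    rw [this]
    exact ContDiffAt.sum fun k _ => ((ContinuousLinearMap.compL ℝ Param ℝ (Fin 7 → ℝ)
        (ContinuousLinearMap.single ℝ (fun _ : Fin 7 => ℝ) k)).contDiff.contDiffAt).comp y
        (h.smooth k)
  have h2 : ContDiffAt ℝ ∞ ContinuousLinearMap.inverse (coLin η y) := by
    rw [← he]; exact contDiffAt_map_inverse e
  exact (h2.comp y h1).clm_apply contDiffAt_const

theorem contDiffAt_structFn (h : IsCoframeAt η y) (i j k : Fin 7) :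
    ContDiffAt ℝ ∞ (structFn η i j k) y :=
  contDiffAt_dOne (h.smooth i) (contDiffAt_frame h j) (contDiffAt_frame h k)

theorem contDiffAt_lieCoeff (h : IsCoframeAt η y) {X : Param → Param} (hX : ContDiffAt ℝ ∞ X y)
    (i j : Fin 7) : ContDiffAt ℝ ∞ (lieCoeff X η i j) y :=
  (contDiffAt_lieDeriv (h.smooth i) hX).clm_apply (contDiffAt_frame h j)

/-- `η^m (D_u e_j) = - (D_u η^m) (e_j)`. -/
theorem coframe_fderiv_frame (h : IsCoframeAt η y) (m j : Fin 7) (u : Param) :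
    η m y (fderiv ℝ (frame η j) y u) = - fderiv ℝ (η m) y u (frame η j y) := by
  have h1 : (fun z => η m z (frame η j z)) =ᶠ[𝓝 y] fun _ => if m = j then 1 else 0 := by
    filter_upwards [h.eventually] with z hz using coframe_frame hz m j
  have h2 := h1.fderiv_eq (𝕜 := ℝ)
  rw [((h.smooth m).dAt.hasFDerivAt.clm_apply (contDiffAt_frame h j).dAt.hasFDerivAt).fderiv] at h2
  have h3 := congrArg (fun L => L u) h2
  simp at h3
  linarith

/-- The brackets of the dual frame. -/
theorem fderiv_frame_sub (h : IsCoframeAt η y) (j l : Fin 7) :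
    fderiv ℝ (frame η j) y (frame η l y) - fderiv ℝ (frame η l) y (frame η j y)
      = - ∑ m, structFn η m l j y • frame η m y := by
  rw [← sub_eq_zero]
  apply eq_zero_of_coframe h.indep
  intro m
  simp only [map_sub, map_neg, map_sum, map_smul, coframe_fderiv_frame h, coframe_frame h.indep]
  simp [structFn, dOne_eq (h.smooth m).dAt]
  ring

theorem dOne_sum_left (θ : OneForm Param) (x w : Param) (f : Fin 7 → ℝ) (V : Fin 7 → Param) :
    dOne θ x (∑ m, f m • V m) w = ∑ m, f m * dOne θ x (V m) w := by
  simp only [← dOneBilin_apply]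
  simp

theorem dOne_sum_right (θ : OneForm Param) (x w : Param) (f : Fin 7 → ℝ) (V : Fin 7 → Param) :
    dOne θ x w (∑ m, f m • V m) = ∑ m, f m * dOne θ x w (V m) := by
  simp only [← dOneBilin_apply]
  simp

theorem structFn_swap (η : Fin 7 → OneForm Param) (i j k : Fin 7) (y : Param) :
    structFn η i j k y = - structFn η i k j y := dOne_swap _ _ _ _

/-- `d² = 0` in terms of structure functions. -/
theorem structFn_jacobi (h : IsCoframeAt η y) (i l j k : Fin 7) :
    (fderiv ℝ (structFn η i j k) y (frame η l y) + fderiv ℝ (structFn η i k l) y (frame η j y)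
      + fderiv ℝ (structFn η i l j) y (frame η k y))
      + ∑ m, (structFn η m l j y * structFn η i m k y + structFn η m j k y * structFn η i m l y
        + structFn η m k l y * structFn η i m j y) = 0 := by
  have hf := fun a => (contDiffAt_frame h a).dAt
  have e : ∀ a b c, fderiv ℝ (structFn η i a b) y (frame η c y) = _ := fun a b c =>
    fderiv_dOne (h.smooth i) (hf a) (hf b) (frame η c y)
  have br : ∀ a b c, dOne (η i) y (fderiv ℝ (frame η b) y (frame η a y)) (frame η c y)
      - dOne (η i) y (fderiv ℝ (frame η a) y (frame η b y)) (frame η c y)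
        = - ∑ m, structFn η m a b y * structFn η i m c y := by
    intro a b c
    have h1 := fderiv_frame_sub h b a
    have h2 : dOneBilin (η i) y (fderiv ℝ (frame η b) y (frame η a y)
      - fderiv ℝ (frame η a) y (frame η b y)) (frame η c y) = _ :=
      congrArg (fun t => dOneBilin (η i) y t (frame η c y)) h1
    simpa [dOneBilin_apply, structFn] using h2
  rw [e, e, e, Finset.sum_add_distrib, Finset.sum_add_distrib]
  have b1 := br l j k
  have b2 := br j k l
  have b3 := br k l j
  -- Symmetry of the second derivative of `η i` cancels the terms in which no frame vector is
  -- differentiated; the others pair up into the brackets `br`.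
  have s := (h.smooth i).isSymm
  rw [s (frame η k y) (frame η l y), s (frame η j y) (frame η l y),
    s (frame η k y) (frame η j y)]
  rw [dOne_swap (η i) y (frame η j y), dOne_swap (η i) y (frame η k y) (fderiv ℝ _ _ _),
    dOne_swap (η i) y (frame η l y) (fderiv ℝ _ _ _)]
  linarith

/-- The components of `d (L_X η) = L_X (dη)`. -/
theorem structFn_lie (h : IsCoframeAt η y) {X : Param → Param} (hX : ContDiffAt ℝ ∞ X y)
    (i j k : Fin 7) :
    fderiv ℝ (lieCoeff X η i k) y (frame η j y) - fderiv ℝ (lieCoeff X η i j) y (frame η k y)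
      + ∑ l, lieCoeff X η i l y * structFn η l j k y
      = fderiv ℝ (structFn η i j k) y (X y)
        + ∑ l, (lieCoeff X η l j y * structFn η i l k y
          + lieCoeff X η l k y * structFn η i j l y) := by
  have hf := fun a => (contDiffAt_frame h a).dAt
  have hL := contDiffAt_lieDeriv (h.smooth i) hX
  have c1 : fderiv ℝ (lieCoeff X η i k) y (frame η j y)
      - fderiv ℝ (lieCoeff X η i j) y (frame η k y) = _ := fderiv_apply_sub hL.dAt (hf j) (hf k)
  have c2 : lieDerivOneForm X (η i) y (fderiv ℝ (frame η k) y (frame η j y)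
      - fderiv ℝ (frame η j) y (frame η k y))
        = - ∑ l, lieCoeff X η i l y * structFn η l j k y := by
    rw [fderiv_frame_sub h]
    simp [lieCoeff, mul_comm]
  have c3 : fderiv ℝ (structFn η i j k) y (X y) = _ :=
    fderiv_dOne (h.smooth i) (hf j) (hf k) (X y)
  -- This is the formula [X, e_a] = −∑ (L_X η^l)(e_a) e_l for the action of X on the dual frame.
  have c4 : ∀ a, fderiv ℝ X y (frame η a y)
      = fderiv ℝ (frame η a) y (X y) + ∑ l, lieCoeff X η l a y • frame η l y := by
    intro a
    rw [← sub_eq_zero]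
    apply eq_zero_of_coframe h.indep
    intro m
    simp only [map_sub, map_add, map_sum, map_smul, coframe_fderiv_frame h,
      coframe_frame h.indep]
    simp [lieCoeff, lieDerivOneForm]
  rw [c1, c2, c3, dOne_lieDeriv (h.smooth i) hX, c4, c4, dOne_add_left, dOne_add_right,
    dOne_sum_left, dOne_sum_right, Finset.sum_add_distrib]
  simp only [structFn]
  ring

end Coframe

/-! ### Infinitesimal symmetries in a generic coframe -/

/-- A coframe with the structure equations of a generic hyperbolic system; the roles of the two
characteristic systems are interchangeable. -/
structure IsGenericCoframeAt (ε₁ ε₂ : ℝ) (η : Fin 7 → OneForm Param) (y : Param) : Prop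
    extends IsCoframeAt η y where
  d_zero : ∀ v w, η 0 y v = 0 → η 0 y w = 0 →
    dOne (η 0) y v w = wedge (η 2 y) (η 5 y) v w + wedge (η 1 y) (η 3 y) v w
  d_one : ∀ v w, η 0 y v = 0 → η 1 y v = 0 → η 0 y w = 0 → η 1 y w = 0 →
    dOne (η 1) y v w = wedge (η 3 y) (η 4 y) v w + ε₁ * wedge (η 2 y) (η 6 y) v w
  d_two : ∀ v w, η 0 y v = 0 → η 2 y v = 0 → η 0 y w = 0 → η 2 y w = 0 →
    dOne (η 2) y v w = wedge (η 5 y) (η 6 y) v w + ε₂ * wedge (η 1 y) (η 4 y) v w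
  d_three : ∀ v w, (∀ k ∈ ({0, 1, 3, 4} : Set (Fin 7)), η k y v = 0 ∧ η k y w = 0) →
    dOne (η 3) y v w = 0
  d_four : ∀ v w, (∀ k ∈ ({0, 1, 3, 4} : Set (Fin 7)), η k y v = 0 ∧ η k y w = 0) →
    dOne (η 4) y v w = 0
  d_five : ∀ v w, (∀ k ∈ ({0, 2, 5, 6} : Set (Fin 7)), η k y v = 0 ∧ η k y w = 0) →
    dOne (η 5) y v w = 0
  d_six : ∀ v w, (∀ k ∈ ({0, 2, 5, 6} : Set (Fin 7)), η k y v = 0 ∧ η k y w = 0) →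
    dOne (η 6) y v w = 0

/-- The components of the wedge product of two members of a coframe. -/
def wedgeCoeff (a b j k : Fin 7) : ℝ :=
  (if a = j then 1 else 0) * (if b = k then 1 else 0)
    - (if a = k then 1 else 0) * (if b = j then 1 else 0)

section StructureFunctions

variable {ε₁ ε₂ : ℝ} {η : Fin 7 → OneForm Param} {y : Param}

theorem IsGenericCoframeAt.structFn_zero (h : IsGenericCoframeAt ε₁ ε₂ η y) {j k : Fin 7}
    (hj : j ≠ 0) (hk : k ≠ 0) :
    structFn η 0 j k y = wedgeCoeff 2 5 j k + wedgeCoeff 1 3 j k := by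
  rw [structFn, h.d_zero _ _ (by simp [coframe_frame h.indep, hj.symm])
    (by simp [coframe_frame h.indep, hk.symm])]
  simp [wedge, wedgeCoeff, coframe_frame h.indep]

theorem IsGenericCoframeAt.structFn_one (h : IsGenericCoframeAt ε₁ ε₂ η y) {j k : Fin 7}
    (hj : j ≠ 0) (hj' : j ≠ 1) (hk : k ≠ 0) (hk' : k ≠ 1) :
    structFn η 1 j k y = wedgeCoeff 3 4 j k + ε₁ * wedgeCoeff 2 6 j k := by
  rw [structFn, h.d_one _ _ (by simp [coframe_frame h.indep, hj.symm])
    (by simp [coframe_frame h.indep, hj'.symm]) (by simp [coframe_frame h.indep, hk.symm])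
    (by simp [coframe_frame h.indep, hk'.symm])]
  simp [wedge, wedgeCoeff, coframe_frame h.indep]

theorem IsGenericCoframeAt.structFn_two (h : IsGenericCoframeAt ε₁ ε₂ η y) {j k : Fin 7}
    (hj : j ≠ 0) (hj' : j ≠ 2) (hk : k ≠ 0) (hk' : k ≠ 2) :
    structFn η 2 j k y = wedgeCoeff 5 6 j k + ε₂ * wedgeCoeff 1 4 j k := by
  rw [structFn, h.d_two _ _ (by simp [coframe_frame h.indep, hj.symm])
    (by simp [coframe_frame h.indep, hj'.symm]) (by simp [coframe_frame h.indep, hk.symm])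
    (by simp [coframe_frame h.indep, hk'.symm])]
  simp [wedge, wedgeCoeff, coframe_frame h.indep]

theorem frame_annihilated (h : LinearIndependent ℝ (fun k => η k y)) {K : Set (Fin 7)}
    {j k : Fin 7} (hj : j ∉ K) (hk : k ∉ K) :
    ∀ l ∈ K, η l y (frame η j y) = 0 ∧ η l y (frame η k y) = 0 := by
  intro l hl
  have h1 : l ≠ j := fun e => hj (e ▸ hl)
  have h2 : l ≠ k := fun e => hk (e ▸ hl)
  simp [coframe_frame h, h1, h2]

theorem IsGenericCoframeAt.structFn_three (h : IsGenericCoframeAt ε₁ ε₂ η y) {j k : Fin 7}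
    (hj : j ∉ ({0, 1, 3, 4} : Set (Fin 7))) (hk : k ∉ ({0, 1, 3, 4} : Set (Fin 7))) :
    structFn η 3 j k y = 0 := h.d_three _ _ (frame_annihilated h.indep hj hk)

theorem IsGenericCoframeAt.structFn_four (h : IsGenericCoframeAt ε₁ ε₂ η y) {j k : Fin 7}
    (hj : j ∉ ({0, 1, 3, 4} : Set (Fin 7))) (hk : k ∉ ({0, 1, 3, 4} : Set (Fin 7))) :
    structFn η 4 j k y = 0 := h.d_four _ _ (frame_annihilated h.indep hj hk)

theorem IsGenericCoframeAt.structFn_five (h : IsGenericCoframeAt ε₁ ε₂ η y) {j k : Fin 7}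
    (hj : j ∉ ({0, 2, 5, 6} : Set (Fin 7))) (hk : k ∉ ({0, 2, 5, 6} : Set (Fin 7))) :
    structFn η 5 j k y = 0 := h.d_five _ _ (frame_annihilated h.indep hj hk)

theorem IsGenericCoframeAt.structFn_six (h : IsGenericCoframeAt ε₁ ε₂ η y) {j k : Fin 7}
    (hj : j ∉ ({0, 2, 5, 6} : Set (Fin 7))) (hk : k ∉ ({0, 2, 5, 6} : Set (Fin 7))) :
    structFn η 6 j k y = 0 := h.d_six _ _ (frame_annihilated h.indep hj hk)

end StructureFunctions

/-- The matrix of `L_X` on a generic coframe, for an infinitesimal symmetry `X`. -/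
def symMatrix (ε₁ ε₂ a h h' : ℝ) : Fin 7 → Fin 7 → ℝ :=
  ![![2 * a, 0, 0, 0, 0, 0, 0], ![h, a, 0, 0, 0, 0, 0], ![h', 0, a, 0, 0, 0, 0],
    ![0, 0, 0, a, 0, 0, 0], ![0, 0, 0, ε₂ * h', 0, 0, 0], ![0, 0, 0, 0, 0, a, 0],
    ![0, 0, 0, 0, 0, ε₁ * h, 0]]

theorem fderiv_eq_zero_of_const {E F : Type*} [NormedAddCommGroup E] [NormedSpace ℝ E]
    [NormedAddCommGroup F] [NormedSpace ℝ F] {U : Set E} (hU : IsOpen U) {f : E → F} {c : F}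
    (hf : ∀ y ∈ U, f y = c) {y : E} (hy : y ∈ U) : fderiv ℝ f y = 0 := by
  have : f =ᶠ[𝓝 y] fun _ => c := by
    filter_upwards [hU.mem_nhds hy] with z hz using hf z hz
  rw [this.fderiv_eq (𝕜 := ℝ)]
  simp

section Symmetry

variable {ε₁ ε₂ : ℝ} {η : Fin 7 → OneForm Param} {X : Param → Param} {U : Set Param}

-- Each relation comes from one component of L_X dη^i = d(L_X η^i) in which the structure function
-- is a known constant. The components are taken in an order in which the unknown derivatives have
-- already been shown to vanish, so only linear algebra is left.
set_option maxHeartbeats 2000000 in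
theorem lieCoeff_eq_symMatrix (hU : IsOpen U) (h₁ : ε₁ * ε₁ = 1) (h₂ : ε₂ * ε₂ = 1)
    (hη : ∀ y ∈ U, IsGenericCoframeAt ε₁ ε₂ η y) (hX : ∀ y ∈ U, ContDiffAt ℝ ∞ X y)
    (hI : ∀ y ∈ U, ∀ i ∈ ({0, 1, 2} : Set (Fin 7)), ∀ j ∈ ({3, 4, 5, 6} : Set (Fin 7)),
      lieCoeff X η i j y = 0) :
    ∀ y ∈ U, ∀ i j, lieCoeff X η i j y
      = symMatrix ε₁ ε₂ (lieCoeff X η 1 1 y) (lieCoeff X η 1 0 y) (lieCoeff X η 2 0 y) i j := by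
  have n₁ : ε₁ ≠ 0 := by rintro rfl; simp at h₁
  have n₂ : ε₂ ≠ 0 := by rintro rfl; simp at h₂
  have M := fun y hy i j k => structFn_lie (hη y hy).toIsCoframeAt (hX y hy) i j k
  have c0 := fun y hy j k => (hη y hy).structFn_zero (j := j) (k := k)
  have c1 := fun y hy j k => (hη y hy).structFn_one (j := j) (k := k)
  have c2 := fun y hy j k => (hη y hy).structFn_two (j := j) (k := k)
  have c3 := fun y hy j k => (hη y hy).structFn_three (j := j) (k := k)
  have c4 := fun y hy j k => (hη y hy).structFn_four (j := j) (k := k)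
  have c5 := fun y hy j k => (hη y hy).structFn_five (j := j) (k := k)
  have c6 := fun y hy j k => (hη y hy).structFn_six (j := j) (k := k)
  have D0 := fun j k hj hk y hy => fderiv_eq_zero_of_const hU
    (f := structFn η 0 j k) (fun y hy => c0 y hy j k hj hk) (y := y) hy
  have D1 := fun j k hj hj' hk hk' y hy => fderiv_eq_zero_of_const hU
    (f := structFn η 1 j k) (fun y hy => c1 y hy j k hj hj' hk hk') (y := y) hy
  have D2 := fun j k hj hj' hk hk' y hy => fderiv_eq_zero_of_const hU
    (f := structFn η 2 j k) (fun y hy => c2 y hy j k hj hj' hk hk') (y := y) hy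
  have D3 := fun j k hj hk y hy => fderiv_eq_zero_of_const hU
    (f := structFn η 3 j k) (fun y hy => c3 y hy j k hj hk) (y := y) hy
  have D4 := fun j k hj hk y hy => fderiv_eq_zero_of_const hU
    (f := structFn η 4 j k) (fun y hy => c4 y hy j k hj hk) (y := y) hy
  have D5 := fun j k hj hk y hy => fderiv_eq_zero_of_const hU
    (f := structFn η 5 j k) (fun y hy => c5 y hy j k hj hk) (y := y) hy
  have D6 := fun j k hj hk y hy => fderiv_eq_zero_of_const hU
    (f := structFn η 6 j k) (fun y hy => c6 y hy j k hj hk) (y := y) hy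
  -- A relation established on all of the open set may be differentiated, which removes derivative
  -- terms from the later components.
  have Z : ∀ i j, (∀ y ∈ U, lieCoeff X η i j y = 0) →
      ∀ y ∈ U, fderiv ℝ (lieCoeff X η i j) y = 0 :=
    fun i j hf y hy => fderiv_eq_zero_of_const hU hf hy
  have B0 : ∀ y ∈ U, ∀ i j, i ∈ ({0, 1, 2} : Set (Fin 7)) → j ∈ ({3, 4, 5, 6} : Set (Fin 7)) →
    lieCoeff X η i j y = 0 := fun y hy i j hi hj => hI y hy i hi j hj
  have E0 : ∀ y ∈ U, ∀ i j, i ∈ ({0, 1, 2} : Set (Fin 7)) → j ∈ ({3, 4, 5, 6} : Set (Fin 7)) →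
    fderiv ℝ (lieCoeff X η i j) y = 0 :=
    fun y hy i j hi hj => Z i j (fun z hz => hI z hz i hi j hj) y hy
  -- the equations modulo `I`
  have S1 : ∀ y ∈ U, lieCoeff X η 0 1 y = 0 ∧ lieCoeff X η 0 2 y = 0 := by
    intro y hy
    have m1 := M y hy 0 3 4
    have m2 := M y hy 0 5 6
    simp [Fin.sum_univ_seven, c0 y hy, c1 y hy, c2 y hy, D0 _ _ _ _ y hy, B0 y hy, E0 y hy,
      wedgeCoeff] at m1 m2
    exact ⟨m1, m2⟩
  have S2 : ∀ y ∈ U, lieCoeff X η 1 2 y = 0 ∧ lieCoeff X η 1 1 y = lieCoeff X η 3 3 y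
      + lieCoeff X η 4 4 y ∧ lieCoeff X η 4 5 y = 0 ∧ lieCoeff X η 4 6 y = 0 ∧
      lieCoeff X η 3 5 y = 0 ∧ lieCoeff X η 3 6 y = 0 := by
    intro y hy
    have m1 := M y hy 1 5 6
    have m2 := M y hy 1 3 4
    have m3 := M y hy 1 3 5
    have m4 := M y hy 1 3 6
    have m5 := M y hy 1 4 5
    have m6 := M y hy 1 4 6
    simp [Fin.sum_univ_seven, c0 y hy, c1 y hy, c2 y hy, D1 _ _ _ _ _ _ y hy, B0 y hy, E0 y hy,
      wedgeCoeff] at m1 m2 m3 m4 m5 m6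
    refine ⟨?_, ?_, ?_, ?_, ?_, ?_⟩ <;> linarith
  have S3 : ∀ y ∈ U, lieCoeff X η 2 1 y = 0 ∧ lieCoeff X η 2 2 y = lieCoeff X η 5 5 y
      + lieCoeff X η 6 6 y ∧ lieCoeff X η 6 3 y = 0 ∧ lieCoeff X η 6 4 y = 0 ∧
      lieCoeff X η 5 3 y = 0 ∧ lieCoeff X η 5 4 y = 0 := by
    intro y hy
    have m1 := M y hy 2 3 4
    have m2 := M y hy 2 5 6
    have m3 := M y hy 2 5 3
    have m4 := M y hy 2 5 4
    have m5 := M y hy 2 6 3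
    have m6 := M y hy 2 6 4
    simp [Fin.sum_univ_seven, c0 y hy, c1 y hy, c2 y hy, D2 _ _ _ _ _ _ y hy, B0 y hy, E0 y hy,
      wedgeCoeff] at m1 m2 m3 m4 m5 m6
    refine ⟨?_, ?_, ?_, ?_, ?_, ?_⟩ <;> linarith
  have E1 : ∀ y ∈ U, fderiv ℝ (lieCoeff X η 0 1) y = 0 ∧ fderiv ℝ (lieCoeff X η 0 2) y = 0 ∧
      fderiv ℝ (lieCoeff X η 1 2) y = 0 ∧ fderiv ℝ (lieCoeff X η 2 1) y = 0 := fun y hy =>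
    ⟨Z _ _ (fun z hz => (S1 z hz).1) y hy, Z _ _ (fun z hz => (S1 z hz).2) y hy,
      Z _ _ (fun z hz => (S2 z hz).1) y hy, Z _ _ (fun z hz => (S3 z hz).1) y hy⟩
  -- the equations modulo `I^{(1)}`, `M₁`, `M₂`
  have S4 : ∀ y ∈ U, lieCoeff X η 0 0 y = lieCoeff X η 1 1 y + lieCoeff X η 3 3 y ∧
      lieCoeff X η 0 0 y = lieCoeff X η 2 2 y + lieCoeff X η 5 5 y ∧
      lieCoeff X η 3 4 y = 0 ∧ lieCoeff X η 5 6 y = 0 ∧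
      lieCoeff X η 3 2 y = lieCoeff X η 5 1 y := by
    intro y hy
    obtain ⟨e1, e2, e3, e4⟩ := E1 y hy
    obtain ⟨s1, s2⟩ := S1 y hy
    obtain ⟨t1, t2, t3, t4, t5, t6⟩ := S2 y hy
    obtain ⟨u1, u2, u3, u4, u5, u6⟩ := S3 y hy
    have m1 := M y hy 0 1 3
    have m2 := M y hy 0 1 4
    have m3 := M y hy 0 2 5
    have m4 := M y hy 0 2 6
    have m5 := M y hy 0 1 2
    simp [Fin.sum_univ_seven, c0 y hy, D0 _ _ _ _ y hy, B0 y hy, E0 y hy, s1, s2, t1, u1, e1, e2,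
      t3, t4, t5, t6, u3, u4, u5, u6, wedgeCoeff] at m1 m2 m3 m4 m5
    refine ⟨?_, ?_, ?_, ?_, ?_⟩ <;> linarith
  have S5 : ∀ y ∈ U, lieCoeff X η 4 2 y = 0 ∧ lieCoeff X η 3 2 y = 0 ∧
      lieCoeff X η 1 0 y = ε₁ * lieCoeff X η 6 5 y ∧
      lieCoeff X η 1 1 y = lieCoeff X η 2 2 y + lieCoeff X η 6 6 y := by
    intro y hy
    obtain ⟨e1, e2, e3, e4⟩ := E1 y hy
    obtain ⟨s1, s2⟩ := S1 y hy
    obtain ⟨t1, t2, t3, t4, t5, t6⟩ := S2 y hy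
    obtain ⟨u1, u2, u3, u4, u5, u6⟩ := S3 y hy
    have m1 := M y hy 1 2 3
    have m2 := M y hy 1 2 4
    have m3 := M y hy 1 2 5
    have m4 := M y hy 1 2 6
    simp [Fin.sum_univ_seven, c0 y hy, c1 y hy, D1 _ _ _ _ _ _ y hy, B0 y hy, E0 y hy, s2,
      t1, e3, t3, t4, t5, t6, u3, u4, u5, u6, wedgeCoeff] at m1 m2 m3 m4
    refine ⟨by linarith, by linarith, by linarith, mul_left_cancel₀ n₁ (by linarith)⟩
  have S6 : ∀ y ∈ U, lieCoeff X η 6 1 y = 0 ∧ lieCoeff X η 2 0 y = ε₂ * lieCoeff X η 4 3 y ∧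
      lieCoeff X η 2 2 y = lieCoeff X η 1 1 y + lieCoeff X η 4 4 y := by
    intro y hy
    obtain ⟨e1, e2, e3, e4⟩ := E1 y hy
    obtain ⟨s1, s2⟩ := S1 y hy
    obtain ⟨t1, t2, t3, t4, t5, t6⟩ := S2 y hy
    obtain ⟨u1, u2, u3, u4, u5, u6⟩ := S3 y hy
    have m1 := M y hy 2 1 5
    have m3 := M y hy 2 1 3
    have m4 := M y hy 2 1 4
    simp [Fin.sum_univ_seven, c0 y hy, c2 y hy, D2 _ _ _ _ _ _ y hy, B0 y hy, E0 y hy, s1,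
      u1, e4, t3, t5, u3, u4, u5, u6, wedgeCoeff] at m1 m3 m4
    refine ⟨by linarith, by linarith, mul_left_cancel₀ n₂ (by linarith)⟩
  -- The component of dη⁰ on e_1, e_2 equates this entry with the (3, 2) entry, and dη¹ kills the
  -- latter.
  have S51 : ∀ y ∈ U, lieCoeff X η 5 1 y = 0 := fun y hy =>
    (S4 y hy).2.2.2.2.symm.trans (S5 y hy).2.1
  -- the equations for the last four forms
  have S7 : ∀ y ∈ U, lieCoeff X η 3 0 y = 0 ∧ lieCoeff X η 3 1 y = 0 ∧
      lieCoeff X η 4 0 y = 0 ∧ lieCoeff X η 4 1 y = 0 := by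
    intro y hy
    obtain ⟨s1, s2⟩ := S1 y hy
    obtain ⟨t1, t2, t3, t4, t5, t6⟩ := S2 y hy
    obtain ⟨v1, v2, v3, v4, v5⟩ := S4 y hy
    obtain ⟨w1, w2, w3, w4⟩ := S5 y hy
    have f1 := Z _ _ (fun z hz => (S5 z hz).1) y hy
    have f2 := Z _ _ (fun z hz => (S5 z hz).2.1) y hy
    have f3 := Z _ _ (fun z hz => (S2 z hz).2.2.1) y hy
    have f4 := Z _ _ (fun z hz => (S2 z hz).2.2.2.1) y hy
    have f5 := Z _ _ (fun z hz => (S2 z hz).2.2.2.2.1) y hy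
    have f6 := Z _ _ (fun z hz => (S2 z hz).2.2.2.2.2) y hy
    have m1 := M y hy 3 2 5
    have m2 := M y hy 3 2 6
    have m3 := M y hy 4 2 5
    have m4 := M y hy 4 2 6
    simp [Fin.sum_univ_seven, c0 y hy, c1 y hy, c3 y hy, c4 y hy, D3 _ _ _ _ y hy,
      D4 _ _ _ _ y hy, B0 y hy, s2, t1, t3, t4, t5, t6, v3, w1, w2, f1, f2, f3, f4, f5, f6,
      n₁, wedgeCoeff] at m1 m2 m3 m4
    exact ⟨m1, m2, m3, m4⟩
  have S8 : ∀ y ∈ U, lieCoeff X η 5 0 y = 0 ∧ lieCoeff X η 5 2 y = 0 ∧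
      lieCoeff X η 6 0 y = 0 ∧ lieCoeff X η 6 2 y = 0 := by
    intro y hy
    obtain ⟨s1, s2⟩ := S1 y hy
    obtain ⟨u1, u2, u3, u4, u5, u6⟩ := S3 y hy
    obtain ⟨v1, v2, v3, v4, v5⟩ := S4 y hy
    obtain ⟨w1, w2, w3⟩ := S6 y hy
    have w5 := S51 y hy
    have f1 := Z _ _ (fun z hz => (S6 z hz).1) y hy
    have f2 := Z _ _ S51 y hy
    have f3 := Z _ _ (fun z hz => (S3 z hz).2.2.1) y hy
    have f4 := Z _ _ (fun z hz => (S3 z hz).2.2.2.1) y hy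
    have f5 := Z _ _ (fun z hz => (S3 z hz).2.2.2.2.1) y hy
    have f6 := Z _ _ (fun z hz => (S3 z hz).2.2.2.2.2) y hy
    have m1 := M y hy 5 1 3
    have m2 := M y hy 5 1 4
    have m3 := M y hy 6 1 3
    have m4 := M y hy 6 1 4
    simp [Fin.sum_univ_seven, c0 y hy, c2 y hy, c5 y hy, c6 y hy, D5 _ _ _ _ y hy,
      D6 _ _ _ _ y hy, B0 y hy, s1, u1, u3, u4, u5, u6, v4, w1, w5, f1, f2, f3, f4, f5, f6,
      n₂, wedgeCoeff] at m1 m2 m3 m4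
    exact ⟨m1, m2, m3, m4⟩
  intro y hy
  obtain ⟨s1, s2⟩ := S1 y hy
  obtain ⟨t1, t2, t3, t4, t5, t6⟩ := S2 y hy
  obtain ⟨u1, u2, u3, u4, u5, u6⟩ := S3 y hy
  obtain ⟨v1, v2, v3, v4, v5⟩ := S4 y hy
  obtain ⟨w1, w2, w3, w4⟩ := S5 y hy
  obtain ⟨x1, x2, x3⟩ := S6 y hy
  obtain ⟨y1, y2, y3, y4⟩ := S7 y hy
  obtain ⟨z1, z2, z3, z4⟩ := S8 y hy
  have w5 := S51 y hy
  -- The six linear relations among the diagonal entries force the (1, 1) and (2, 2) entries to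
  -- agree, so the entries of η⁴ and η⁶ vanish.
  have q1 : lieCoeff X η 4 4 y = 0 := by linarith
  have q2 : lieCoeff X η 6 6 y = 0 := by linarith
  have q3 : lieCoeff X η 4 3 y = ε₂ * lieCoeff X η 2 0 y := by
    rw [x2, ← mul_assoc, h₂, one_mul]
  have q4 : lieCoeff X η 6 5 y = ε₁ * lieCoeff X η 1 0 y := by
    rw [w3, ← mul_assoc, h₁, one_mul]
  intro i j
  fin_cases i <;> fin_cases j <;>
    simp [symMatrix, B0 y hy, s1, s2, t1, t3, t4, t5, t6, u1, u3, u4, u5, u6, v3, v4, w1, w2,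
      x1, y1, y2, y3, y4, z1, z2, z3, z4, w5, q1, q2, q3, q4] <;> linarith

end Symmetry

/-! ### Determination of symmetries by their values and isotropy parameters -/

open Asymptotics in
/-- A solution of a homogeneous linear total differential equation vanishes near its zeros. -/
theorem eventually_eq_zero_of_fderiv_isBigO {E F : Type*} [NormedAddCommGroup E] [NormedSpace ℝ E]
    [NormedAddCommGroup F] [NormedSpace ℝ F] {f : E → F} {p : E}
    (hd : ∀ᶠ y in 𝓝 p, DifferentiableAt ℝ f y) (hO : fderiv ℝ f =O[𝓝 p] f) (h0 : f p = 0) :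
    ∀ᶠ y in 𝓝 p, f y = 0 := by
  obtain ⟨C, hC⟩ := hO.bound
  obtain ⟨r, hr, hb⟩ := Metric.eventually_nhds_iff_ball.1 (hd.and hC)
  filter_upwards [Metric.ball_mem_nhds p hr] with y hy
  set l : ℝ → E := fun t => p + t • (y - p) with hl
  have hmem : ∀ t ∈ Set.Icc (0 : ℝ) 1, l t ∈ Metric.ball p r := by
    intro t ht
    rw [mem_ball_iff_norm, hl]
    rw [mem_ball_iff_norm] at hy
    calc ‖p + t • (y - p) - p‖ = |t| * ‖y - p‖ := by
          rw [add_sub_cancel_left, norm_smul, Real.norm_eq_abs]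
      _ ≤ 1 * ‖y - p‖ := by
          gcongr
          exact abs_le.2 ⟨by linarith [ht.1], ht.2⟩
      _ < r := by rwa [one_mul]
  have hlD : ∀ t, HasDerivAt l (y - p) t := by
    intro t
    simpa [hl] using (((hasDerivAt_id t).smul_const (y - p)).const_add p :
      HasDerivAt (fun s => p + id s • (y - p)) _ t)
  have hg : ∀ t ∈ Set.Icc (0 : ℝ) 1,
      HasDerivAt (fun s => f (l s)) (fderiv ℝ f (l t) (y - p)) t := fun t ht =>
    (hb _ (hmem t ht)).1.hasFDerivAt.comp_hasDerivAt t (hlD t)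
  -- Grönwall's inequality along the segment from p to y, with initial value 0 and no inhomogeneous
  -- term.
  have key := norm_le_gronwallBound_of_norm_deriv_right_le (f := fun s => f (l s))
    (f' := fun t => fderiv ℝ f (l t) (y - p)) (δ := 0) (K := C * ‖y - p‖) (ε := 0) (a := 0) (b := 1)
    (fun t ht => (hg t ht).continuousAt.continuousWithinAt)
    (fun t ht => (hg t ⟨ht.1, ht.2.le⟩).hasDerivWithinAt) (by simp [hl, h0])
    (fun t ht => by
      have h1 := (hb _ (hmem t ⟨ht.1, ht.2.le⟩)).2
      calc ‖fderiv ℝ f (l t) (y - p)‖ ≤ ‖fderiv ℝ f (l t)‖ * ‖y - p‖ :=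
            ContinuousLinearMap.le_opNorm _ _
        _ ≤ (C * ‖f (l t)‖) * ‖y - p‖ := by gcongr
        _ = C * ‖y - p‖ * ‖f (l t)‖ + 0 := by ring)
    1 ⟨zero_le_one, le_rfl⟩
  rw [gronwallBound_ε0_δ0] at key
  simpa [hl] using key

section Determination

variable {ε₁ ε₂ : ℝ} {η : Fin 7 → OneForm Param} {X : Param → Param} {p : Param}
  {I : CotangentField Param}

/-- The structure of an infinitesimal symmetry near a point: it acts on the coframe through the
isotropy algebra. -/
def ActsGenericallyNear (ε₁ ε₂ : ℝ) (η : Fin 7 → OneForm Param) (p : Param) (X : Param → Param) :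
    Prop :=
  ∀ᶠ y in 𝓝 p, ContDiffAt ℝ ∞ X y ∧ ∀ i j, lieCoeff X η i j y
    = symMatrix ε₁ ε₂ (lieCoeff X η 1 1 y) (lieCoeff X η 1 0 y) (lieCoeff X η 2 0 y) i j

theorem genBy_apply_eq_zero {K : Set (Fin 7)} {y v : Param} {α : Param →L[ℝ] ℝ}
    (hα : α ∈ genBy η K y) (hv : ∀ k ∈ K, η k y v = 0) : α v = 0 := by
  induction hα using Submodule.span_induction with
  | mem _ hx => obtain ⟨k, hk, rfl⟩ := hx; exact hv k hk
  | zero => rfl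
  | add a b _ _ ha hb => simp [ha, hb]
  | smul c a _ ha => simp [ha]

theorem mem_genBy {K : Set (Fin 7)} {y : Param} {k : Fin 7} (hk : k ∈ K) : η k y ∈ genBy η K y :=
  Submodule.subset_span ⟨k, hk, rfl⟩

/-- The forms η⁰, η¹, η² are sections of I, so their Lie derivatives stay in I and vanish on e_3, …,
e_6. This is the only input that `lieCoeff_eq_symMatrix` needs from the symmetry condition. -/
theorem IsInfSymmetryNear.actsGenerically (h₁ : ε₁ * ε₁ = 1) (h₂ : ε₂ * ε₂ = 1)
    (hη : ∀ᶠ y in 𝓝 p, IsGenericCoframeAt ε₁ ε₂ η y)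
    (hI : ∀ᶠ y in 𝓝 p, I y = genBy η {0, 1, 2} y) (hX : IsInfSymmetryNear I p X) :
    ActsGenericallyNear ε₁ ε₂ η p X := by
  obtain ⟨U, hU, hUo, hpU⟩ := eventually_nhds_iff.1 ((hη.and hI).and hX)
  have key := lieCoeff_eq_symMatrix hUo h₁ h₂ (fun y hy => (hU y hy).1.1)
    (fun y hy => (hU y hy).2.1) (fun y hy i hi j hj => by
      have hsec : IsLocalSection I y (η i) := by
        filter_upwards [hUo.mem_nhds hy] with z hz
        refine ⟨(hU z hz).1.1.smooth i, ?_⟩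
        rw [(hU z hz).1.2]
        exact mem_genBy hi
      have hmem := (hU y hy).2.2 _ hsec
      rw [(hU y hy).1.2] at hmem
      refine genBy_apply_eq_zero hmem fun k hk => ?_
      rw [coframe_frame (hU y hy).1.1.indep, if_neg]
      rintro rfl
      simp only [Set.mem_insert_iff, Set.mem_singleton_iff] at hk hj
      omega)
  filter_upwards [hUo.mem_nhds hpU] with y hy using ⟨(hU y hy).2.1, key y hy⟩

/-- The value and the isotropy parameters of a vector field. -/
def symData (X : Param → Param) (η : Fin 7 → OneForm Param) (y : Param) : Param × ℝ × ℝ × ℝ :=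
  (X y, lieCoeff X η 1 1 y, lieCoeff X η 1 0 y, lieCoeff X η 2 0 y)

open Asymptotics

theorem isBigO_one_of_contDiffAt {F : Type*} [NormedAddCommGroup F] [NormedSpace ℝ F]
    {f : Param → F} (h : ContDiffAt ℝ ∞ f p) : f =O[𝓝 p] fun _ => (1 : ℝ) :=
  h.continuousAt.norm.isBoundedUnder_le.isBigO_one ℝ

theorem isBigO_of_frame {F G : Type*} [NormedAddCommGroup F] [NormedSpace ℝ F]
    [NormedAddCommGroup G] {g : Param → Param →L[ℝ] F} {Y : Param → G} (hη : IsCoframeAt η p)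
    (h : ∀ k, (fun y => g y (frame η k y)) =O[𝓝 p] Y) : g =O[𝓝 p] Y := by
  have e : g =ᶠ[𝓝 p] fun y => ∑ k, (η k y).smulRight (g y (frame η k y)) := by
    filter_upwards [hη.eventually] with y hy
    ext v
    conv_lhs => rw [← sum_frame hy v]
    simp
  refine e.trans_isBigO (IsBigO.fun_sum fun k _ => ?_)
  have h1 := (isBigO_one_of_contDiffAt (hη.smooth k)).norm_norm.mul (h k).norm_norm
  refine IsBigO.trans (IsBigO.of_bound 1 (Eventually.of_forall fun y => ?_))
    (h1.trans (IsBigO.of_bound 1 (Eventually.of_forall fun y => ?_)))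
  · simp [ContinuousLinearMap.norm_smulRight_apply]
  · simp

theorem lieCoeff_isBigO (hX : ActsGenericallyNear ε₁ ε₂ η p X) (a b : Fin 7) :
    lieCoeff X η a b =O[𝓝 p] symData X η := by
  have o1 : lieCoeff X η 1 1 =O[𝓝 p] symData X η := isBigO_fst_prod.trans isBigO_snd_prod
  have o2 : lieCoeff X η 1 0 =O[𝓝 p] symData X η :=
    (isBigO_fst_prod.trans isBigO_snd_prod).trans isBigO_snd_prod
  have o3 : lieCoeff X η 2 0 =O[𝓝 p] symData X η :=
    (isBigO_snd_prod.trans isBigO_snd_prod).trans isBigO_snd_prod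
  have e : lieCoeff X η a b =ᶠ[𝓝 p] fun y => symMatrix ε₁ ε₂ (lieCoeff X η 1 1 y)
        (lieCoeff X η 1 0 y) (lieCoeff X η 2 0 y) a b := by
      filter_upwards [hX] with y hy using hy.2 a b
  refine e.trans_isBigO ?_
  fin_cases a <;> fin_cases b <;>
      first
      | exact isBigO_zero _ _
      | exact o1
      | exact o2
      | exact o3
      | exact o1.const_mul_left _
      | exact o2.const_mul_left _
      | exact o3.const_mul_left _

/-- The definition of L_X η^i, solved for the derivative of X, expresses that derivative linearly
through X and the entries of the isotropy matrix. -/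
theorem fderiv_symmetry_isBigO (hη : ∀ᶠ y in 𝓝 p, IsCoframeAt η y)
    (hX : ActsGenericallyNear ε₁ ε₂ η p X) : fderiv ℝ X =O[𝓝 p] symData X η := by
  have hp := hη.self_of_nhds
  have oX : X =O[𝓝 p] symData X η := isBigO_fst_prod
  refine isBigO_of_frame hp fun k => ?_
  have e : (fun y => fderiv ℝ X y (frame η k y)) =ᶠ[𝓝 p] fun y =>
      ∑ i, (lieCoeff X η i k y - fderiv ℝ (η i) y (X y) (frame η k y)) • frame η i y := by
    filter_upwards [hη] with y hy
    conv_lhs => rw [← sum_frame hy.indep (fderiv ℝ X y (frame η k y))]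
    refine Finset.sum_congr rfl fun i _ => ?_
    simp [lieCoeff, lieDerivOneForm]
  refine e.trans_isBigO (IsBigO.fun_sum fun i _ => ?_)
  have oF : ∀ j, frame η j =O[𝓝 p] fun _ => (1 : ℝ) := fun j =>
    isBigO_one_of_contDiffAt (contDiffAt_frame hp j)
  have h1 : (fun y => fderiv ℝ (η i) y (X y) (frame η k y)) =O[𝓝 p] symData X η := by
    have h2 := ((isBigO_one_of_contDiffAt (hp.smooth i).smooth_fderiv).norm_left.mul
      oX.norm_norm).mul (oF k).norm_left
    refine IsBigO.trans (IsBigO.of_bound 1 (Eventually.of_forall fun y => ?_)) (h2.trans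
      (IsBigO.of_bound 1 (Eventually.of_forall fun y => ?_)))
    · simpa using (fderiv ℝ (η i) y).le_opNorm₂ (X y) (frame η k y)
    · simp
  have h3 := ((lieCoeff_isBigO hX i k).sub h1).norm_right.smul (oF i)
  simpa using h3.norm_right

/-- In the (j, k) component of L_X dη^i = d(L_X η^i), only e_k of the (i, j) entry and e_j of the
(i, k) entry of the isotropy matrix are differentiated. If the second entry is identically 0, the
first derivative is linear in X and the isotropy parameters. -/
theorem fderiv_lieCoeff_isBigO (hη : ∀ᶠ y in 𝓝 p, IsCoframeAt η y)
    (hX : ActsGenericallyNear ε₁ ε₂ η p X) (i j k : Fin 7)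
    (hik : ∀ a h h', symMatrix ε₁ ε₂ a h h' i k = 0) :
    (fun y => fderiv ℝ (lieCoeff X η i j) y (frame η k y)) =O[𝓝 p] symData X η := by
  have hp := hη.self_of_nhds
  have hXp := hX.self_of_nhds.1
  have oX : X =O[𝓝 p] symData X η := isBigO_fst_prod
  have oB := lieCoeff_isBigO hX
  have oc : ∀ a b c, structFn η a b c =O[𝓝 p] fun _ => (1 : ℝ) := fun a b c =>
    isBigO_one_of_contDiffAt (contDiffAt_structFn hp a b c)
  have oBc : ∀ a b c d e, (fun y => lieCoeff X η a b y * structFn η c d e y)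
      =O[𝓝 p] symData X η := by
    intro a b c d e
    have := (oB a b).norm_right.mul (oc c d e)
    simpa using this.norm_right
  have oX' : ∀ a b c, (fun y => fderiv ℝ (structFn η a b c) y (X y)) =O[𝓝 p] symData X η := by
    intro a b c
    have h1 := (isBigO_one_of_contDiffAt (contDiffAt_structFn hp a b c).smooth_fderiv).norm_left.mul
      oX.norm_norm
    refine IsBigO.trans (IsBigO.of_bound 1 (Eventually.of_forall fun y => ?_)) (h1.trans
      (IsBigO.of_bound 1 (Eventually.of_forall fun y => ?_)))
    · simpa using (fderiv ℝ (structFn η a b c) y).le_opNorm (X y)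
    · simp
  have e : (fun y => fderiv ℝ (lieCoeff X η i j) y (frame η k y)) =ᶠ[𝓝 p] fun y =>
      ∑ l, lieCoeff X η i l y * structFn η l j k y - fderiv ℝ (structFn η i j k) y (X y)
        - ∑ l, (lieCoeff X η l j y * structFn η i l k y
          + lieCoeff X η l k y * structFn η i j l y) := by
    filter_upwards [hη, hX, eventually_eventually_nhds.2 hX] with y hy hXy hXn
    have h1 := structFn_lie hy hXy.1 i j k
    have h2 : fderiv ℝ (lieCoeff X η i k) y = 0 := by
      have : lieCoeff X η i k =ᶠ[𝓝 y] fun _ => 0 := by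
        filter_upwards [hXn] with z hz
        rw [hz.2, hik]
      rw [this.fderiv_eq (𝕜 := ℝ)]
      simp
    rw [h2] at h1
    simp only [zero_apply] at h1
    linarith
  refine e.trans_isBigO (((IsBigO.fun_sum fun l _ => oBc _ _ _ _ _).sub (oX' _ _ _)).sub
    (IsBigO.fun_sum fun l _ => (oBc _ _ _ _ _).add (oBc _ _ _ _ _)))

theorem contDiffAt_symData (hη : IsCoframeAt η p) (hX : ContDiffAt ℝ ∞ X p) :
    ContDiffAt ℝ ∞ (symData X η) p :=
  hX.prodMk ((contDiffAt_lieCoeff hη hX 1 1).prodMk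
    ((contDiffAt_lieCoeff hη hX 1 0).prodMk (contDiffAt_lieCoeff hη hX 2 0)))

theorem hasFDerivAt_symData (hη : IsCoframeAt η p) (hX : ContDiffAt ℝ ∞ X p) :
    HasFDerivAt (symData X η) ((fderiv ℝ X p).prod ((fderiv ℝ (lieCoeff X η 1 1) p).prod
      ((fderiv ℝ (lieCoeff X η 1 0) p).prod (fderiv ℝ (lieCoeff X η 2 0) p)))) p := by
  have d := fun i j => (contDiffAt_lieCoeff hη hX i j).dAt.hasFDerivAt
  exact HasFDerivAt.prodMk hX.dAt.hasFDerivAt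
    (HasFDerivAt.prodMk (d 1 1) (HasFDerivAt.prodMk (d 1 0) (d 2 0)))

theorem fderiv_symData_isBigO (hη : ∀ᶠ y in 𝓝 p, IsCoframeAt η y)
    (hX : ∀ᶠ y in 𝓝 p, ContDiffAt ℝ ∞ X y) {G : Type*} [NormedAddCommGroup G] {Y : Param → G}
    (oX : fderiv ℝ X =O[𝓝 p] Y) (oa : fderiv ℝ (lieCoeff X η 1 1) =O[𝓝 p] Y)
    (ob : fderiv ℝ (lieCoeff X η 1 0) =O[𝓝 p] Y) (oc : fderiv ℝ (lieCoeff X η 2 0) =O[𝓝 p] Y) :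
    fderiv ℝ (symData X η) =O[𝓝 p] Y := by
  have h := oX.prod_left (oa.prod_left (ob.prod_left oc))
  refine IsBigO.trans (IsBigO.of_bound 1 ?_) h
  filter_upwards [hη, hX] with y hy hXy
  rw [(hasFDerivAt_symData hy hXy).fderiv, one_mul]
  simp only [ContinuousLinearMap.opNorm_prod, Prod.norm_def]
  exact le_rfl

/-- A symmetry is determined by its value and its isotropy parameters at a point. -/
theorem eventually_eq_zero_of_symData (h₁ : ε₁ * ε₁ = 1) (h₂ : ε₂ * ε₂ = 1)
    (hη : ∀ᶠ y in 𝓝 p, IsCoframeAt η y) (hX : ActsGenericallyNear ε₁ ε₂ η p X)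
    (h0 : symData X η p = 0) : X =ᶠ[𝓝 p] 0 := by
  have n₁ : ε₁ ≠ 0 := by rintro rfl; simp at h₁
  have n₂ : ε₂ ≠ 0 := by rintro rfl; simp at h₂
  have hp := hη.self_of_nhds
  have hXp := hX.self_of_nhds.1
  have oD := fderiv_lieCoeff_isBigO hη hX
  have scale : ∀ (i j i' j' : Fin 7) (c : ℝ), (∀ᶠ y in 𝓝 p, lieCoeff X η i j y
      = c * lieCoeff X η i' j' y) → ∀ k,
      (fun y => fderiv ℝ (lieCoeff X η i' j') y (frame η k y)) =O[𝓝 p] symData X η →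
      (fun y => fderiv ℝ (lieCoeff X η i j) y (frame η k y)) =O[𝓝 p] symData X η := by
    intro i j i' j' c he k ho
    have e : (fun y => fderiv ℝ (lieCoeff X η i j) y (frame η k y)) =ᶠ[𝓝 p]
        fun y => c * fderiv ℝ (lieCoeff X η i' j') y (frame η k y) := by
      filter_upwards [eventually_eventually_nhds.2 he, hη, hX] with y hy hηy hXy
      have : lieCoeff X η i j =ᶠ[𝓝 y] fun z => c * lieCoeff X η i' j' z := hy
      rw [this.fderiv_eq (𝕜 := ℝ), fderiv_const_mul (contDiffAt_lieCoeff hηy hXy.1 i' j').dAt]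
      rfl
    exact e.trans_isBigO (ho.const_mul_left c)
  have oa : fderiv ℝ (lieCoeff X η 1 1) =O[𝓝 p] symData X η := by
    refine isBigO_of_frame hp fun k => ?_
    -- The parameter a occurs at (3, 3) and, doubled, at (0, 0). Row 0 has no entry in columns k ≠ 0
    -- and row 3 none in column 0, so every direction e_k is covered.
    by_cases hk : k = 0
    · subst hk
      refine scale _ _ 3 3 1 ?_ _ (oD 3 3 0 (by simp [symMatrix]))
      filter_upwards [hX] with y hy
      rw [hy.2 3 3]; simp [symMatrix]
    · refine scale _ _ 0 0 (1 / 2) ?_ _ (oD 0 0 k ?_)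
      · filter_upwards [hX] with y hy
        rw [hy.2 0 0]; simp [symMatrix]
      · fin_cases k <;> simp_all [symMatrix]
  have ob : fderiv ℝ (lieCoeff X η 1 0) =O[𝓝 p] symData X η := by
    refine isBigO_of_frame hp fun k => ?_
    -- Row 1 vanishes in the columns other than 0 and 1; for these two the copy ε₁h at (6, 5)
    -- serves.
    by_cases hk : k = 0 ∨ k = 1
    · refine scale _ _ 6 5 ε₁ ?_ _ (oD 6 5 k ?_)
      · filter_upwards [hX] with y hy
        rw [hy.2 6 5]; simp [symMatrix, ← mul_assoc, h₁]
      · rcases hk with rfl | rfl <;> simp [symMatrix]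
    · refine oD 1 0 k ?_
      fin_cases k <;> simp_all [symMatrix]
  have oc : fderiv ℝ (lieCoeff X η 2 0) =O[𝓝 p] symData X η := by
    refine isBigO_of_frame hp fun k => ?_
    -- Likewise with row 2 and the copy ε₂h' at (4, 3).
    by_cases hk : k = 0 ∨ k = 2
    · refine scale _ _ 4 3 ε₂ ?_ _ (oD 4 3 k ?_)
      · filter_upwards [hX] with y hy
        rw [hy.2 4 3]; simp [symMatrix, ← mul_assoc, h₂]
      · rcases hk with rfl | rfl <;> simp [symMatrix]
    · refine oD 2 0 k ?_
      fin_cases k <;> simp_all [symMatrix]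
  have oX := fderiv_symmetry_isBigO hη hX
  have hO := fderiv_symData_isBigO hη (hX.mono fun y hy => hy.1) oX oa ob oc
  have hz := eventually_eq_zero_of_fderiv_isBigO (p := p) (f := symData X η) (by
    filter_upwards [hη, hX] with y hy hXy using (contDiffAt_symData hy hXy.1).dAt) hO h0
  filter_upwards [hz] with y hy
  exact congrArg Prod.fst hy

end Determination

/-! ### Maximal symmetry -/

section MaximalSymmetry

variable {ε₁ ε₂ : ℝ} {η : Fin 7 → OneForm Param} {X Y : Param → Param} {p : Param}
  {I : CotangentField Param}

theorem lieCoeff_add (hX : DifferentiableAt ℝ X p) (hY : DifferentiableAt ℝ Y p) (i j : Fin 7) :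
    lieCoeff (X + Y) η i j p = lieCoeff X η i j p + lieCoeff Y η i j p := by
  simp [lieCoeff, lieDerivOneForm, fderiv_add hX hY]
  ring

theorem lieCoeff_smul (c : ℝ) (hX : DifferentiableAt ℝ X p) (i j : Fin 7) :
    lieCoeff (c • X) η i j p = c * lieCoeff X η i j p := by
  simp [lieCoeff, lieDerivOneForm, fderiv_const_smul hX]
  ring

theorem lieCoeff_congr (h : X =ᶠ[𝓝 p] Y) (i j : Fin 7) :
    lieCoeff X η i j p = lieCoeff Y η i j p := by
  simp [lieCoeff, lieDerivOneForm, h.eq_of_nhds, h.fderiv_eq (𝕜 := ℝ)]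

theorem structFn_self (η : Fin 7 → OneForm Param) (i j : Fin 7) (y : Param) :
    structFn η i j j y = 0 := dOne_self _ _ _

/-- At a zero of a symmetry without dilation part, the two remaining isotropy parameters determine
each other. -/
theorem isotropy_relations (h₁ : ε₁ * ε₁ = 1) (h₂ : ε₂ * ε₂ = 1)
    (hη : ∀ᶠ y in 𝓝 p, IsGenericCoframeAt ε₁ ε₂ η y) (hX : ActsGenericallyNear ε₁ ε₂ η p X)
    (h0 : X p = 0) (ha : lieCoeff X η 1 1 p = 0) :
    (lieCoeff X η 2 0 p = 0 → lieCoeff X η 1 0 p = 0) ∧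
    (lieCoeff X η 1 0 p = 0 → lieCoeff X η 2 0 p = 0) := by
  have n₁ : ε₁ ≠ 0 := by rintro rfl; simp at h₁
  have n₂ : ε₂ ≠ 0 := by rintro rfl; simp at h₂
  have hp := hη.self_of_nhds
  have hXp := hX.self_of_nhds
  have B := hXp.2
  have c0 := fun j k => hp.structFn_zero (j := j) (k := k)
  have Z : ∀ i j, (∀ a h h', symMatrix ε₁ ε₂ a h h' i j = 0) →
      fderiv ℝ (lieCoeff X η i j) p = 0 := by
    intro i j hij
    have : lieCoeff X η i j =ᶠ[𝓝 p] fun _ => 0 := by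
      filter_upwards [hX] with z hz
      rw [hz.2, hij]
    rw [this.fderiv_eq (𝕜 := ℝ)]
    simp
  have D : ∀ k, fderiv ℝ (lieCoeff X η 0 0) p (frame η k p)
      = 2 * fderiv ℝ (lieCoeff X η 1 1) p (frame η k p) := by
    intro k
    have : lieCoeff X η 0 0 =ᶠ[𝓝 p] fun z => 2 * lieCoeff X η 1 1 z := by
      filter_upwards [hX] with z hz
      rw [hz.2 0 0]; simp [symMatrix]
    rw [this.fderiv_eq (𝕜 := ℝ),
      fderiv_const_mul (contDiffAt_lieCoeff hp.toIsCoframeAt hXp.1 1 1).dAt]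
    rfl
  -- If h' = 0, the first two components read e_3(a) = h and −2e_3(a) = h, so h = 0. If h = 0, the
  -- last two read e_5(a) = 0 and −2e_5(a) = h', so h' = 0.
  have m1 := structFn_lie hp.toIsCoframeAt hXp.1 1 1 3
  have m2 := structFn_lie hp.toIsCoframeAt hXp.1 0 0 3
  have m3 := structFn_lie hp.toIsCoframeAt hXp.1 1 1 5
  have m4 := structFn_lie hp.toIsCoframeAt hXp.1 0 0 5
  rw [Z 1 3 (by simp [symMatrix])] at m1
  rw [Z 0 3 (by simp [symMatrix]), D] at m2
  rw [Z 1 5 (by simp [symMatrix])] at m3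
  rw [Z 0 5 (by simp [symMatrix]), D] at m4
  obtain ⟨h, hh⟩ : ∃ h, lieCoeff X η 1 0 p = h := ⟨_, rfl⟩
  obtain ⟨h', hh'⟩ : ∃ h', lieCoeff X η 2 0 p = h' := ⟨_, rfl⟩
  rw [hh, hh']
  simp only [ha, hh, hh'] at B
  simp only [B] at m1 m2 m3 m4
  simp only [Fin.sum_univ_seven] at m1 m2 m3 m4
  simp [symMatrix, h0, c0, wedgeCoeff] at m1 m2 m3 m4
  constructor
  · rintro rfl
    simp at m1 m2
    linarith
  · rintro rfl
    simp at m3 m4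
    linarith

/-- The value, the dilation parameter and one translation parameter of a vector field. -/
def symValue (X : Param → Param) (η : Fin 7 → OneForm Param) (p : Param) : Param × ℝ × ℝ :=
  (X p, lieCoeff X η 1 1 p, lieCoeff X η 2 0 p)

/-- If the symmetry algebra has dimension nine, then every value and isotropy parameters are
realized by a symmetry. -/
theorem exists_symmetry (h₁ : ε₁ * ε₁ = 1) (h₂ : ε₂ * ε₂ = 1)
    (hη : ∀ᶠ y in 𝓝 p, IsGenericCoframeAt ε₁ ε₂ η y)
    (hI : ∀ᶠ y in 𝓝 p, I y = genBy η {0, 1, 2} y)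
    (hdim : Module.finrank ℝ (symmetryAlgebra I p) = 9) (w : Param × ℝ × ℝ) :
    ∃ X, ActsGenericallyNear ε₁ ε₂ η p X ∧ symValue X η p = w := by
  have hrep : ∀ g : symmetryAlgebra I p, ∃ X : Param → Param,
      IsInfSymmetryNear I p X ∧ (X : Germ (𝓝 p) Param) = g := fun g => g.2
  choose rep hrepX hrepg using hrep
  have hd : ∀ g, DifferentiableAt ℝ (rep g) p := fun g => (hrepX g).self_of_nhds.1.dAt
  -- Chosen representatives are additive only near p, which suffices because `symValue` depends on
  -- the germ alone.
  have hadd : ∀ g g', rep (g + g') =ᶠ[𝓝 p] rep g + rep g' := by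
    intro g g'
    apply Germ.coe_eq.1
    rw [hrepg, Germ.coe_add, hrepg, hrepg]
    rfl
  have hsmul : ∀ (c : ℝ) g, rep (c • g) =ᶠ[𝓝 p] c • rep g := by
    intro c g
    apply Germ.coe_eq.1
    rw [hrepg, Germ.coe_smul, hrepg]
    rfl
  let Φ : symmetryAlgebra I p →ₗ[ℝ] Param × ℝ × ℝ :=
    { toFun := fun g => symValue (rep g) η p
      map_add' := by
        intro g g'
        simp [symValue, lieCoeff_congr (hadd g g'), lieCoeff_add (hd g) (hd g'),
          (hadd g g').eq_of_nhds]
      map_smul' := by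
        intro c g
        simp [symValue, lieCoeff_congr (hsmul c g), lieCoeff_smul c (hd g),
          (hsmul c g).eq_of_nhds] }
  have hinj : Function.Injective Φ := by
    rw [← LinearMap.ker_eq_bot, LinearMap.ker_eq_bot']
    intro g hg
    have hg' : symValue (rep g) η p = 0 := hg
    have e1 : rep g p = 0 := congrArg Prod.fst hg'
    have e2 : lieCoeff (rep g) η 1 1 p = 0 := congrArg (fun t => t.2.1) hg'
    have e3 : lieCoeff (rep g) η 2 0 p = 0 := congrArg (fun t => t.2.2) hg'
    have act := (hrepX g).actsGenerically h₁ h₂ hη hI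
    have e4 := (isotropy_relations h₁ h₂ hη act e1 e2).1 e3
    have hz := eventually_eq_zero_of_symData h₁ h₂ (hη.mono fun y hy => hy.toIsCoframeAt) act
      (by simp [symData, e1, e2, e3, e4])
    apply Subtype.ext
    rw [← hrepg g]
    exact Germ.coe_eq.2 hz
  have : FiniteDimensional ℝ (symmetryAlgebra I p) :=
    FiniteDimensional.of_finrank_pos (by rw [hdim]; norm_num)
  -- The target is ℝ⁷ × ℝ × ℝ, of dimension 9, so injectivity gives surjectivity.
  have hsurj : Function.Surjective Φ :=
    (LinearMap.injective_iff_surjective_of_finrank_eq_finrank (by rw [hdim]; simp)).1 hinj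
  obtain ⟨g, hg⟩ := hsurj w
  exact ⟨rep g, (hrepX g).actsGenerically h₁ h₂ hη hI, hg⟩

/-- `{η³, η⁴}` is completely integrable at a point with maximal isotropy. -/
theorem structFn_eq_zero_of_isotropy (h₁ : ε₁ * ε₁ = 1) (h₂ : ε₂ * ε₂ = 1)
    (hη : ∀ᶠ y in 𝓝 p, IsGenericCoframeAt ε₁ ε₂ η y)
    (hex : ∀ w, ∃ X, ActsGenericallyNear ε₁ ε₂ η p X ∧ symValue X η p = w) :
    ∀ j k : Fin 7, j ≠ 3 → j ≠ 4 → k ≠ 3 → k ≠ 4 →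
      structFn η 3 j k p = 0 ∧ structFn η 4 j k p = 0 := by
  have hp := hη.self_of_nhds
  have n₁ : ε₁ ≠ 0 := by rintro rfl; simp at h₁
  have n₂ : ε₂ ≠ 0 := by rintro rfl; simp at h₂
  have c3 := fun j k => hp.structFn_three (j := j) (k := k)
  have c4 := fun j k => hp.structFn_four (j := j) (k := k)
  have Z : ∀ X, ActsGenericallyNear ε₁ ε₂ η p X → ∀ i j,
      (∀ a h h', symMatrix ε₁ ε₂ a h h' i j = 0) → fderiv ℝ (lieCoeff X η i j) p = 0 := by
    intro X hX i j hij
    have : lieCoeff X η i j =ᶠ[𝓝 p] fun _ => 0 := by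
      filter_upwards [hX] with z hz
      rw [hz.2, hij]
    rw [this.fderiv_eq (𝕜 := ℝ)]
    simp
  -- the equation of a symmetry vanishing at `p`
  have M : ∀ X, ActsGenericallyNear ε₁ ε₂ η p X → X p = 0 → ∀ i j k,
      (∀ a h h', symMatrix ε₁ ε₂ a h h' i j = 0) → (∀ a h h', symMatrix ε₁ ε₂ a h h' i k = 0) →
      ∑ l, symMatrix ε₁ ε₂ (lieCoeff X η 1 1 p) (lieCoeff X η 1 0 p) (lieCoeff X η 2 0 p) i l
        * structFn η l j k p = ∑ l,
          (symMatrix ε₁ ε₂ (lieCoeff X η 1 1 p) (lieCoeff X η 1 0 p) (lieCoeff X η 2 0 p) l j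
            * structFn η i l k p
          + symMatrix ε₁ ε₂ (lieCoeff X η 1 1 p) (lieCoeff X η 1 0 p) (lieCoeff X η 2 0 p) l k
            * structFn η i j l p) := by
    intro X hX h0 i j k hj hk
    have m := structFn_lie hp.toIsCoframeAt hX.self_of_nhds.1 i j k
    simp only [← hX.self_of_nhds.2]
    simpa [Z X hX i j hj, Z X hX i k hk, h0] using m
  -- X is a nilpotent isotropy element with h' = 1, hence h ≠ 0 by `isotropy_relations`; Y is a
  -- dilation with h' = 0 and h unknown.
  obtain ⟨X, hX, hXv⟩ := hex (0, 0, 1)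
  obtain ⟨Y, hY, hYv⟩ := hex (0, 1, 0)
  have x1 : X p = 0 := congrArg Prod.fst hXv
  have x2 : lieCoeff X η 1 1 p = 0 := congrArg (fun t => t.2.1) hXv
  have x3 : lieCoeff X η 2 0 p = 1 := congrArg (fun t => t.2.2) hXv
  have x4 : lieCoeff X η 1 0 p ≠ 0 := by
    intro h
    have := (isotropy_relations h₁ h₂ hη hX x1 x2).2 h
    rw [x3] at this
    exact one_ne_zero this
  have y1 : Y p = 0 := congrArg Prod.fst hYv
  have y2 : lieCoeff Y η 1 1 p = 1 := congrArg (fun t => t.2.1) hYv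
  have y3 : lieCoeff Y η 2 0 p = 0 := congrArg (fun t => t.2.2) hYv
  have MX := M X hX x1
  have MY := M Y hY y1
  rw [x2, x3] at MX
  rw [y2, y3] at MY
  -- The weights of η¹ and η⁶ add up to that of η³, so the dilation says nothing here. The nilpotent
  -- X gives ε₁h c³₁₆ = 0 instead.
  have a16 : structFn η 3 1 6 p = 0 := by
    have m := MX 3 1 5 (by simp [symMatrix]) (by simp [symMatrix])
    simp [Fin.sum_univ_seven, symMatrix, x4, n₁] at m
    exact m
  -- From here on the dilation Y multiplies the component by a nonzero difference of weights. Its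
  -- h-terms involve only components already killed, and this dictates the order.
  have a15 : structFn η 3 1 5 p = 0 := by
    have m := MY 3 1 5 (by simp [symMatrix]) (by simp [symMatrix])
    simp [Fin.sum_univ_seven, symMatrix, a16] at m
    linarith
  have a12 : structFn η 3 1 2 p = 0 := by
    have m := MY 3 1 2 (by simp [symMatrix]) (by simp [symMatrix])
    simp [Fin.sum_univ_seven, symMatrix] at m
    linarith
  have a06 : structFn η 3 0 6 p = 0 := by
    have m := MY 3 0 6 (by simp [symMatrix]) (by simp [symMatrix])
    simp [Fin.sum_univ_seven, symMatrix, a16, c3] at m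
    linarith
  have a05 : structFn η 3 0 5 p = 0 := by
    have m := MY 3 0 5 (by simp [symMatrix]) (by simp [symMatrix])
    simp [Fin.sum_univ_seven, symMatrix, a15, a06, c3] at m
    linarith
  have a02 : structFn η 3 0 2 p = 0 := by
    have m := MY 3 0 2 (by simp [symMatrix]) (by simp [symMatrix])
    simp [Fin.sum_univ_seven, symMatrix, a12, c3] at m
    linarith
  have a01 : structFn η 3 0 1 p = 0 := by
    have m := MY 3 0 1 (by simp [symMatrix]) (by simp [symMatrix])
    simp [Fin.sum_univ_seven, symMatrix, structFn_swap η 3 2 1, a12, structFn_self] at m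
    linarith
  have b16 : structFn η 4 1 6 p = 0 := by
    have m := MY 4 1 6 (by simp [symMatrix]) (by simp [symMatrix])
    simp [Fin.sum_univ_seven, symMatrix, a16] at m
    linarith
  have b15 : structFn η 4 1 5 p = 0 := by
    have m := MY 4 1 5 (by simp [symMatrix]) (by simp [symMatrix])
    simp [Fin.sum_univ_seven, symMatrix, b16, a15] at m
    linarith
  have b12 : structFn η 4 1 2 p = 0 := by
    have m := MY 4 1 2 (by simp [symMatrix]) (by simp [symMatrix])
    simp [Fin.sum_univ_seven, symMatrix, a12] at m
    linarith
  have b06 : structFn η 4 0 6 p = 0 := by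
    have m := MY 4 0 6 (by simp [symMatrix]) (by simp [symMatrix])
    simp [Fin.sum_univ_seven, symMatrix, b16, a06, c4] at m
    linarith
  have b05 : structFn η 4 0 5 p = 0 := by
    have m := MY 4 0 5 (by simp [symMatrix]) (by simp [symMatrix])
    simp [Fin.sum_univ_seven, symMatrix, b15, b06, a05, c4] at m
    linarith
  have b02 : structFn η 4 0 2 p = 0 := by
    have m := MY 4 0 2 (by simp [symMatrix]) (by simp [symMatrix])
    simp [Fin.sum_univ_seven, symMatrix, b12, a02, c4] at m
    linarith
  have b01 : structFn η 4 0 1 p = 0 := by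
    have m := MY 4 0 1 (by simp [symMatrix]) (by simp [symMatrix])
    simp [Fin.sum_univ_seven, symMatrix, structFn_swap η 4 2 1, b12, a01,
      structFn_self] at m
    linarith
  have s : ∀ {i j k : Fin 7}, structFn η i j k p = 0 → structFn η i k j p = 0 := by
    intro i j k h
    rw [structFn_swap, h, neg_zero]
  intro j k
  fin_cases j <;> fin_cases k <;> simp [structFn_self, c3, c4, a16, a15, a12, a06, a05, a02, a01,
    b16, b15, b12, b06, b05, b02, b01, s a16, s a15, s a12, s a06, s a05, s a02, s a01,
    s b16, s b15, s b12, s b06, s b05, s b02, s b01]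

end MaximalSymmetry

/-! ### Derived systems and characteristic systems in terms of structure functions -/

section Systems

variable {η ζ : Fin 7 → OneForm Param} {y : Param} {K K' : Set (Fin 7)}

theorem inAnn_genBy {v : Param} : InAnn (genBy η K y) v ↔ ∀ k ∈ K, η k y v = 0 :=
  ⟨fun h _ hk => h _ (mem_genBy hk), fun h _ hα => genBy_apply_eq_zero hα h⟩

theorem mem_genBy_iff (h : LinearIndependent ℝ (fun k => η k y)) {α : Param →L[ℝ] ℝ} :
    α ∈ genBy η K y ↔ ∀ j, j ∉ K → α (frame η j y) = 0 := by
  constructor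
  · intro hα j hj
    refine genBy_apply_eq_zero hα fun k hk => ?_
    rw [coframe_frame h, if_neg]
    rintro rfl
    exact hj hk
  · intro hα
    rw [← sum_coframe h α]
    refine Submodule.sum_mem _ fun j _ => ?_
    by_cases hj : j ∈ K
    · exact Submodule.smul_mem _ _ (mem_genBy hj)
    · rw [hα j hj, zero_smul]
      exact Submodule.zero_mem _

theorem mem_genBy_iff_ann (h : LinearIndependent ℝ (fun k => η k y)) {α : Param →L[ℝ] ℝ} :
    α ∈ genBy η K y ↔ ∀ v, (∀ k ∈ K, η k y v = 0) → α v = 0 := by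
  refine ⟨fun hα v hv => genBy_apply_eq_zero hα hv, fun hα => ?_⟩
  rw [mem_genBy_iff h]
  intro j hj
  refine hα _ fun k hk => ?_
  rw [coframe_frame h, if_neg]
  rintro rfl
  exact hj hk

theorem genBy_eq_of_ann (h : LinearIndependent ℝ (fun k => η k y))
    (h' : LinearIndependent ℝ (fun k => ζ k y))
    (e : ∀ v, (∀ k ∈ K, η k y v = 0) ↔ ∀ k ∈ K', ζ k y v = 0) :
    genBy η K y = genBy ζ K' y := by
  ext α
  simp only [mem_genBy_iff_ann h, mem_genBy_iff_ann h', e]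

/-- Seven covectors on ℝ⁷ with no common zero give a bijective linear map. This reduces the
independence of a modified coframe to solving homogeneous equations on a vector. -/
theorem indep_of_injective (h : ∀ v, (∀ k, η k y v = 0) → v = 0) :
    LinearIndependent ℝ (fun k => η k y) := by
  have inj : Function.Injective (coLin η y : Param →ₗ[ℝ] Param) := by
    rw [injective_iff_map_eq_zero]
    exact fun v hv => h v fun k => congrFun hv k
  have surj := (LinearMap.injective_iff_surjective (f := (coLin η y : Param →ₗ[ℝ] Param))).1 inj
  rw [Fintype.linearIndependent_iff]
  intro g hg i
  obtain ⟨v, hv⟩ := surj (Pi.single i 1)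
  have hv' : ∀ k, η k y v = (Pi.single i 1 : Param) k := fun k => congrFun hv k
  have := congrArg (fun α => α v) hg
  simpa [hv', Pi.single_apply] using this

theorem dOne_expand (h : LinearIndependent ℝ (fun k => η k y)) (θ : OneForm Param) (v w : Param) :
    dOne θ y v w = ∑ i, ∑ j, η i y v * (η j y w * dOne θ y (frame η i y) (frame η j y)) := by
  conv_lhs => rw [← sum_frame h v, ← sum_frame h w]
  rw [dOne_sum_left]
  simp only [dOne_sum_right, Finset.mul_sum]

/-- A 2-form `dθ` vanishes on the annihilator of `η k`, `k ∈ K`, if its components do. -/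
theorem dOne_eq_zero_of_frame (h : LinearIndependent ℝ (fun k => η k y)) {θ : OneForm Param}
    (hθ : ∀ i j, i ∉ K → j ∉ K → dOne θ y (frame η i y) (frame η j y) = 0) {v w : Param}
    (hv : ∀ k ∈ K, η k y v = 0) (hw : ∀ k ∈ K, η k y w = 0) : dOne θ y v w = 0 := by
  rw [dOne_expand h]
  refine Finset.sum_eq_zero fun i _ => Finset.sum_eq_zero fun j _ => ?_
  by_cases hi : i ∈ K
  · rw [hv i hi, zero_mul]
  by_cases hj : j ∈ K
  · rw [hw j hj, zero_mul, mul_zero]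
  rw [hθ i j hi hj, mul_zero, mul_zero]

theorem isLocalSection_coframe (hη : ∀ᶠ z in 𝓝 y, IsCoframeAt η z) {k : Fin 7} (hk : k ∈ K) :
    IsLocalSection (genBy η K) y (η k) :=
  hη.mono fun _ hz => ⟨hz.smooth k, mem_genBy hk⟩

/-- The exterior derivative of a section of `{η k | k ∈ K}` modulo the system. -/
theorem dOne_section (hη : ∀ᶠ z in 𝓝 y, IsCoframeAt η z) {θ : OneForm Param}
    (hθ : IsLocalSection (genBy η K) y θ) {i j : Fin 7} (hi : i ∉ K) (hj : j ∉ K) :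
    dOne θ y (frame η i y) (frame η j y) = ∑ m, θ y (frame η m y) * structFn η m i j y := by
  have hp := hη.self_of_nhds
  -- A section vanishes on e_l near y for l outside K, so Cartan's formula leaves only the bracket
  -- term.
  have hz : ∀ l, l ∉ K → fderiv ℝ (fun z => θ z (frame η l z)) y = 0 := by
    intro l hl
    have : (fun z => θ z (frame η l z)) =ᶠ[𝓝 y] fun _ => 0 := by
      filter_upwards [hη, hθ] with z hz hθz using (mem_genBy_iff hz.indep).1 hθz.2 l hl
    rw [this.fderiv_eq (𝕜 := ℝ)]
    simp
  have h1 := fderiv_apply_sub hθ.self_of_nhds.1.dAt (contDiffAt_frame hp i).dAt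
    (contDiffAt_frame hp j).dAt
  rw [hz j hj, hz i hi, fderiv_frame_sub hp] at h1
  simp only [zero_apply, sub_zero, map_neg, map_sum, map_smul, smul_eq_mul] at h1
  rw [eq_comm, add_neg_eq_zero] at h1
  rw [h1]
  exact Finset.sum_congr rfl fun m _ => mul_comm _ _

theorem IsLocalSection.congr {D D' : CotangentField Param} (h : D =ᶠ[𝓝 y] D')
    {θ : OneForm Param} (hθ : IsLocalSection D y θ) : IsLocalSection D' y θ := by
  filter_upwards [h, hθ] with z hz hθz
  exact ⟨hθz.1, hz ▸ hθz.2⟩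

theorem derivedSystem_congr_le {D D' : CotangentField Param} (h : D =ᶠ[𝓝 y] D') :
    derivedSystem D y ≤ derivedSystem D' y := by
  rintro _ ⟨θ, h1, h2, rfl⟩
  refine ⟨θ, h1.congr h, ?_, rfl⟩
  filter_upwards [h, h2] with z hz h2z v w hv hw
  exact h2z v w (hz ▸ hv) (hz ▸ hw)

theorem derivedSystem_congr {D D' : CotangentField Param} (h : D =ᶠ[𝓝 y] D') :
    derivedSystem D y = derivedSystem D' y :=
  le_antisymm (derivedSystem_congr_le h) (derivedSystem_congr_le h.symm)

/-- The derived system of `{η k | k ∈ K}` is `{η k | k ∈ K'}` if the structure functions of the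
forms in `K'` vanish off `K` and every other form of `K` is detected by a pair of indices. -/
theorem derivedSystem_genBy (hη : ∀ᶠ z in 𝓝 y, IsCoframeAt η z) (hK : K' ⊆ K)
    (h1 : ∀ᶠ z in 𝓝 y, ∀ k ∈ K', ∀ i j, i ∉ K → j ∉ K → structFn η k i j z = 0)
    (h2 : ∀ k ∈ K, k ∉ K' → ∃ i j, i ∉ K ∧ j ∉ K ∧ structFn η k i j y ≠ 0 ∧
      ∀ l ∈ K, l ≠ k → structFn η l i j y = 0) :
    derivedSystem (genBy η K) y = genBy η K' y := by
  have hp := hη.self_of_nhds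
  apply le_antisymm
  · rintro _ ⟨θ, hθ, hd, rfl⟩
    rw [mem_genBy_iff hp.indep]
    intro k hk
    by_cases hkK : k ∈ K
    · obtain ⟨i, j, hi, hj, hne, hl⟩ := h2 k hkK hk
      have e1 := dOne_section hη hθ hi hj
      rw [hd.self_of_nhds _ _ (inAnn_genBy.2 fun l hl => (frame_annihilated hp.indep hi hj l hl).1)
        (inAnn_genBy.2 fun l hl => (frame_annihilated hp.indep hi hj l hl).2),
        Finset.sum_eq_single k] at e1
      · exact (mul_eq_zero.1 e1.symm).resolve_right hne
      · intro m _ hm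
        by_cases hmK : m ∈ K
        · rw [hl m hmK hm, mul_zero]
        · rw [(mem_genBy_iff hp.indep).1 hθ.self_of_nhds.2 m hmK, zero_mul]
      · simp
    · exact (mem_genBy_iff hp.indep).1 hθ.self_of_nhds.2 k hkK
  · refine Submodule.span_le.2 ?_
    rintro _ ⟨k, hk, rfl⟩
    refine ⟨η k, isLocalSection_coframe hη (hK hk), ?_, rfl⟩
    filter_upwards [hη, h1] with z hz h1z v w hv hw
    exact dOne_eq_zero_of_frame hz.indep (fun i j hi hj => h1z k hk i j hi hj)
      (inAnn_genBy.1 hv) (inAnn_genBy.1 hw)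

/-- On I^⊥ the exterior derivative of a section of M is a pointwise combination of those of the
generators, because M ⊆ I. So generators and frame vectors suffice to test the condition on all
sections. -/
theorem isChar_iff (hη : ∀ᶠ z in 𝓝 y, IsCoframeAt η z) {I M : CotangentField Param}
    (hI : I y = genBy η K y) (hM : M =ᶠ[𝓝 y] genBy η K') (hK : K' ⊆ K) {v : Param} :
    IsChar I M y v ↔ (∀ k ∈ K, η k y v = 0) ∧
      ∀ k ∈ K', ∀ j, j ∉ K → dOne (η k) y v (frame η j y) = 0 := by
  have hp := hη.self_of_nhds
  constructor
  · rintro ⟨h1, h2⟩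
    rw [hI] at h1
    refine ⟨inAnn_genBy.1 h1, fun k hk j hj => ?_⟩
    obtain ⟨β, hβ, hβw⟩ := h2 _ ((isLocalSection_coframe hη hk).congr hM.symm)
    rw [← hβw]
    rw [hI] at hβ
    exact (mem_genBy_iff hp.indep).1 hβ j hj
  · rintro ⟨h1, h2⟩
    refine ⟨?_, fun θ hθ => ?_⟩
    · rw [hI]
      exact inAnn_genBy.2 h1
    · have hθ' := hθ.congr hM
      refine ⟨∑ j, dOne θ y v (frame η j y) • η j y, ?_, fun w => ?_⟩
      · rw [hI]
        refine Submodule.sum_mem _ fun j _ => ?_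
        by_cases hj : j ∈ K
        · exact Submodule.smul_mem _ _ (mem_genBy hj)
        · have e : dOne θ y v (frame η j y)
              = ∑ m, θ y (frame η m y) * dOne (η m) y v (frame η j y) := by
            have e1 : ∀ ξ : OneForm Param, dOne ξ y v (frame η j y)
                = ∑ i, η i y v * dOne ξ y (frame η i y) (frame η j y) := by
              intro ξ
              conv_lhs => rw [← sum_frame hp.indep v]
              rw [dOne_sum_left]
            simp only [e1, Finset.mul_sum]
            rw [Finset.sum_comm]
            refine Finset.sum_congr rfl fun i _ => ?_
            by_cases hi : i ∈ K
            · simp [h1 i hi]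
            · rw [dOne_section hη hθ' (fun h => hi (hK h)) (fun h => hj (hK h)), Finset.mul_sum]
              refine Finset.sum_congr rfl fun m _ => ?_
              rw [structFn]
              ring
          rw [e, Finset.sum_eq_zero, zero_smul]
          · exact Submodule.zero_mem _
          · intro m _
            by_cases hm : m ∈ K'
            · rw [h2 m hm j hj, mul_zero]
            · rw [(mem_genBy_iff hp.indep).1 hθ'.self_of_nhds.2 m hm, zero_mul]
      · conv_rhs => rw [← sum_frame hp.indep w]
        rw [dOne_sum_right]
        simp [mul_comm]

theorem charSystem_eq_genBy (h : LinearIndependent ℝ (fun k => η k y)) {I M : CotangentField Param}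
    (hC : ∀ v, IsChar I M y v ↔ ∀ k ∈ K, η k y v = 0) : charSystem I M y = genBy η K y := by
  ext α
  rw [mem_genBy_iff_ann h]
  exact forall_congr' fun v => by rw [hC]

theorem isPfaffianSystem_genBy {S : Set Param} {D : CotangentField Param} {n : ℕ}
    (f : Fin n → Fin 7) (hf : Function.Injective f)
    (hη : ∀ z ∈ S, ∀ᶠ y in 𝓝 z, IsCoframeAt η y)
    (hD : ∀ z ∈ S, ∀ᶠ y in 𝓝 z, D y = genBy η (Set.range f) y) : IsPfaffianSystem D n S := by
  intro z hz
  refine ⟨fun i => η (f i), ?_⟩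
  filter_upwards [hη z hz, hD z hz] with y hy hDy
  refine ⟨fun i => hy.smooth _, hy.indep.comp f hf, ?_⟩
  rw [hDy, genBy, ← Set.range_comp]
  rfl

end Systems

/-! ### Generic coframes adapted to a pair of characteristic systems -/

/-- A generic coframe adapted to `I`, `M₁`, `M₂`. -/
structure IsGenericFor (I M₁ M₂ : CotangentField Param) (ε₁ ε₂ : ℝ) (η : Fin 7 → OneForm Param)
    (y : Param) : Prop extends IsGenericCoframeAt ε₁ ε₂ η y where
  eq_I : I y = genBy η {0, 1, 2} y
  eq_M₁ : M₁ y = genBy η {0, 1} y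
  eq_M₂ : M₂ y = genBy η {0, 2} y

/-- The interchange of the two characteristic systems. -/
def swapIdx : Fin 7 → Fin 7 := ![0, 2, 1, 5, 6, 3, 4]

theorem swapIdx_swapIdx (k : Fin 7) : swapIdx (swapIdx k) = k := by
  fin_cases k <;> rfl

theorem genBy_swap (η : Fin 7 → OneForm Param) (K : Set (Fin 7)) (y : Param) :
    genBy (fun k => η (swapIdx k)) K y = genBy η (swapIdx '' K) y := by
  simp only [genBy, Set.image_image]

section Adapted

variable {I M₁ M₂ : CotangentField Param} {ε₁ ε₂ : ℝ} {η : Fin 7 → OneForm Param} {y : Param}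

/-- The structure equations are invariant under this permutation once ε₁ and ε₂ are exchanged as
well. Two signs are carried for this reason, although one can be scaled to 1. -/
theorem IsGenericFor.swap (h : IsGenericFor I M₁ M₂ ε₁ ε₂ η y) :
    IsGenericFor I M₂ M₁ ε₂ ε₁ (fun k => η (swapIdx k)) y where
  smooth k := h.smooth _
  indep := h.indep.comp swapIdx (Function.LeftInverse.injective swapIdx_swapIdx)
  d_zero v w hv hw := by
    rw [add_comm]
    exact h.d_zero v w hv hw
  d_one v w a b c d := h.d_two v w a b c d
  d_two v w a b c d := h.d_one v w a b c d
  d_three v w hvw := h.d_five v w (by simpa [swapIdx] using hvw)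
  d_four v w hvw := h.d_six v w (by simpa [swapIdx] using hvw)
  d_five v w hvw := h.d_three v w (by simpa [swapIdx] using hvw)
  d_six v w hvw := h.d_four v w (by simpa [swapIdx] using hvw)
  eq_I := by
    rw [genBy_swap, h.eq_I]
    congr 1
    simp [Set.image_insert_eq, swapIdx, Set.pair_comm]
  eq_M₁ := by
    rw [genBy_swap, h.eq_M₂]
    simp [Set.image_insert_eq, swapIdx]
  eq_M₂ := by
    rw [genBy_swap, h.eq_M₁]
    simp [Set.image_insert_eq, swapIdx]

theorem derivedSystem_I (hη : ∀ᶠ z in 𝓝 y, IsGenericFor I M₁ M₂ ε₁ ε₂ η z) :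
    derivedSystem I y = genBy η {0} y := by
  have hc := hη.mono fun z hz => hz.toIsCoframeAt
  have hp := hη.self_of_nhds
  rw [derivedSystem_congr (hη.mono fun z hz => hz.eq_I : I =ᶠ[𝓝 y] genBy η {0, 1, 2})]
  refine derivedSystem_genBy hc (by simp) ?_ ?_
  · filter_upwards [hη] with z hz
    simp only [Set.mem_singleton_iff, forall_eq]
    intro i j hi hj
    fin_cases i <;> fin_cases j <;> simp_all [hz.structFn_zero, wedgeCoeff]
  · intro k hk hk'
    fin_cases k <;> simp at hk hk'
    · refine ⟨3, 4, by simp, by simp, ?_⟩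
      simp [hp.structFn_zero, hp.structFn_one, hp.structFn_two, wedgeCoeff]
    · refine ⟨5, 6, by simp, by simp, ?_⟩
      simp [hp.structFn_zero, hp.structFn_one, hp.structFn_two, wedgeCoeff]

/-- On I^⊥ the form dη⁰ vanishes and dη¹ is η³∧η⁴, so the characteristic vectors are those of I^⊥
killed by η³ and η⁴. -/
theorem charSystem_one (hη : ∀ᶠ z in 𝓝 y, IsGenericFor I M₁ M₂ ε₁ ε₂ η z) :
    charSystem I M₁ y = genBy η {0, 1, 2, 3, 4} y := by
  have hc := hη.mono fun z hz => hz.toIsCoframeAt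
  have hp := hη.self_of_nhds
  refine charSystem_eq_genBy hp.indep fun v => ?_
  rw [isChar_iff hc hp.eq_I (hη.mono fun z hz => hz.eq_M₁) (by
    intro k; simp only [Set.mem_insert_iff, Set.mem_singleton_iff]; tauto)]
  have e : ∀ j : Fin 7, j ∉ ({0, 1, 2} : Set (Fin 7)) → η 0 y v = 0 → η 1 y v = 0 →
      η 2 y v = 0 → dOne (η 0) y v (frame η j y) = 0 ∧
      dOne (η 1) y v (frame η j y) = wedge (η 3 y) (η 4 y) v (frame η j y) := by
    intro j hj h0 h1 h2
    simp only [Set.mem_insert_iff, Set.mem_singleton_iff, not_or] at hj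
    have f0 : η 0 y (frame η j y) = 0 := by simp [coframe_frame hp.indep, Ne.symm hj.1]
    have f1 : η 1 y (frame η j y) = 0 := by simp [coframe_frame hp.indep, Ne.symm hj.2.1]
    have f2 : η 2 y (frame η j y) = 0 := by simp [coframe_frame hp.indep, Ne.symm hj.2.2]
    constructor
    · rw [hp.d_zero _ _ h0 f0]; simp [wedge, h1, h2, f1, f2]
    · rw [hp.d_one _ _ h0 h1 f0 f1]; simp [wedge, h2, f2]
  constructor
  · rintro ⟨h1, h2⟩
    have z0 := h1 0 (by simp)
    have z1 := h1 1 (by simp)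
    have z2 := h1 2 (by simp)
    have a3 := h2 1 (by simp) 3 (by simp)
    have a4 := h2 1 (by simp) 4 (by simp)
    rw [(e 3 (by simp) z0 z1 z2).2] at a3
    rw [(e 4 (by simp) z0 z1 z2).2] at a4
    simp [wedge, coframe_frame hp.indep] at a3 a4
    simp [z0, z1, z2, a3, a4]
  · intro h
    have z0 := h 0 (by simp)
    have z1 := h 1 (by simp)
    have z2 := h 2 (by simp)
    have z3 := h 3 (by simp)
    have z4 := h 4 (by simp)
    refine ⟨by simp [z0, z1, z2], ?_⟩
    intro k hk j hj
    simp only [Set.mem_insert_iff, Set.mem_singleton_iff] at hk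
    rcases hk with rfl | rfl
    · exact (e j hj z0 z1 z2).1
    · rw [(e j hj z0 z1 z2).2]
      simp [wedge, z3, z4]

/-- The first derived system of a characteristic system. -/
theorem derivedSystem_charSystem_one (hη : ∀ᶠ z in 𝓝 y, IsGenericFor I M₁ M₂ ε₁ ε₂ η z) :
    derivedSystem (charSystem I M₁) y = genBy η {0, 1, 3, 4} y := by
  have hc := hη.mono fun z hz => hz.toIsCoframeAt
  have hp := hη.self_of_nhds
  have e : charSystem I M₁ =ᶠ[𝓝 y] genBy η {0, 1, 2, 3, 4} :=
    (eventually_eventually_nhds.2 hη).mono fun z hz => charSystem_one hz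
  rw [derivedSystem_congr e]
  refine derivedSystem_genBy hc ?_ ?_ ?_
  · intro k; simp only [Set.mem_insert_iff, Set.mem_singleton_iff]; tauto
  · filter_upwards [hη] with z hz
    intro k hk i j hi hj
    simp only [Set.mem_insert_iff, Set.mem_singleton_iff] at hk
    rcases hk with rfl | rfl | rfl | rfl <;> fin_cases i <;> fin_cases j <;>
      simp_all [hz.structFn_zero, hz.structFn_one, hz.structFn_three, hz.structFn_four, wedgeCoeff]
  · intro k hk hk'
    fin_cases k <;> simp at hk hk'
    -- The form η² leaves the system because dη² contains η⁵∧η⁶, which no other generator can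
    -- compensate.
    refine ⟨5, 6, by simp, by simp, ?_⟩
    simp [hp.structFn_zero, hp.structFn_one, hp.structFn_two, hp.structFn_three, hp.structFn_four,
      wedgeCoeff]

/-- Off {η⁰, η¹, η³, η⁴} the derivatives of η⁰ and η¹ are the independent 2-forms η²∧η⁵ and ε₁η²∧η⁶,
while those of η³ and η⁴ vanish. -/
theorem derivedSystem_derivedSystem_charSystem_one (h₁ : ε₁ ≠ 0)
    (hη : ∀ᶠ z in 𝓝 y, IsGenericFor I M₁ M₂ ε₁ ε₂ η z) :
    derivedSystem (derivedSystem (charSystem I M₁)) y = genBy η {3, 4} y := by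
  have hc := hη.mono fun z hz => hz.toIsCoframeAt
  have hp := hη.self_of_nhds
  have e : derivedSystem (charSystem I M₁) =ᶠ[𝓝 y] genBy η {0, 1, 3, 4} :=
    (eventually_eventually_nhds.2 hη).mono fun z hz => derivedSystem_charSystem_one hz
  rw [derivedSystem_congr e]
  refine derivedSystem_genBy hc ?_ ?_ ?_
  · intro k; simp only [Set.mem_insert_iff, Set.mem_singleton_iff]; tauto
  · filter_upwards [hη] with z hz
    intro k hk i j hi hj
    simp only [Set.mem_insert_iff, Set.mem_singleton_iff] at hk
    rcases hk with rfl | rfl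
    · exact hz.structFn_three hi hj
    · exact hz.structFn_four hi hj
  · intro k hk hk'
    fin_cases k <;> simp at hk hk'
    · refine ⟨2, 5, by simp, by simp, ?_⟩
      simp [hp.structFn_zero, hp.structFn_one, hp.structFn_three, hp.structFn_four,
        wedgeCoeff]
    · refine ⟨2, 6, by simp, by simp, ?_⟩
      simp [hp.structFn_zero, hp.structFn_one, hp.structFn_three, hp.structFn_four,
        wedgeCoeff, h₁]

/-- A generic coframe is adapted in the sense of the structure theorem. -/
theorem isAdaptedCoframeAt {ε : ℝ} (hε : ε ≠ 0)
    (hη : ∀ᶠ z in 𝓝 y, IsGenericFor I M₁ M₂ 1 ε η z) : IsAdaptedCoframeAt I M₁ M₂ ε η y := by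
  have hp := hη.self_of_nhds
  have hs := hη.mono fun z hz => hz.swap
  refine ⟨hp.smooth, hp.indep, hp.eq_I, derivedSystem_I hη, hp.eq_M₁, hp.eq_M₂, ?_, ?_, ?_,
    charSystem_one hη, ?_, derivedSystem_charSystem_one hη, ?_,
    derivedSystem_derivedSystem_charSystem_one one_ne_zero hη, ?_⟩
  · intro v w hv hw
    exact hp.d_zero v w (hv _ (mem_genBy rfl)) (hw _ (mem_genBy rfl))
  · intro v w hv hw
    have := hp.d_one v w (hv _ (mem_genBy (by simp))) (hv _ (mem_genBy (by simp)))
      (hw _ (mem_genBy (by simp))) (hw _ (mem_genBy (by simp)))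
    rw [this, one_mul]
  · intro v w hv hw
    exact hp.d_two v w (hv _ (mem_genBy (by simp))) (hv _ (mem_genBy (by simp)))
      (hw _ (mem_genBy (by simp))) (hw _ (mem_genBy (by simp)))
  · rw [charSystem_one hs, genBy_swap]
    congr 1
    ext k; fin_cases k <;> simp [swapIdx]
  · rw [derivedSystem_charSystem_one hs, genBy_swap]
    simp [Set.image_insert_eq, swapIdx]
  · rw [derivedSystem_derivedSystem_charSystem_one hε hs, genBy_swap]
    simp [Set.image_insert_eq, swapIdx]

end Adapted

/-! ### Darboux integrability of maximally symmetric generic systems -/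

section Darboux

variable {I M₁ M₂ : CotangentField Param} {ε₁ ε₂ : ℝ} {η : Fin 7 → OneForm Param} {p : Param}

/-- Cartan's formula L_Xθ = X⌟dθ + d(θ(X)). -/
theorem lieDeriv_apply_eq {θ : OneForm Param} {X : Param → Param} {y : Param}
    (hθ : DifferentiableAt ℝ θ y) (hX : DifferentiableAt ℝ X y) (w : Param) :
    lieDerivOneForm X θ y w = dOne θ y (X y) w + fderiv ℝ (fun z => θ z (X z)) y w := by
  rw [(hθ.hasFDerivAt.clm_apply hX.hasFDerivAt).fderiv, dOne_eq hθ]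
  simp [lieDerivOneForm]

theorem lieDeriv_apply_coframe {X : Param → Param} {y : Param}
    (h : LinearIndependent ℝ (fun k => η k y)) (i : Fin 7) (w : Param) :
    lieDerivOneForm X (η i) y w = ∑ j, lieCoeff X η i j y * η j y w := by
  conv_lhs => rw [← sum_coframe h (lieDerivOneForm X (η i) y)]
  simp [lieCoeff]

/-- The form of `{η³, η⁴}` that annihilates a symmetry is integrable. -/
theorem dOne_eq_zero_of_symmetry {X : Param → Param} {s : Param → ℝ} {y : Param}
    (hη : IsCoframeAt η y) (hX : ActsGenericallyNear ε₁ ε₂ η y X)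
    (hc : ∀ j k : Fin 7, j ≠ 3 → j ≠ 4 → k ≠ 3 → k ≠ 4 →
      structFn η 3 j k y = 0 ∧ structFn η 4 j k y = 0)
    (hs : DifferentiableAt ℝ s y) (hne : η 3 y (X y) ≠ 0)
    (hann : ∀ᶠ z in 𝓝 y, η 4 z (X z) + s z * η 3 z (X z) = 0) {v w : Param}
    (hv : η 4 y v + s y * η 3 y v = 0) (hw : η 4 y w + s y * η 3 y w = 0) :
    dOne (fun z => η 4 z + s z • η 3 z) y v w = 0 := by
  set θ : OneForm Param := fun z => η 4 z + s z • η 3 z with hθ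
  have d3 := (hη.smooth 3).dAt
  have d4 := (hη.smooth 4).dAt
  have hXy := hX.self_of_nhds
  have dX := hXy.1.dAt
  have hdθ : ∀ v w, dOne θ y v w = dOne (η 4) y v w + (s y * dOne (η 3) y v w
      + (fderiv ℝ s y v * η 3 y w - fderiv ℝ s y w * η 3 y v)) := by
    intro v w
    rw [hθ, dOne_add d4 (hs.fun_smul d3), dOne_mul hs d3]
  -- the case of two vectors annihilated by `η³` and `η⁴`
  have A : ∀ v w, η 3 y v = 0 → η 4 y v = 0 → η 3 y w = 0 → η 4 y w = 0 → dOne θ y v w = 0 := by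
    intro v w v3 v4 w3 w4
    have z : ∀ k ∈ ({3, 4} : Set (Fin 7)), η k y v = 0 := by simp [v3, v4]
    have z' : ∀ k ∈ ({3, 4} : Set (Fin 7)), η k y w = 0 := by simp [w3, w4]
    have hm : ∀ i j : Fin 7, i ∉ ({3, 4} : Set (Fin 7)) → j ∉ ({3, 4} : Set (Fin 7)) →
        structFn η 3 i j y = 0 ∧ structFn η 4 i j y = 0 := by
      intro i j hi hj
      simp only [Set.mem_insert_iff, Set.mem_singleton_iff, not_or] at hi hj
      exact hc i j hi.1 hi.2 hj.1 hj.2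
    rw [hdθ, dOne_eq_zero_of_frame hη.indep (fun i j hi hj => (hm i j hi hj).1) z z',
      dOne_eq_zero_of_frame hη.indep (fun i j hi hj => (hm i j hi hj).2) z z', v3, w3]
    ring
  -- the case where one vector is the symmetry
  have C : ∀ w, η 3 y w = 0 → η 4 y w = 0 → dOne θ y (X y) w = 0 := by
    intro w w3 w4
    have hz : fderiv ℝ (fun z => η 4 z (X z) + s z * η 3 z (X z)) y = 0 := by
      have : (fun z => η 4 z (X z) + s z * η 3 z (X z)) =ᶠ[𝓝 y] fun _ => 0 := hann
      rw [this.fderiv_eq (𝕜 := ℝ)]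
      simp
    have hD := (d4.hasFDerivAt.clm_apply dX.hasFDerivAt).fun_add
      (hs.hasFDerivAt.mul (d3.hasFDerivAt.clm_apply dX.hasFDerivAt))
    have e3 : fderiv ℝ (fun z => η 3 z (X z)) y w = _ :=
      congrArg (fun L => L w) (d3.hasFDerivAt.clm_apply dX.hasFDerivAt).fderiv
    have e4 : fderiv ℝ (fun z => η 4 z (X z)) y w = _ :=
      congrArg (fun L => L w) (d4.hasFDerivAt.clm_apply dX.hasFDerivAt).fderiv
    have hz' := congrArg (fun L => L w) (hD.fderiv.symm.trans hz)
    -- Since θ(X) vanishes identically, X⌟dθ = L_Xθ. The isotropy matrix sends both η³ and η⁴ to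
    -- multiples of η³, so L_Xθ is a multiple of η³ and vanishes on w.
    have l3 := lieDeriv_apply_eq d3 dX w
    have l4 := lieDeriv_apply_eq d4 dX w
    rw [lieDeriv_apply_coframe hη.indep] at l3 l4
    obtain ⟨a, h, h', B⟩ : ∃ a h h', ∀ i j, lieCoeff X η i j y = symMatrix ε₁ ε₂ a h h' i j :=
      ⟨_, _, _, hXy.2⟩
    simp only [B] at l3 l4
    simp [Fin.sum_univ_seven, symMatrix, w3] at l3 l4 hz' e3 e4
    rw [hdθ, w3]
    rw [e3] at l3
    rw [e4] at l4
    linear_combination (-1 : ℝ) * l4 - s y * l3 - hz'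
  -- The kernel of θ is spanned by X and the common kernel of η³ and η⁴, because η³(X) ≠ 0.
  have split : ∀ v, η 4 y v + s y * η 3 y v = 0 → ∃ (t : ℝ) (v' : Param), v = v' + t • X y ∧
      η 3 y v' = 0 ∧ η 4 y v' = 0 := by
    intro v hv
    have h0 := hann.self_of_nhds
    refine ⟨η 3 y v / η 3 y (X y), v - (η 3 y v / η 3 y (X y)) • X y, by simp, ?_, ?_⟩
    · simp
      field_simp
      simp
    · simp
      field_simp
      linear_combination η 3 y (X y) * hv - η 3 y v * h0
  obtain ⟨t, v', rfl, v3, v4⟩ := split v hv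
  obtain ⟨u, w', rfl, w3, w4⟩ := split w hw
  rw [dOne_add_left, dOne_add_right, dOne_smul_left, dOne_add_right, dOne_smul_right,
    dOne_smul_right, A v' w' v3 v4 w3 w4, C w' w3 w4, dOne_swap θ y v', C v' v3 v4, dOne_self]
  ring

/-- Adding multiples of `η³` to `η⁴` and of `η⁰` to `η²`. -/
def shearCoframe (ε₂ : ℝ) (s : Param → ℝ) (η : Fin 7 → OneForm Param) : Fin 7 → OneForm Param :=
  ![η 0, η 1, fun z => η 2 z + (ε₂ * s z) • η 0 z, η 3, fun z => η 4 z + s z • η 3 z, η 5, η 6]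

/-- Adding sη³ to η⁴ changes ε₂η¹∧η⁴ in dη² by ε₂sη¹∧η³, which is exactly what adding ε₂sη⁰ to η²
contributes through dη⁰. This is the freedom measured by h'. -/
theorem IsGenericFor.shear {s : Param → ℝ} {y : Param}
    (h : IsGenericFor I M₁ M₂ ε₁ ε₂ η y) (hs : ContDiffAt ℝ ∞ s y) :
    IsGenericFor I M₁ M₂ ε₁ ε₂ (shearCoframe ε₂ s η) y := by
  have hs' : ContDiffAt ℝ ∞ (fun z => ε₂ * s z) y := contDiffAt_const.mul hs
  have a2 : ∀ v, (shearCoframe ε₂ s η) 2 y v = η 2 y v + ε₂ * s y * η 0 y v := fun v => by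
    simp [shearCoframe]
  have a4 : ∀ v, (shearCoframe ε₂ s η) 4 y v = η 4 y v + s y * η 3 y v := fun v => by
    simp [shearCoframe]
  have ind : LinearIndependent ℝ (fun k => (shearCoframe ε₂ s η) k y) := by
    refine indep_of_injective fun v hv => eq_zero_of_coframe h.indep fun k => ?_
    have v0 : η 0 y v = 0 := hv 0
    have v3 : η 3 y v = 0 := hv 3
    have v2 := hv 2
    have v4 := hv 4
    rw [a2, v0] at v2
    rw [a4, v3] at v4
    fin_cases k
    · exact v0
    · exact hv 1
    · simpa using v2
    · exact v3
    · simpa using v4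
    · exact hv 5
    · exact hv 6
  refine ⟨⟨⟨?_, ind⟩, ?_, ?_, ?_, ?_, ?_, ?_, ?_⟩, ?_, ?_, ?_⟩
  · intro k
    fin_cases k
    · exact h.smooth 0
    · exact h.smooth 1
    · exact (h.smooth 2).add (hs'.smul (h.smooth 0))
    · exact h.smooth 3
    · exact (h.smooth 4).add (hs.smul (h.smooth 3))
    · exact h.smooth 5
    · exact h.smooth 6
  · intro v w (hv : η 0 y v = 0) (hw : η 0 y w = 0)
    refine (h.d_zero v w hv hw).trans ?_
    simp only [wedge, a2, hv, hw]
    simp [shearCoframe]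
  · intro v w (v0 : η 0 y v = 0) (v1 : η 1 y v = 0) (w0 : η 0 y w = 0) (w1 : η 1 y w = 0)
    refine (h.d_one v w v0 v1 w0 w1).trans ?_
    simp only [wedge, a2, a4, v0, w0]
    simp [shearCoframe]
    ring
  · intro v w (v0 : η 0 y v = 0) v2 (w0 : η 0 y w = 0) w2
    rw [a2, v0] at v2
    rw [a2, w0] at w2
    have e : dOne ((shearCoframe ε₂ s η) 2) y v w = _ :=
      (dOne_add (h.smooth 2).dAt (hs'.dAt.fun_smul (h.smooth 0).dAt) v w)
    rw [e, dOne_mul hs'.dAt (h.smooth 0).dAt, v0, w0,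
      h.d_two v w v0 (by simpa using v2) w0 (by simpa using w2), h.d_zero v w v0 w0]
    simp only [wedge, a4]
    simp at v2 w2
    simp [shearCoframe, v2, w2]
    ring
  · intro v w hvw
    refine h.d_three v w fun k hk => ?_
    have q3 := hvw 3 (by simp)
    have q4 := hvw 4 (by simp)
    have q3' : η 3 y v = 0 ∧ η 3 y w = 0 := q3
    rw [a4, a4, q3'.1, q3'.2] at q4
    simp only [Set.mem_insert_iff, Set.mem_singleton_iff] at hk
    rcases hk with rfl | rfl | rfl | rfl
    · exact hvw 0 (by simp)
    · exact hvw 1 (by simp)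
    · exact q3
    · simpa using q4
  · intro v w hvw
    have q3 : η 3 y v = 0 ∧ η 3 y w = 0 := hvw 3 (by simp)
    have q4 := hvw 4 (by simp)
    rw [a4, a4, q3.1, q3.2] at q4
    have hk : ∀ k ∈ ({0, 1, 3, 4} : Set (Fin 7)), η k y v = 0 ∧ η k y w = 0 := by
      intro k hk
      simp only [Set.mem_insert_iff, Set.mem_singleton_iff] at hk
      rcases hk with rfl | rfl | rfl | rfl
      · exact hvw 0 (by simp)
      · exact hvw 1 (by simp)
      · exact q3
      · simpa using q4
    have e : dOne ((shearCoframe ε₂ s η) 4) y v w = _ :=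
      (dOne_add (h.smooth 4).dAt (hs.dAt.fun_smul (h.smooth 3).dAt) v w)
    rw [e, dOne_mul hs.dAt (h.smooth 3).dAt, q3.1, q3.2, h.d_four v w hk, h.d_three v w hk]
    ring
  · intro v w hvw
    refine h.d_five v w fun k hk => ?_
    have q0 : η 0 y v = 0 ∧ η 0 y w = 0 := hvw 0 (by simp)
    have q2 := hvw 2 (by simp)
    rw [a2, a2, q0.1, q0.2] at q2
    simp only [Set.mem_insert_iff, Set.mem_singleton_iff] at hk
    rcases hk with rfl | rfl | rfl | rfl
    · exact q0
    · simpa using q2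
    · exact hvw 5 (by simp)
    · exact hvw 6 (by simp)
  · intro v w hvw
    refine h.d_six v w fun k hk => ?_
    have q0 : η 0 y v = 0 ∧ η 0 y w = 0 := hvw 0 (by simp)
    have q2 := hvw 2 (by simp)
    rw [a2, a2, q0.1, q0.2] at q2
    simp only [Set.mem_insert_iff, Set.mem_singleton_iff] at hk
    rcases hk with rfl | rfl | rfl | rfl
    · exact q0
    · simpa using q2
    · exact hvw 5 (by simp)
    · exact hvw 6 (by simp)
  · rw [h.eq_I]
    refine genBy_eq_of_ann h.indep ind fun v => ?_
    simp only [Set.mem_insert_iff, Set.mem_singleton_iff, forall_eq_or_imp, forall_eq, a2]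
    have e0 : (shearCoframe ε₂ s η) 0 y v = η 0 y v := rfl
    have e1 : (shearCoframe ε₂ s η) 1 y v = η 1 y v := rfl
    rw [e0, e1]
    constructor
    · rintro ⟨b0, b1, b2⟩; simp [b0, b1, b2]
    · rintro ⟨b0, b1, b2⟩; simpa [b0, b1] using b2
  · exact h.eq_M₁.trans (by simp [genBy, Set.image_insert_eq, shearCoframe])
  · rw [h.eq_M₂]
    refine genBy_eq_of_ann h.indep ind fun v => ?_
    simp only [Set.mem_insert_iff, Set.mem_singleton_iff, forall_eq_or_imp, forall_eq, a2]
    have e0 : (shearCoframe ε₂ s η) 0 y v = η 0 y v := rfl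
    rw [e0]
    constructor
    · rintro ⟨b0, b2⟩; simp [b0, b2]
    · rintro ⟨b0, b2⟩; simpa [b0] using b2

/-- A maximally symmetric generic system has a generic coframe whose form `η⁴` is integrable. -/
theorem exists_integrable_form (h₁ : ε₁ * ε₁ = 1) (h₂ : ε₂ * ε₂ = 1)
    (hη : ∀ᶠ y in 𝓝 p, IsGenericFor I M₁ M₂ ε₁ ε₂ η y)
    (hdim : ∀ᶠ y in 𝓝 p, Module.finrank ℝ (symmetryAlgebra I y) = 9) :
    ∃ ζ : Fin 7 → OneForm Param, (∀ᶠ y in 𝓝 p, IsGenericFor I M₁ M₂ ε₁ ε₂ ζ y) ∧ ζ 6 = η 6 ∧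
      ∀ᶠ y in 𝓝 p, ∀ v w, ζ 4 y v = 0 → ζ 4 y w = 0 → dOne (ζ 4) y v w = 0 := by
  have hg := hη.mono fun y hy => hy.toIsGenericCoframeAt
  have hc : ∀ᶠ y in 𝓝 p, ∀ w, ∃ X, ActsGenericallyNear ε₁ ε₂ η y X ∧ symValue X η y = w := by
    filter_upwards [hdim, eventually_eventually_nhds.2 hη] with y hy hηy
    exact exists_symmetry h₁ h₂ (hηy.mono fun z hz => hz.toIsGenericCoframeAt)
      (hηy.mono fun z hz => hz.eq_I) hy
  -- Transitivity supplies a symmetry with η³(X) ≠ 0 near p.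
  obtain ⟨X, hX, hXv⟩ := hc.self_of_nhds (frame η 3 p, 0, 0)
  have hXp : X p = frame η 3 p := congrArg Prod.fst hXv
  have hp := hη.self_of_nhds
  have smooth : ∀ᶠ y in 𝓝 p, ∀ k, ContDiffAt ℝ ∞ (fun z => η k z (X z)) y := by
    filter_upwards [hη, hX] with y hy hXy k using (hy.smooth k).clm_apply hXy.1
  have hne : ∀ᶠ y in 𝓝 p, η 3 y (X y) ≠ 0 := by
    refine ContinuousAt.eventually_ne (smooth.self_of_nhds 3).continuousAt ?_
    rw [hXp, coframe_frame hp.indep]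
    simp
  -- Chosen so that η⁴ + sη³ annihilates X.
  let s : Param → ℝ := fun z => - η 4 z (X z) / η 3 z (X z)
  have hs : ∀ᶠ y in 𝓝 p, ContDiffAt ℝ ∞ s y := by
    filter_upwards [smooth, hne] with y hy hny using (hy 4).neg.div (hy 3) hny
  refine ⟨shearCoframe ε₂ s η, ?_, rfl, ?_⟩
  · filter_upwards [hη, hs] with y hy hsy using hy.shear hsy
  · filter_upwards [hη, hs, eventually_eventually_nhds.2 hg, eventually_eventually_nhds.2 hX, hc,
      eventually_eventually_nhds.2 hne] with y hy hsy hgy hXy hcy hny v w hv hw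
    refine dOne_eq_zero_of_symmetry hy.toIsCoframeAt hXy
      (structFn_eq_zero_of_isotropy h₁ h₂ hgy hcy) hsy.dAt hny.self_of_nhds ?_ hv hw
    filter_upwards [hny] with z hz
    simp only [s]
    field_simp
    ring

/-- The second derived systems of a maximally symmetric generic system are integrable. -/
theorem completelyIntegrable_secondDerived (h₁ : ε₁ * ε₁ = 1) (h₂ : ε₂ * ε₂ = 1)
    (hη : ∀ᶠ y in 𝓝 p, IsGenericFor I M₁ M₂ ε₁ ε₂ η y)
    (hdim : ∀ᶠ y in 𝓝 p, Module.finrank ℝ (symmetryAlgebra I y) = 9) :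
    derivedSystem (derivedSystem (derivedSystem (charSystem I M₁))) p
      = derivedSystem (derivedSystem (charSystem I M₁)) p := by
  have n₁ : ε₁ ≠ 0 := by rintro rfl; simp at h₁
  have e : derivedSystem (derivedSystem (charSystem I M₁)) =ᶠ[𝓝 p] genBy η {3, 4} := by
    filter_upwards [eventually_eventually_nhds.2 hη] with y hy
    exact derivedSystem_derivedSystem_charSystem_one n₁ hy
  rw [derivedSystem_congr e, e.self_of_nhds]
  refine derivedSystem_genBy (hη.mono fun z hz => hz.toIsCoframeAt) subset_rfl ?_
    (fun k hk hk' => absurd hk hk')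
  filter_upwards [hdim, eventually_eventually_nhds.2 hη] with y hy hηy
  have hg := hηy.mono fun z hz => hz.toIsGenericCoframeAt
  have := structFn_eq_zero_of_isotropy h₁ h₂ hg (exists_symmetry h₁ h₂ hg
    (hηy.mono fun z hz => hz.eq_I) hy)
  intro k hk i j hi hj
  simp only [Set.mem_insert_iff, Set.mem_singleton_iff, not_or] at hk hi hj
  have q := this i j hi.1 hi.2 hj.1 hj.2
  rcases hk with rfl | rfl
  · exact q.1
  · exact q.2

theorem derivedSystem_genBy_singleton (hη : ∀ᶠ y in 𝓝 p, IsCoframeAt η y) (k : Fin 7)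
    (h : ∀ᶠ y in 𝓝 p, ∀ v w, η k y v = 0 → η k y w = 0 → dOne (η k) y v w = 0) :
    derivedSystem (genBy η {k}) p = genBy η {k} p := by
  refine derivedSystem_genBy hη subset_rfl ?_ (fun l hl hl' => absurd hl hl')
  filter_upwards [hη, h] with y hy hky
  intro l hl i j hi hj
  obtain rfl : l = k := hl
  exact hky _ _ (frame_annihilated hy.indep hi hj l rfl).1
    (frame_annihilated hy.indep hi hj l rfl).2

/-- The second derived system {η³, η⁴} is itself the required subsystem. It meets I = {η⁰, η¹, η²}
in 0 because the generators belong to one coframe. Both signs stay free so that the result also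
applies with the characteristic systems exchanged. -/
theorem hasDarbouxSubsystem {S : Set Param} (hS : IsOpen S)
    (hgen : ∀ p ∈ S, ∃ ε₁ ε₂ : ℝ, ε₁ * ε₁ = 1 ∧ ε₂ * ε₂ = 1 ∧ ∃ η : Fin 7 → OneForm Param,
      ∀ᶠ y in 𝓝 p, IsGenericFor I M₁ M₂ ε₁ ε₂ η y)
    (hdim : ∀ p ∈ S, Module.finrank ℝ (symmetryAlgebra I p) = 9) :
    IsPfaffianSystem (derivedSystem (derivedSystem (charSystem I M₁))) 2 S ∧
    CompletelyIntegrableOn (derivedSystem (derivedSystem (charSystem I M₁))) S ∧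
    HasDarbouxSubsystem I M₁ S := by
  have hdim' : ∀ p ∈ S, ∀ᶠ y in 𝓝 p, Module.finrank ℝ (symmetryAlgebra I y) = 9 :=
    fun p hp => by filter_upwards [hS.mem_nhds hp] with y hy using hdim y hy
  have a : IsPfaffianSystem (derivedSystem (derivedSystem (charSystem I M₁))) 2 S := by
    intro p hp
    obtain ⟨ε₁, ε₂, h₁, h₂, η, hη⟩ := hgen p hp
    have n₁ : ε₁ ≠ 0 := by rintro rfl; simp at h₁
    refine isPfaffianSystem_genBy (η := η) (S := {p}) ![3, 4] (by decide) ?_ ?_ p rfl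
    · rintro _ rfl
      exact hη.mono fun z hz => hz.toIsCoframeAt
    · rintro _ rfl
      filter_upwards [eventually_eventually_nhds.2 hη] with y hy
      rw [derivedSystem_derivedSystem_charSystem_one n₁ hy]
      simp [Set.pair_comm]
  have b : CompletelyIntegrableOn (derivedSystem (derivedSystem (charSystem I M₁))) S := by
    intro p hp
    obtain ⟨ε₁, ε₂, h₁, h₂, η, hη⟩ := hgen p hp
    exact completelyIntegrable_secondDerived h₁ h₂ hη (hdim' p hp)
  refine ⟨a, b, _, a, ?_, b, ?_⟩
  · intro p hp
    obtain ⟨ε₁, ε₂, h₁, h₂, η, hη⟩ := hgen p hp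
    have n₁ : ε₁ ≠ 0 := by rintro rfl; simp at h₁
    rw [derivedSystem_derivedSystem_charSystem_one n₁ hη, charSystem_one hη]
    refine Submodule.span_mono (Set.image_mono ?_)
    intro k; simp only [Set.mem_insert_iff, Set.mem_singleton_iff]; tauto
  · intro p hp
    obtain ⟨ε₁, ε₂, h₁, h₂, η, hη⟩ := hgen p hp
    have n₁ : ε₁ ≠ 0 := by rintro rfl; simp at h₁
    have hp' := hη.self_of_nhds
    rw [derivedSystem_derivedSystem_charSystem_one n₁ hη, hp'.eq_I, eq_bot_iff]
    rintro α ⟨hα, hα'⟩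
    have q1 := (mem_genBy_iff hp'.indep).1 hα
    have q2 := (mem_genBy_iff hp'.indep).1 hα'
    rw [Submodule.mem_bot, ← sum_coframe hp'.indep α]
    refine Finset.sum_eq_zero fun j _ => ?_
    by_cases hj : j ∈ ({3, 4} : Set (Fin 7))
    · rw [q2 j, zero_smul]
      rcases hj with rfl | rfl <;> simp
    · rw [q1 j hj, zero_smul]

/-- The structure theorem for systems with local generic coframes and maximal symmetry. -/
theorem structure_of_maximal_symmetry {S : Set Param} (hS : IsOpen S)
    (hgen : ∀ p ∈ S, ∃ ε : ℝ, (ε = 1 ∨ ε = -1) ∧ ∃ η : Fin 7 → OneForm Param,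
      ∀ᶠ y in 𝓝 p, IsGenericFor I M₁ M₂ 1 ε η y)
    (hdim : ∀ p ∈ S, Module.finrank ℝ (symmetryAlgebra I p) = 9) :
    (IsPfaffianSystem (derivedSystem (derivedSystem (charSystem I M₁))) 2 S ∧
      CompletelyIntegrableOn (derivedSystem (derivedSystem (charSystem I M₁))) S) ∧
    (IsPfaffianSystem (derivedSystem (derivedSystem (charSystem I M₂))) 2 S ∧
      CompletelyIntegrableOn (derivedSystem (derivedSystem (charSystem I M₂))) S) ∧
    IsDarbouxIntegrable I M₁ M₂ S ∧
    ∀ p ∈ S, ∃ ε : ℝ, (ε = 1 ∨ ε = -1) ∧ ∃ (U : Set Param) (η : Fin 7 → OneForm Param),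
      IsOpen U ∧ p ∈ U ∧ U ⊆ S ∧
      (∀ y ∈ U, IsAdaptedCoframeAt I M₁ M₂ ε η y) ∧
      (∀ y ∈ U,
        derivedSystem (derivedSystem (charSystem I M₁)) y = genBy η {3, 4} y ∧
        derivedSystem (derivedSystem (charSystem I M₂)) y = genBy η {5, 6} y) ∧
      IsPfaffianSystem (genBy η {4}) 1 U ∧ CompletelyIntegrableOn (genBy η {4}) U ∧
      IsPfaffianSystem (genBy η {6}) 1 U ∧ CompletelyIntegrableOn (genBy η {6}) U := by
  have sq : ∀ {ε : ℝ}, (ε = 1 ∨ ε = -1) → ε * ε = 1 := by rintro _ (rfl | rfl) <;> norm_num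
  obtain ⟨a1, b1, c1⟩ := hasDarbouxSubsystem (M₂ := M₂) hS (fun p hp => by
    obtain ⟨ε, hε, η, hη⟩ := hgen p hp
    exact ⟨1, ε, by norm_num, sq hε, η, hη⟩) hdim
  obtain ⟨a2, b2, c2⟩ := hasDarbouxSubsystem (M₂ := M₁) hS (fun p hp => by
    obtain ⟨ε, hε, η, hη⟩ := hgen p hp
    exact ⟨ε, 1, sq hε, by norm_num, _, hη.mono fun z hz => hz.swap⟩) hdim
  refine ⟨⟨a1, b1⟩, ⟨a2, b2⟩, ⟨c1, c2⟩, fun p hp => ?_⟩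
  obtain ⟨ε, hε, η₀, hη₀⟩ := hgen p hp
  have hdim' : ∀ᶠ y in 𝓝 p, Module.finrank ℝ (symmetryAlgebra I y) = 9 := by
    filter_upwards [hS.mem_nhds hp] with y hy using hdim y hy
  obtain ⟨η₁, hη₁, -, hi₁⟩ := exists_integrable_form (one_mul 1) (sq hε) hη₀ hdim'
  -- In the exchanged labelling the integrable form found first has index 6, which this second shear
  -- leaves unchanged. So both integrable forms survive.
  obtain ⟨η₂, hη₂, h6, hi₂⟩ := exists_integrable_form (sq hε) (one_mul 1)
    (hη₁.mono fun z hz => hz.swap) hdim'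
  have hη₃ := hη₂.mono fun z hz => hz.swap
  have i4 : η₂ (swapIdx 4) = η₁ 4 := h6
  obtain ⟨U, hU, hUo, hpU⟩ := eventually_nhds_iff.1
    ((hη₃.and (hi₁.and hi₂)).and (hS.mem_nhds hp))
  have hnear : ∀ y ∈ U, ∀ᶠ z in 𝓝 y, IsGenericFor I M₁ M₂ 1 ε (fun k => η₂ (swapIdx k)) z :=
    fun y hy => by filter_upwards [hUo.mem_nhds hy] with z hz using (hU z hz).1.1
  have hco : ∀ y ∈ U, ∀ᶠ z in 𝓝 y, IsCoframeAt (fun k => η₂ (swapIdx k)) z :=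
    fun y hy => (hnear y hy).mono fun z hz => hz.toIsCoframeAt
  have had : ∀ y ∈ U, IsAdaptedCoframeAt I M₁ M₂ ε (fun k => η₂ (swapIdx k)) y := fun y hy =>
    isAdaptedCoframeAt (by rcases hε with rfl | rfl <;> norm_num) (hnear y hy)
  refine ⟨ε, hε, U, fun k => η₂ (swapIdx k), hUo, hpU, fun y hy => (hU y hy).2, had,
    fun y hy => ⟨(had y hy).char_one_derived₂, (had y hy).char_two_derived₂⟩, ?_, ?_, ?_, ?_⟩
  · exact isPfaffianSystem_genBy ![4] (by decide) hco fun y hy => Eventually.of_forall fun z => by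
      simp
  · intro y hy
    refine derivedSystem_genBy_singleton (hco y hy) 4 ?_
    filter_upwards [hUo.mem_nhds hy] with z hz
    rw [i4]
    exact (hU z hz).1.2.1
  · exact isPfaffianSystem_genBy ![6] (by decide) hco fun y hy => Eventually.of_forall fun z => by
      simp
  · intro y hy
    refine derivedSystem_genBy_singleton (hco y hy) 6 ?_
    filter_upwards [hUo.mem_nhds hy] with z hz
    exact (hU z hz).1.2.2

end Darboux

/-! ### Normalization of coframes -/

section Normalization

variable {I M₁ M₂ : CotangentField Param} {η : Fin 7 → OneForm Param} {y p : Param}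

/-- A coframe adapted to `I`, `M₁`, `M₂`, with normalized `dη⁰` modulo `η⁰`. -/
structure IsContactCoframeAt (I M₁ M₂ : CotangentField Param) (η : Fin 7 → OneForm Param)
    (y : Param) : Prop extends IsCoframeAt η y where
  d_zero : ∀ v w, η 0 y v = 0 → η 0 y w = 0 →
    dOne (η 0) y v w = wedge (η 2 y) (η 5 y) v w + wedge (η 1 y) (η 3 y) v w
  eq_I : I y = genBy η {0, 1, 2} y
  eq_M₁ : M₁ y = genBy η {0, 1} y
  eq_M₂ : M₂ y = genBy η {0, 2} y

theorem IsContactCoframeAt.structFn_zero (h : IsContactCoframeAt I M₁ M₂ η y) {j k : Fin 7}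
    (hj : j ≠ 0) (hk : k ≠ 0) :
    structFn η 0 j k y = wedgeCoeff 2 5 j k + wedgeCoeff 1 3 j k := by
  rw [structFn, h.d_zero _ _ (by simp [coframe_frame h.indep, hj.symm])
    (by simp [coframe_frame h.indep, hk.symm])]
  simp [wedge, wedgeCoeff, coframe_frame h.indep]

theorem fderiv_eq_zero_of_eventually_const {E F : Type*} [NormedAddCommGroup E] [NormedSpace ℝ E]
    [NormedAddCommGroup F] [NormedSpace ℝ F] {f : E → F} {c : F} {x : E}
    (h : ∀ᶠ y in 𝓝 x, f y = c) : fderiv ℝ f x = 0 := by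
  rw [Filter.EventuallyEq.fderiv_eq (𝕜 := ℝ) (h : f =ᶠ[𝓝 x] fun _ => c)]
  simp

theorem dOne_mod_I (h : LinearIndependent ℝ (fun k => η k y)) (θ : OneForm Param)
    {c : Fin 7 → Fin 7 → ℝ} (hc : ∀ i j, dOne θ y (frame η i y) (frame η j y) = c i j)
    {v w : Param} (hv : η 0 y v = 0 ∧ η 1 y v = 0 ∧ η 2 y v = 0)
    (hw : η 0 y w = 0 ∧ η 1 y w = 0 ∧ η 2 y w = 0) :
    dOne θ y v w = c 3 4 * wedge (η 3 y) (η 4 y) v w + c 3 5 * wedge (η 3 y) (η 5 y) v w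
      + c 3 6 * wedge (η 3 y) (η 6 y) v w + c 4 5 * wedge (η 4 y) (η 5 y) v w
      + c 4 6 * wedge (η 4 y) (η 6 y) v w + c 5 6 * wedge (η 5 y) (η 6 y) v w := by
  have s : ∀ i j, c i j = - c j i := fun i j => by rw [← hc, ← hc, dOne_swap]
  have z : ∀ i, c i i = 0 := fun i => by rw [← hc, dOne_self]
  rw [dOne_expand h]
  simp only [hc, Fin.sum_univ_seven, hv, hw, z]
  rw [s 4 3, s 5 3, s 6 3, s 5 4, s 6 4, s 6 5]
  simp only [wedge]
  ring

theorem dOne_mod_M₁ (h : LinearIndependent ℝ (fun k => η k y)) (θ : OneForm Param)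
    {c : Fin 7 → Fin 7 → ℝ} (hc : ∀ i j, dOne θ y (frame η i y) (frame η j y) = c i j)
    {v w : Param} (hv : η 0 y v = 0 ∧ η 1 y v = 0) (hw : η 0 y w = 0 ∧ η 1 y w = 0) :
    dOne θ y v w = c 2 3 * wedge (η 2 y) (η 3 y) v w + c 2 4 * wedge (η 2 y) (η 4 y) v w
      + c 2 5 * wedge (η 2 y) (η 5 y) v w + c 2 6 * wedge (η 2 y) (η 6 y) v w
      + c 3 4 * wedge (η 3 y) (η 4 y) v w + c 3 5 * wedge (η 3 y) (η 5 y) v w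
      + c 3 6 * wedge (η 3 y) (η 6 y) v w + c 4 5 * wedge (η 4 y) (η 5 y) v w
      + c 4 6 * wedge (η 4 y) (η 6 y) v w + c 5 6 * wedge (η 5 y) (η 6 y) v w := by
  have s : ∀ i j, c i j = - c j i := fun i j => by rw [← hc, ← hc, dOne_swap]
  have z : ∀ i, c i i = 0 := fun i => by rw [← hc, dOne_self]
  rw [dOne_expand h]
  simp only [hc, Fin.sum_univ_seven, hv, hw, z]
  rw [s 3 2, s 4 2, s 5 2, s 6 2, s 4 3, s 5 3, s 6 3, s 5 4, s 6 4, s 6 5]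
  simp only [wedge]
  ring

theorem dOne_mod_M₂ (h : LinearIndependent ℝ (fun k => η k y)) (θ : OneForm Param)
    {c : Fin 7 → Fin 7 → ℝ} (hc : ∀ i j, dOne θ y (frame η i y) (frame η j y) = c i j)
    {v w : Param} (hv : η 0 y v = 0 ∧ η 2 y v = 0) (hw : η 0 y w = 0 ∧ η 2 y w = 0) :
    dOne θ y v w = c 1 3 * wedge (η 1 y) (η 3 y) v w + c 1 4 * wedge (η 1 y) (η 4 y) v w
      + c 1 5 * wedge (η 1 y) (η 5 y) v w + c 1 6 * wedge (η 1 y) (η 6 y) v w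
      + c 3 4 * wedge (η 3 y) (η 4 y) v w + c 3 5 * wedge (η 3 y) (η 5 y) v w
      + c 3 6 * wedge (η 3 y) (η 6 y) v w + c 4 5 * wedge (η 4 y) (η 5 y) v w
      + c 4 6 * wedge (η 4 y) (η 6 y) v w + c 5 6 * wedge (η 5 y) (η 6 y) v w := by
  have s : ∀ i j, c i j = - c j i := fun i j => by rw [← hc, ← hc, dOne_swap]
  have z : ∀ i, c i i = 0 := fun i => by rw [← hc, dOne_self]
  rw [dOne_expand h]
  simp only [hc, Fin.sum_univ_seven, hv, hw, z]
  rw [s 3 1, s 4 1, s 5 1, s 6 1, s 4 3, s 5 3, s 6 3, s 5 4, s 6 4, s 6 5]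
  simp only [wedge]
  ring

/-- The product of the forms `dη^a`, `dη^b` modulo `I`, as a multiple of `η³ ∧ η⁴ ∧ η⁵ ∧ η⁶`. -/
def conformalCoeff (η : Fin 7 → OneForm Param) (a b : Fin 7) (y : Param) : ℝ :=
  structFn η a 3 4 y * structFn η b 5 6 y - structFn η a 3 5 y * structFn η b 4 6 y
    + structFn η a 3 6 y * structFn η b 4 5 y + structFn η a 4 5 y * structFn η b 3 6 y
    - structFn η a 4 6 y * structFn η b 3 5 y + structFn η a 5 6 y * structFn η b 3 4 y

/-- A contact coframe with `dη¹ ≡ η³ ∧ η⁴`, `dη² ≡ η⁵ ∧ η⁶` modulo `I`. -/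
structure IsSplitCoframeAt (I M₁ M₂ : CotangentField Param) (η : Fin 7 → OneForm Param)
    (y : Param) : Prop extends IsContactCoframeAt I M₁ M₂ η y where
  d_one : ∀ v w, η 0 y v = 0 ∧ η 1 y v = 0 ∧ η 2 y v = 0 →
    η 0 y w = 0 ∧ η 1 y w = 0 ∧ η 2 y w = 0 → dOne (η 1) y v w = wedge (η 3 y) (η 4 y) v w
  d_two : ∀ v w, η 0 y v = 0 ∧ η 1 y v = 0 ∧ η 2 y v = 0 →
    η 0 y w = 0 ∧ η 1 y w = 0 ∧ η 2 y w = 0 → dOne (η 2) y v w = wedge (η 5 y) (η 6 y) v w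

/-- The identity d²η⁰ = 0 relates dη¹ and dη² modulo I. With the isotropy conditions it makes them
decomposable, divisible by η³ and η⁵ respectively, and the cofactors become the new η⁴ and η⁶. -/
theorem exists_splitCoframe (hη : ∀ᶠ y in 𝓝 p, IsContactCoframeAt I M₁ M₂ η y)
    (h11 : ∀ᶠ y in 𝓝 p, conformalCoeff η 1 1 y = 0) (h22 : ∀ᶠ y in 𝓝 p, conformalCoeff η 2 2 y = 0)
    (h12 : ∀ᶠ y in 𝓝 p, conformalCoeff η 1 2 y ≠ 0) :
    ∃ ζ, ∀ᶠ y in 𝓝 p, IsSplitCoframeAt I M₁ M₂ ζ y := by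
  refine ⟨![η 0, η 1, η 2, η 3, fun z => structFn η 1 3 4 z • η 4 z + structFn η 1 3 5 z • η 5 z
    + structFn η 1 3 6 z • η 6 z, η 5, fun z => structFn η 2 5 6 z • η 6 z
      - structFn η 2 4 5 z • η 4 z - structFn η 2 3 5 z • η 3 z], ?_⟩
  filter_upwards [hη, eventually_eventually_nhds.2 hη, h11, h22, h12] with y hy hηy e11 e22 e12
  have c0 := fun j k => hy.structFn_zero (j := j) (k := k)
  have D0 : ∀ j k, j ≠ 0 → k ≠ 0 → fderiv ℝ (structFn η 0 j k) y = 0 := fun j k hj hk =>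
    fderiv_eq_zero_of_eventually_const (hηy.mono fun z hz => hz.structFn_zero hj hk)
  -- These are components of dη¹∧η³ + dη²∧η⁵ ≡ 0 modulo I, obtained by differentiating dη⁰.
  have j1 := structFn_jacobi hy.toIsCoframeAt 0 4 6 3
  have j2 := structFn_jacobi hy.toIsCoframeAt 0 4 6 5
  have j3 := structFn_jacobi hy.toIsCoframeAt 0 3 5 6
  have j4 := structFn_jacobi hy.toIsCoframeAt 0 3 4 5
  simp [Fin.sum_univ_seven, c0, D0, wedgeCoeff, structFn_swap η 2 6 3] at j1 j2 j3 j4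
  have k1 : structFn η 1 4 6 y = 0 := by linarith
  have k2 : structFn η 2 4 6 y = 0 := by linarith
  have k3 : structFn η 1 5 6 y = structFn η 2 3 6 y := by linarith
  have k4 : structFn η 1 4 5 y = - structFn η 2 3 4 y := by linarith
  simp only [conformalCoeff, k1, k2, k3, k4] at e11 e22 e12
  set a := structFn η 1 3 4 y
  set b := structFn η 1 3 6 y
  set m := structFn η 2 3 6 y
  set n := structFn η 2 3 4 y
  set A := structFn η 2 5 6 y
  set B := structFn η 2 4 5 y
  have e12' : a * A + b * B ≠ 0 := fun h => e12 (by linear_combination h)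
  have f1 : a * m - b * n = 0 := by linarith
  have f2 : n * A + m * B = 0 := by linarith
  -- Isotropy is a linear system in (m, n) with determinant aA + bB. This is the pairing of η¹ with
  -- η², hence nonzero; the same number makes the new η⁴ and η⁶ independent.
  have hm : m = 0 := by
    have : m * (a * A + b * B) = 0 := by linear_combination A * f1 + b * f2
    exact (mul_eq_zero.1 this).resolve_right e12'
  have hn : n = 0 := by
    have : n * (a * A + b * B) = 0 := by linear_combination a * f2 - B * f1
    exact (mul_eq_zero.1 this).resolve_right e12'
  rw [hm] at k3
  rw [hn, neg_zero] at k4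
  have sc := fun i j k => contDiffAt_structFn hy.toIsCoframeAt i j k
  refine ⟨⟨⟨?_, ?_⟩, ?_, ?_, ?_, ?_⟩, ?_, ?_⟩
  · intro k
    fin_cases k
    · exact hy.smooth 0
    · exact hy.smooth 1
    · exact hy.smooth 2
    · exact hy.smooth 3
    · exact (((sc 1 3 4).smul (hy.smooth 4)).add ((sc 1 3 5).smul (hy.smooth 5))).add
        ((sc 1 3 6).smul (hy.smooth 6))
    · exact hy.smooth 5
    · exact (((sc 2 5 6).smul (hy.smooth 6)).sub ((sc 2 4 5).smul (hy.smooth 4))).sub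
        ((sc 2 3 5).smul (hy.smooth 3))
  · refine indep_of_injective fun v hv => eq_zero_of_coframe hy.indep ?_
    have v0 : η 0 y v = 0 := hv 0
    have v1 : η 1 y v = 0 := hv 1
    have v2 : η 2 y v = 0 := hv 2
    have v3 : η 3 y v = 0 := hv 3
    have v5 : η 5 y v = 0 := hv 5
    have v4 := hv 4
    have v6 := hv 6
    simp [v3, v5] at v4 v6
    change a * η 4 y v + b * η 6 y v = 0 at v4
    change A * η 6 y v - B * η 4 y v = 0 at v6
    have u4 : η 4 y v = 0 := by
      have : η 4 y v * (a * A + b * B) = 0 := by linear_combination A * v4 - b * v6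
      exact (mul_eq_zero.1 this).resolve_right e12'
    have u6 : η 6 y v = 0 := by
      have : η 6 y v * (a * A + b * B) = 0 := by linear_combination B * v4 + a * v6
      exact (mul_eq_zero.1 this).resolve_right e12'
    intro k
    fin_cases k
    exacts [v0, v1, v2, v3, u4, v5, u6]
  · exact hy.d_zero
  · exact hy.eq_I.trans (by simp [genBy, Set.image_insert_eq])
  · exact hy.eq_M₁.trans (by simp [genBy, Set.image_insert_eq])
  · exact hy.eq_M₂.trans (by simp [genBy, Set.image_insert_eq])
  · intro v w hv hw
    refine (dOne_mod_I hy.indep (η 1) (c := fun i j => structFn η 1 i j y) (fun _ _ => rfl)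
      hv hw).trans ?_
    simp only [k1, k3, k4]
    simp [wedge]
    ring
  · intro v w hv hw
    refine (dOne_mod_I hy.indep (η 2) (c := fun i j => structFn η 2 i j y) (fun _ _ => rfl)
      hv hw).trans ?_
    have hm' : structFn η 2 3 6 y = 0 := hm
    have hn' : structFn η 2 3 4 y = 0 := hn
    simp only [hm', hn', k2]
    simp [wedge]
    ring

/-- A contact coframe with normalized `dη¹`, `dη²` modulo `M₁`, `M₂`, up to coefficients. -/
structure IsSemiGenericCoframeAt (I M₁ M₂ : CotangentField Param) (η : Fin 7 → OneForm Param)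
    (A B A' B' : Param → ℝ) (y : Param) : Prop extends IsContactCoframeAt I M₁ M₂ η y where
  d_one : ∀ v w, η 0 y v = 0 ∧ η 1 y v = 0 → η 0 y w = 0 ∧ η 1 y w = 0 →
    dOne (η 1) y v w = wedge (η 3 y) (η 4 y) v w + (A y * wedge (η 2 y) (η 5 y) v w
      + B y * wedge (η 2 y) (η 6 y) v w)
  d_two : ∀ v w, η 0 y v = 0 ∧ η 2 y v = 0 → η 0 y w = 0 ∧ η 2 y w = 0 →
    dOne (η 2) y v w = wedge (η 5 y) (η 6 y) v w + (A' y * wedge (η 1 y) (η 3 y) v w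
      + B' y * wedge (η 1 y) (η 4 y) v w)
  smooth_coeff : ContDiffAt ℝ ∞ A y ∧ ContDiffAt ℝ ∞ B y ∧ ContDiffAt ℝ ∞ A' y ∧
    ContDiffAt ℝ ∞ B' y

theorem IsSplitCoframeAt.structFn_one_two (h : IsSplitCoframeAt I M₁ M₂ η y) {j k : Fin 7}
    (hj : j ∉ ({0, 1, 2} : Set (Fin 7))) (hk : k ∉ ({0, 1, 2} : Set (Fin 7))) :
    structFn η 1 j k y = wedgeCoeff 3 4 j k ∧ structFn η 2 j k y = wedgeCoeff 5 6 j k := by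
  have a := frame_annihilated h.indep hj hk
  have hv : η 0 y (frame η j y) = 0 ∧ η 1 y (frame η j y) = 0 ∧ η 2 y (frame η j y) = 0 :=
    ⟨(a 0 (by simp)).1, (a 1 (by simp)).1, (a 2 (by simp)).1⟩
  have hw : η 0 y (frame η k y) = 0 ∧ η 1 y (frame η k y) = 0 ∧ η 2 y (frame η k y) = 0 :=
    ⟨(a 0 (by simp)).2, (a 1 (by simp)).2, (a 2 (by simp)).2⟩
  rw [structFn, structFn, h.d_one _ _ hv hw, h.d_two _ _ hv hw]
  simp [wedge, wedgeCoeff, coframe_frame h.indep]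

/-- The terms η²∧η³ and η²∧η⁴ of dη¹ are absorbed into η³∧η⁴, and similarly η¹∧η⁵ and η¹∧η⁶ of dη²
into η⁵∧η⁶. To keep dη⁰, the multiple of η² added to η³ must equal the multiple of η¹ added to η⁵.
-/
theorem exists_semiGenericCoframe (hη : ∀ᶠ y in 𝓝 p, IsSplitCoframeAt I M₁ M₂ η y) :
    ∃ ζ A B A' B', ∀ᶠ y in 𝓝 p, IsSemiGenericCoframeAt I M₁ M₂ ζ A B A' B' y := by
  refine ⟨![η 0, η 1, η 2, fun z => η 3 z + structFn η 1 2 4 z • η 2 z,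
    fun z => η 4 z - structFn η 1 2 3 z • η 2 z, fun z => η 5 z + structFn η 1 2 4 z • η 1 z,
    fun z => η 6 z - structFn η 2 1 5 z • η 1 z], structFn η 1 2 5, structFn η 1 2 6,
    structFn η 2 1 3, structFn η 2 1 4, ?_⟩
  filter_upwards [hη, eventually_eventually_nhds.2 hη] with y hy hηy
  have c0 := fun j k => hy.structFn_zero (j := j) (k := k)
  have c1 := fun j k hj hk => (hy.structFn_one_two (j := j) (k := k) hj hk).1
  have c2 := fun j k hj hk => (hy.structFn_one_two (j := j) (k := k) hj hk).2
  have D0 : ∀ j k, j ≠ 0 → k ≠ 0 → fderiv ℝ (structFn η 0 j k) y = 0 := fun j k hj hk =>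
    fderiv_eq_zero_of_eventually_const (hηy.mono fun z hz => hz.structFn_zero hj hk)
  have D1 : ∀ j k, j ∉ ({0, 1, 2} : Set (Fin 7)) → k ∉ ({0, 1, 2} : Set (Fin 7)) →
      fderiv ℝ (structFn η 1 j k) y = 0 := fun j k hj hk =>
    fderiv_eq_zero_of_eventually_const (hηy.mono fun z hz => (hz.structFn_one_two hj hk).1)
  have j1 := structFn_jacobi hy.toIsCoframeAt 0 1 5 6
  have j2 := structFn_jacobi hy.toIsCoframeAt 1 4 5 6
  simp [Fin.sum_univ_seven, c0, c1, c2, D0, D1, wedgeCoeff, structFn_swap η 2 6 1] at j1 j2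
  -- The compatibility of the two absorptions is forced by d²η⁰ = 0 and d²η¹ = 0.
  have hk : structFn η 2 1 6 y = structFn η 1 2 4 y := by linarith
  have sc := fun i j k => contDiffAt_structFn hy.toIsCoframeAt i j k
  refine ⟨⟨⟨?_, ?_⟩, ?_, ?_, ?_, ?_⟩, ?_, ?_, sc _ _ _, sc _ _ _, sc _ _ _, sc _ _ _⟩
  · intro k
    fin_cases k
    · exact hy.smooth 0
    · exact hy.smooth 1
    · exact hy.smooth 2
    · exact (hy.smooth 3).add ((sc 1 2 4).smul (hy.smooth 2))
    · exact (hy.smooth 4).sub ((sc 1 2 3).smul (hy.smooth 2))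
    · exact (hy.smooth 5).add ((sc 1 2 4).smul (hy.smooth 1))
    · exact (hy.smooth 6).sub ((sc 2 1 5).smul (hy.smooth 1))
  · refine indep_of_injective fun v hv => eq_zero_of_coframe hy.indep ?_
    have v0 : η 0 y v = 0 := hv 0
    have v1 : η 1 y v = 0 := hv 1
    have v2 : η 2 y v = 0 := hv 2
    have v3 := hv 3
    have v4 := hv 4
    have v5 := hv 5
    have v6 := hv 6
    simp [v1, v2] at v3 v4 v5 v6
    intro k
    fin_cases k
    exacts [v0, v1, v2, v3, v4, v5, v6]
  · intro v w hv hw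
    refine (hy.d_zero v w hv hw).trans ?_
    simp [wedge]
    ring
  · exact hy.eq_I.trans (by simp [genBy, Set.image_insert_eq])
  · exact hy.eq_M₁.trans (by simp [genBy, Set.image_insert_eq])
  · exact hy.eq_M₂.trans (by simp [genBy, Set.image_insert_eq])
  · intro v w hv hw
    refine (dOne_mod_M₁ hy.indep (η 1) (c := fun i j => structFn η 1 i j y) (fun _ _ => rfl)
      hv hw).trans ?_
    have v1 : η 1 y v = 0 := hv.2
    have w1 : η 1 y w = 0 := hw.2
    simp [c1, wedge, wedgeCoeff, v1, w1]
    ring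
  · intro v w hv hw
    refine (dOne_mod_M₂ hy.indep (η 2) (c := fun i j => structFn η 2 i j y) (fun _ _ => rfl)
      hv hw).trans ?_
    have v2 : η 2 y v = 0 := hv.2
    have w2 : η 2 y w = 0 := hw.2
    simp [c2, wedge, wedgeCoeff, v2, w2, hk]
    ring

/-- If the Cartan system has full rank, there is no Cauchy characteristic vector. -/
theorem eq_zero_of_isChar_of_classAt {D : CotangentField Param} (h : classAt D y = 7) {v : Param}
    (hv : IsChar D D y v) : v = 0 := by
  have htop : charSystem D D y = ⊤ :=
    Submodule.eq_top_of_finrank_eq (by rw [finrank_dual_param]; exact h)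
  funext j
  have : (ContinuousLinearMap.proj j : Param →L[ℝ] ℝ) ∈ charSystem D D y := by
    rw [htop]; trivial
  exact this v hv

/-- If B = 0 at the point, then e_6 is a Cauchy characteristic vector of M₁, against class 7;
likewise e_4 for M₂ if B' = 0. -/
theorem IsSemiGenericCoframeAt.coeff_ne_zero {A B A' B' : Param → ℝ}
    (hη : ∀ᶠ y in 𝓝 p, IsSemiGenericCoframeAt I M₁ M₂ η A B A' B' y)
    (h₁ : classAt M₁ p = 7) (h₂ : classAt M₂ p = 7) : B p ≠ 0 ∧ B' p ≠ 0 := by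
  have hp := hη.self_of_nhds
  have hc := hη.mono fun z hz => hz.toIsCoframeAt
  have fr := fun i j => coframe_frame hp.indep i j
  constructor
  · intro hB
    have : IsChar M₁ M₁ p (frame η 6 p) := by
      refine (isChar_iff hc hp.eq_M₁ (hη.mono fun z hz => hz.eq_M₁) subset_rfl).2 ⟨?_, ?_⟩
      · simp [fr]
      · intro k hk j hj
        simp only [Set.mem_insert_iff, Set.mem_singleton_iff, not_or] at hk hj
        rcases hk with rfl | rfl
        · rw [hp.d_zero _ _ (by simp [fr]) (by simp [fr, Ne.symm hj.1])]
          simp [wedge, fr]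
        · rw [hp.d_one _ _ (by simp [fr]) (by simp [fr, Ne.symm hj.1, Ne.symm hj.2])]
          simp [wedge, fr, hB]
    have e := coframe_frame hp.indep 6 6
    rw [eq_zero_of_isChar_of_classAt h₁ this] at e
    simp at e
  · intro hB
    have : IsChar M₂ M₂ p (frame η 4 p) := by
      refine (isChar_iff hc hp.eq_M₂ (hη.mono fun z hz => hz.eq_M₂) subset_rfl).2 ⟨?_, ?_⟩
      · simp [fr]
      · intro k hk j hj
        simp only [Set.mem_insert_iff, Set.mem_singleton_iff, not_or] at hk hj
        rcases hk with rfl | rfl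
        · rw [hp.d_zero _ _ (by simp [fr]) (by simp [fr, Ne.symm hj.1])]
          simp [wedge, fr]
        · rw [hp.d_two _ _ (by simp [fr]) (by simp [fr, Ne.symm hj.1, Ne.symm hj.2])]
          simp [wedge, fr, hB]
    have e := coframe_frame hp.indep 4 4
    rw [eq_zero_of_isChar_of_classAt h₂ this] at e
    simp at e

end Normalization

/-! ### Scaling to the invariant ε and absorption of torsion in the last four forms -/

section Normalization

variable {I M₁ M₂ : CotangentField Param} {η : Fin 7 → OneForm Param} {y p : Param}

/-- A contact coframe with normalized `dη¹`, `dη²` modulo `M₁`, `M₂`. -/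
structure IsNormalCoframeAt (I M₁ M₂ : CotangentField Param) (ε : ℝ) (η : Fin 7 → OneForm Param)
    (y : Param) : Prop extends IsContactCoframeAt I M₁ M₂ η y where
  d_one : ∀ v w, η 0 y v = 0 ∧ η 1 y v = 0 → η 0 y w = 0 ∧ η 1 y w = 0 →
    dOne (η 1) y v w = wedge (η 3 y) (η 4 y) v w + wedge (η 2 y) (η 6 y) v w
  d_two : ∀ v w, η 0 y v = 0 ∧ η 2 y v = 0 → η 0 y w = 0 ∧ η 2 y w = 0 →
    dOne (η 2) y v w = wedge (η 5 y) (η 6 y) v w + ε * wedge (η 1 y) (η 4 y) v w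

theorem genBy_eq_of_smul {ζ : Fin 7 → OneForm Param} {K : Set (Fin 7)}
    (h : LinearIndependent ℝ (fun k => η k y)) (h' : LinearIndependent ℝ (fun k => ζ k y))
    (e : ∀ k ∈ K, ∃ c : ℝ, c ≠ 0 ∧ ∀ v, ζ k y v = c * η k y v) : genBy η K y = genBy ζ K y := by
  refine genBy_eq_of_ann h h' fun v => forall₂_congr fun k hk => ?_
  obtain ⟨c, hc, hv⟩ := e k hk
  rw [hv, mul_eq_zero, or_iff_right hc]

/-- The A-terms are absorbed into η⁴ and η⁶. A scaling that keeps dη⁰ and the terms η³∧η⁴, η⁵∧η⁶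
then turns B into 1 and B' into ε, provided l⁴B' = εB; so only the sign of B/B' survives. -/
theorem exists_normalCoframe {A B A' B' : Param → ℝ}
    (hη : ∀ᶠ y in 𝓝 p, IsSemiGenericCoframeAt I M₁ M₂ η A B A' B' y) (hB : B p ≠ 0)
    (hB' : B' p ≠ 0) :
    ∃ ε : ℝ, (ε = 1 ∨ ε = -1) ∧ ∃ ζ, ∀ᶠ y in 𝓝 p, IsNormalCoframeAt I M₁ M₂ ε ζ y := by
  obtain ⟨ε, hε, hpos⟩ : ∃ ε : ℝ, (ε = 1 ∨ ε = -1) ∧ 0 < ε * B p / B' p := by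
    rcases lt_or_gt_of_ne (div_ne_zero hB hB') with h | h
    · exact ⟨-1, Or.inr rfl, by rw [neg_one_mul, neg_div]; linarith⟩
    · exact ⟨1, Or.inl rfl, by rwa [one_mul]⟩
  have hεε : ε * ε = 1 := by rcases hε with rfl | rfl <;> norm_num
  have hp := hη.self_of_nhds
  have neB : ∀ᶠ y in 𝓝 p, B y ≠ 0 := hp.smooth_coeff.2.1.continuousAt.eventually_ne hB
  have neB' : ∀ᶠ y in 𝓝 p, B' y ≠ 0 := hp.smooth_coeff.2.2.2.continuousAt.eventually_ne hB'
  have pos : ∀ᶠ y in 𝓝 p, 0 < ε * B y / B' y := by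
    have hc : ContinuousAt (fun y => ε * B y / B' y) p :=
      (continuousAt_const.mul hp.smooth_coeff.2.1.continuousAt).div
        hp.smooth_coeff.2.2.2.continuousAt hB'
    exact hc.eventually (lt_mem_nhds hpos)
  -- The positive fourth root of εB/B', smooth because the radicand is positive near p.
  let l : Param → ℝ := fun y => √(√(ε * B y / B' y))
  refine ⟨ε, hε, ![fun z => (l z ^ 3 / B z) • η 0 z, η 1, fun z => l z • η 2 z,
    fun z => (l z ^ 3 / B z) • η 3 z, fun z => (B z / l z ^ 3) • (η 4 z + (A' z / B' z) • η 3 z),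
    fun z => (l z ^ 2 / B z) • η 5 z, fun z => (B z / l z) • (η 6 z + (A z / B z) • η 5 z)], ?_⟩
  filter_upwards [hη, neB, neB', pos] with y hy hBy hBy' hpy
  obtain ⟨sA, sB, sA', sB'⟩ := hy.smooth_coeff
  have sr : ContDiffAt ℝ ∞ (fun z => ε * B z / B' z) y := (contDiffAt_const.mul sB).div sB' hBy'
  have sl : ContDiffAt ℝ ∞ l y := (sr.sqrt hpy.ne').sqrt (Real.sqrt_pos.2 hpy).ne'
  have lpos : 0 < l y := Real.sqrt_pos.2 (Real.sqrt_pos.2 hpy)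
  have l4 : l y ^ 4 * B' y = ε * B y := by
    have : l y ^ 4 = ε * B y / B' y := by
      calc l y ^ 4 = (l y ^ 2) ^ 2 := by ring
        _ = ε * B y / B' y := by
          simp only [l]
          rw [Real.sq_sqrt (Real.sqrt_nonneg _), Real.sq_sqrt hpy.le]
    rw [this]
    field_simp
  have lne := lpos.ne'
  have s1 : ContDiffAt ℝ ∞ (fun z => l z ^ 3 / B z) y := (sl.pow 3).div sB hBy
  have s2 : ContDiffAt ℝ ∞ (fun z => B z / l z ^ 3) y := sB.div (sl.pow 3) (pow_ne_zero 3 lne)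
  have n1 : l y ^ 3 / B y ≠ 0 := div_ne_zero (pow_ne_zero 3 lne) hBy
  have n2 : B y / l y ^ 3 ≠ 0 := div_ne_zero hBy (pow_ne_zero 3 lne)
  have n3 : l y ^ 2 / B y ≠ 0 := div_ne_zero (pow_ne_zero 2 lne) hBy
  have n4 : B y / l y ≠ 0 := div_ne_zero hBy lne
  have key : ∀ {c x : ℝ}, c ≠ 0 → (c * x = 0 ↔ x = 0) := fun hc => by
    rw [mul_eq_zero, or_iff_right hc]
  have ind : LinearIndependent ℝ (fun k => (![fun z => (l z ^ 3 / B z) • η 0 z, η 1,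
      fun z => l z • η 2 z, fun z => (l z ^ 3 / B z) • η 3 z,
      fun z => (B z / l z ^ 3) • (η 4 z + (A' z / B' z) • η 3 z),
      fun z => (l z ^ 2 / B z) • η 5 z,
      fun z => (B z / l z) • (η 6 z + (A z / B z) • η 5 z)] : Fin 7 → OneForm Param) k y) := by
    refine indep_of_injective fun v hv => eq_zero_of_coframe hy.indep ?_
    have v0 : l y ^ 3 / B y * η 0 y v = 0 := hv 0
    have v1 : η 1 y v = 0 := hv 1
    have v2 : l y * η 2 y v = 0 := hv 2
    have v3 : l y ^ 3 / B y * η 3 y v = 0 := hv 3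
    have v4 : B y / l y ^ 3 * (η 4 y v + A' y / B' y * η 3 y v) = 0 := hv 4
    have v5 : l y ^ 2 / B y * η 5 y v = 0 := hv 5
    have v6 : B y / l y * (η 6 y v + A y / B y * η 5 y v) = 0 := hv 6
    rw [key n1] at v0 v3
    rw [key lne] at v2
    rw [key n2, v3, mul_zero, add_zero] at v4
    rw [key n3] at v5
    rw [key n4, v5, mul_zero, add_zero] at v6
    intro k
    fin_cases k
    exacts [v0, v1, v2, v3, v4, v5, v6]
  refine ⟨⟨⟨?_, ind⟩, ?_, ?_, ?_, ?_⟩, ?_, ?_⟩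
  · intro k
    fin_cases k
    · exact s1.smul (hy.smooth 0)
    · exact hy.smooth 1
    · exact sl.smul (hy.smooth 2)
    · exact s1.smul (hy.smooth 3)
    · exact s2.smul ((hy.smooth 4).add ((sA'.div sB' hBy').smul (hy.smooth 3)))
    · exact ((sl.pow 2).div sB hBy).smul (hy.smooth 5)
    · exact (sB.div sl lne).smul ((hy.smooth 6).add ((sA.div sB hBy).smul (hy.smooth 5)))
  · intro v w hv hw
    have v0 : η 0 y v = 0 := (key n1).1 hv
    have w0 : η 0 y w = 0 := (key n1).1 hw
    refine (dOne_mul s1.dAt (hy.smooth 0).dAt v w).trans ?_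
    rw [hy.d_zero v w v0 w0, v0, w0]
    simp [wedge]
    field_simp
  · refine hy.eq_I.trans (genBy_eq_of_smul hy.indep ind fun k hk => ?_)
    simp only [Set.mem_insert_iff, Set.mem_singleton_iff] at hk
    rcases hk with rfl | rfl | rfl
    · exact ⟨_, n1, fun v => rfl⟩
    · exact ⟨1, one_ne_zero, fun v => (one_mul _).symm⟩
    · exact ⟨_, lne, fun v => rfl⟩
  · refine hy.eq_M₁.trans (genBy_eq_of_smul hy.indep ind fun k hk => ?_)
    simp only [Set.mem_insert_iff, Set.mem_singleton_iff] at hk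
    rcases hk with rfl | rfl
    · exact ⟨_, n1, fun v => rfl⟩
    · exact ⟨1, one_ne_zero, fun v => (one_mul _).symm⟩
  · refine hy.eq_M₂.trans (genBy_eq_of_smul hy.indep ind fun k hk => ?_)
    simp only [Set.mem_insert_iff, Set.mem_singleton_iff] at hk
    rcases hk with rfl | rfl
    · exact ⟨_, n1, fun v => rfl⟩
    · exact ⟨_, lne, fun v => rfl⟩
  · intro v w hv hw
    have v0 : η 0 y v = 0 := (key n1).1 hv.1
    have w0 : η 0 y w = 0 := (key n1).1 hw.1
    refine (hy.d_one v w ⟨v0, hv.2⟩ ⟨w0, hw.2⟩).trans ?_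
    simp [wedge]
    field_simp
    ring
  · intro v w hv hw
    have v0 : η 0 y v = 0 := (key n1).1 hv.1
    have w0 : η 0 y w = 0 := (key n1).1 hw.1
    have v2 : η 2 y v = 0 := (key lne).1 hv.2
    have w2 : η 2 y w = 0 := (key lne).1 hw.2
    refine (dOne_mul sl.dAt (hy.smooth 2).dAt v w).trans ?_
    rw [hy.d_two v w ⟨v0, v2⟩ ⟨w0, w2⟩, v2, w2]
    have e1 : B' y = ε * B y / l y ^ 4 := by
      rw [← l4]
      field_simp
    have εne : ε ≠ 0 := by rintro rfl; simp at hεε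
    simp [wedge]
    field_simp
    rw [e1]
    field_simp
    ring

/-- Off {η⁰, η¹, η³, η⁴}, the terms η²∧η⁵ and η²∧η⁶ of dη³ and dη⁴ are dη⁰ and dη¹, so multiples of
η⁰ and η¹ remove them. The remaining η⁵∧η⁶ term vanishes because d² = 0. For dη⁵ and dη⁶, the forms
η⁰ and η² play this role, and ε is its own inverse. -/
theorem exists_genericCoframe_of_normal {ε : ℝ} (hε : ε * ε = 1)
    (hη : ∀ᶠ y in 𝓝 p, IsNormalCoframeAt I M₁ M₂ ε η y) :
    ∃ ζ, ∀ᶠ y in 𝓝 p, IsGenericFor I M₁ M₂ 1 ε ζ y := by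
  obtain ⟨ζ, hζ⟩ : ∃ ζ : Fin 7 → OneForm Param, ζ = ![η 0, η 1, η 2,
    fun z => η 3 z - (structFn η 3 2 5 z • η 0 z + structFn η 3 2 6 z • η 1 z),
    fun z => η 4 z - (structFn η 4 2 5 z • η 0 z + structFn η 4 2 6 z • η 1 z),
    fun z => η 5 z - (structFn η 5 1 3 z • η 0 z + (ε * structFn η 5 1 4 z) • η 2 z),
    fun z => η 6 z - (structFn η 6 1 3 z • η 0 z + (ε * structFn η 6 1 4 z) • η 2 z)] := ⟨_, rfl⟩
  refine ⟨ζ, ?_⟩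
  have S1 : ∀ z, IsNormalCoframeAt I M₁ M₂ ε η z → ∀ j k, j ≠ 0 → j ≠ 1 → k ≠ 0 → k ≠ 1 →
      structFn η 1 j k z = wedgeCoeff 3 4 j k + wedgeCoeff 2 6 j k := by
    intro z hz j k hj hj' hk hk'
    rw [structFn, hz.d_one _ _
      (by simp [coframe_frame hz.indep, Ne.symm hj, Ne.symm hj'])
      (by simp [coframe_frame hz.indep, Ne.symm hk, Ne.symm hk'])]
    simp [wedge, wedgeCoeff, coframe_frame hz.indep]
  have S2 : ∀ z, IsNormalCoframeAt I M₁ M₂ ε η z → ∀ j k, j ≠ 0 → j ≠ 2 → k ≠ 0 → k ≠ 2 →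
      structFn η 2 j k z = wedgeCoeff 5 6 j k + ε * wedgeCoeff 1 4 j k := by
    intro z hz j k hj hj' hk hk'
    rw [structFn, hz.d_two _ _
      (by simp [coframe_frame hz.indep, Ne.symm hj, Ne.symm hj'])
      (by simp [coframe_frame hz.indep, Ne.symm hk, Ne.symm hk'])]
    simp [wedge, wedgeCoeff, coframe_frame hz.indep]
  filter_upwards [hη, eventually_eventually_nhds.2 hη] with y hy hηy
  have c0 := fun j k => hy.structFn_zero (j := j) (k := k)
  have c1 := S1 y hy
  have c2 := S2 y hy
  have D0 : ∀ j k, j ≠ 0 → k ≠ 0 → fderiv ℝ (structFn η 0 j k) y = 0 := fun j k hj hk =>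
    fderiv_eq_zero_of_eventually_const (hηy.mono fun z hz => hz.structFn_zero hj hk)
  have D1 : ∀ j k, j ≠ 0 → j ≠ 1 → k ≠ 0 → k ≠ 1 → fderiv ℝ (structFn η 1 j k) y = 0 :=
    fun j k hj hj' hk hk' => fderiv_eq_zero_of_eventually_const
      (hηy.mono fun z hz => S1 z hz j k hj hj' hk hk')
  have D2 : ∀ j k, j ≠ 0 → j ≠ 2 → k ≠ 0 → k ≠ 2 → fderiv ℝ (structFn η 2 j k) y = 0 :=
    fun j k hj hj' hk hk' => fderiv_eq_zero_of_eventually_const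
      (hηy.mono fun z hz => S2 z hz j k hj hj' hk hk')
  -- These four identities give c³₅₆ = c⁴₅₆ = c⁵₃₄ = c⁶₃₄ = 0, the torsion that cannot be absorbed.
  have j3 := structFn_jacobi hy.toIsCoframeAt 0 1 5 6
  have j4 := structFn_jacobi hy.toIsCoframeAt 1 3 5 6
  have j5 := structFn_jacobi hy.toIsCoframeAt 0 2 3 4
  have j6 := structFn_jacobi hy.toIsCoframeAt 2 5 3 4
  simp [Fin.sum_univ_seven, c0, c1, c2, D0, D1, D2, wedgeCoeff] at j3 j4 j5 j6
  have sc := fun i j k => contDiffAt_structFn hy.toIsCoframeAt i j k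
  -- subtracting a combination of two members of the coframe
  have sub_d : ∀ (f g : Param → ℝ) (a b c : Fin 7), ContDiffAt ℝ ∞ f y → ContDiffAt ℝ ∞ g y →
      ∀ v w, η b y v = 0 → η b y w = 0 → η c y v = 0 → η c y w = 0 →
      dOne (fun z => η a z - (f z • η b z + g z • η c z)) y v w
        = dOne (η a) y v w - (f y * dOne (η b) y v w + g y * dOne (η c) y v w) := by
    intro f g a b c hf hg v w bv bw cv cw
    have e : (fun z => η a z - (f z • η b z + g z • η c z))
        = fun z => η a z + ((-f z) • η b z + (-g z) • η c z) := by
      funext z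
      module
    have db := (hy.smooth b).dAt
    have dc := (hy.smooth c).dAt
    rw [e, dOne_add (hy.smooth a).dAt
      ((hf.neg.dAt.fun_smul db).fun_add (hg.neg.dAt.fun_smul dc)),
      dOne_add (hf.neg.dAt.fun_smul db) (hg.neg.dAt.fun_smul dc), dOne_mul hf.neg.dAt db,
      dOne_mul hg.neg.dAt dc, bv, bw, cv, cw]
    ring
  have T34 : ∀ a, structFn η a 5 6 y = 0 → ∀ v w,
      (∀ k ∈ ({0, 1, 3, 4} : Set (Fin 7)), η k y v = 0 ∧ η k y w = 0) →
      dOne (fun z => η a z - (structFn η a 2 5 z • η 0 z + structFn η a 2 6 z • η 1 z)) y v w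
        = 0 := by
    intro a ha v w h
    obtain ⟨v0, w0⟩ := by
      simpa [hζ] using h 0 (by simp)
    obtain ⟨v1, w1⟩ := by
      simpa [hζ] using h 1 (by simp)
    obtain ⟨v3, w3⟩ := h 3 (by simp)
    obtain ⟨v4, w4⟩ := h 4 (by simp)
    rw [sub_d _ _ _ _ _ (sc _ _ _) (sc _ _ _) v w v0 w0 v1 w1, hy.d_zero v w v0 w0,
      hy.d_one v w ⟨v0, v1⟩ ⟨w0, w1⟩, dOne_mod_M₁ hy.indep (η a)
        (c := fun i j => structFn η a i j y) (fun _ _ => rfl) ⟨v0, v1⟩ ⟨w0, w1⟩]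
    simp only [wedge, v1, w1, v3, w3, v4, w4, ha]
    ring
  have T56 : ∀ a, structFn η a 3 4 y = 0 → ∀ v w,
      (∀ k ∈ ({0, 2, 5, 6} : Set (Fin 7)), η k y v = 0 ∧ η k y w = 0) →
      dOne (fun z => η a z - (structFn η a 1 3 z • η 0 z + (ε * structFn η a 1 4 z) • η 2 z))
        y v w = 0 := by
    intro a ha v w h
    obtain ⟨v0, w0⟩ := by
      simpa [hζ] using h 0 (by simp)
    obtain ⟨v2, w2⟩ := by
      simpa [hζ] using h 2 (by simp)
    obtain ⟨v5, w5⟩ := h 5 (by simp)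
    obtain ⟨v6, w6⟩ := h 6 (by simp)
    rw [sub_d _ _ _ _ _ (sc _ _ _) (contDiffAt_const.mul (sc _ _ _)) v w v0 w0 v2 w2,
      hy.d_zero v w v0 w0, hy.d_two v w ⟨v0, v2⟩ ⟨w0, w2⟩, dOne_mod_M₂ hy.indep (η a)
        (c := fun i j => structFn η a i j y) (fun _ _ => rfl) ⟨v0, v2⟩ ⟨w0, w2⟩]
    simp only [wedge, v2, w2, v5, w5, v6, w6, ha]
    linear_combination (-(structFn η a 1 4 y) * (η 1 y v * η 4 y w - η 1 y w * η 4 y v)) * hε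
  have A34 : ∀ v w, (∀ k ∈ ({0, 1, 3, 4} : Set (Fin 7)), ζ k y v = 0 ∧ ζ k y w = 0) →
      ∀ k ∈ ({0, 1, 3, 4} : Set (Fin 7)), η k y v = 0 ∧ η k y w = 0 := by
    intro v w h
    have h0 : η 0 y v = 0 ∧ η 0 y w = 0 := by
      simpa [hζ] using h 0 (by simp)
    have h1 : η 1 y v = 0 ∧ η 1 y w = 0 := by
      simpa [hζ] using h 1 (by simp)
    have h3 := h 3 (by simp)
    have h4 := h 4 (by simp)
    simp [hζ, h0, h1] at h3 h4
    simp [h0, h1, h3, h4]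
  have A56 : ∀ v w, (∀ k ∈ ({0, 2, 5, 6} : Set (Fin 7)), ζ k y v = 0 ∧ ζ k y w = 0) →
      ∀ k ∈ ({0, 2, 5, 6} : Set (Fin 7)), η k y v = 0 ∧ η k y w = 0 := by
    intro v w h
    have h0 : η 0 y v = 0 ∧ η 0 y w = 0 := by
      simpa [hζ] using h 0 (by simp)
    have h2 : η 2 y v = 0 ∧ η 2 y w = 0 := by
      simpa [hζ] using h 2 (by simp)
    have h5 := h 5 (by simp)
    have h6 := h 6 (by simp)
    simp [hζ, h0, h2] at h5 h6
    simp [h0, h2, h5, h6]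
  subst hζ
  refine ⟨⟨⟨?_, ?_⟩, ?_, ?_, ?_, ?_, ?_, ?_, ?_⟩, ?_, ?_, ?_⟩
  · intro k
    fin_cases k
    · exact hy.smooth 0
    · exact hy.smooth 1
    · exact hy.smooth 2
    · exact (hy.smooth 3).sub (((sc 3 2 5).smul (hy.smooth 0)).add ((sc 3 2 6).smul (hy.smooth 1)))
    · exact (hy.smooth 4).sub (((sc 4 2 5).smul (hy.smooth 0)).add ((sc 4 2 6).smul (hy.smooth 1)))
    · exact (hy.smooth 5).sub (((sc 5 1 3).smul (hy.smooth 0)).add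
        ((contDiffAt_const.mul (sc 5 1 4)).smul (hy.smooth 2)))
    · exact (hy.smooth 6).sub (((sc 6 1 3).smul (hy.smooth 0)).add
        ((contDiffAt_const.mul (sc 6 1 4)).smul (hy.smooth 2)))
  · refine indep_of_injective fun v hv => eq_zero_of_coframe hy.indep ?_
    have v0 : η 0 y v = 0 := hv 0
    have v1 : η 1 y v = 0 := hv 1
    have v2 : η 2 y v = 0 := hv 2
    have v3 := hv 3
    have v4 := hv 4
    have v5 := hv 5
    have v6 := hv 6
    simp [v0, v1, v2] at v3 v4 v5 v6
    intro k
    fin_cases k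
    exacts [v0, v1, v2, v3, v4, v5, v6]
  · intro v w hv hw
    have v0 : η 0 y v = 0 := hv
    have w0 : η 0 y w = 0 := hw
    refine (hy.d_zero v w hv hw).trans ?_
    simp [wedge, v0, w0]
    ring
  · intro v w v0 v1 w0 w1
    have v0 : η 0 y v = 0 := v0
    have w0 : η 0 y w = 0 := w0
    have v1 : η 1 y v = 0 := v1
    have w1 : η 1 y w = 0 := w1
    refine (hy.d_one v w ⟨v0, v1⟩ ⟨w0, w1⟩).trans ?_
    simp [wedge, v0, w0, v1, w1]
    ring
  · intro v w v0 v2 w0 w2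
    have v0 : η 0 y v = 0 := v0
    have w0 : η 0 y w = 0 := w0
    have v2 : η 2 y v = 0 := v2
    have w2 : η 2 y w = 0 := w2
    refine (hy.d_two v w ⟨v0, v2⟩ ⟨w0, w2⟩).trans ?_
    simp [wedge, v0, w0, v2, w2]
    left
    ring
  · exact fun v w h => T34 3 j3 v w (A34 v w h)
  · exact fun v w h => T34 4 j4 v w (A34 v w h)
  · exact fun v w h => T56 5 j5 v w (A56 v w h)
  · exact fun v w h => T56 6 j6 v w (A56 v w h)
  · exact hy.eq_I.trans (by simp [genBy, Set.image_insert_eq])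
  · exact hy.eq_M₁.trans (by simp [genBy, Set.image_insert_eq])
  · exact hy.eq_M₂.trans (by simp [genBy, Set.image_insert_eq])

theorem exists_genericCoframe (hη : ∀ᶠ y in 𝓝 p, IsContactCoframeAt I M₁ M₂ η y)
    (h11 : ∀ᶠ y in 𝓝 p, conformalCoeff η 1 1 y = 0) (h22 : ∀ᶠ y in 𝓝 p, conformalCoeff η 2 2 y = 0)
    (h12 : ∀ᶠ y in 𝓝 p, conformalCoeff η 1 2 y ≠ 0) (h₁ : classAt M₁ p = 7)
    (h₂ : classAt M₂ p = 7) :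
    ∃ ε : ℝ, (ε = 1 ∨ ε = -1) ∧ ∃ ζ, ∀ᶠ y in 𝓝 p, IsGenericFor I M₁ M₂ 1 ε ζ y := by
  obtain ⟨ζ₁, hζ₁⟩ := exists_splitCoframe hη h11 h22 h12
  obtain ⟨ζ₂, A, B, A', B', hζ₂⟩ := exists_semiGenericCoframe hζ₁
  obtain ⟨hB, hB'⟩ := IsSemiGenericCoframeAt.coeff_ne_zero hζ₂ h₁ h₂
  obtain ⟨ε, hε, ζ₃, hζ₃⟩ := exists_normalCoframe hζ₂ hB hB'
  exact ⟨ε, hε, exists_genericCoframe_of_normal (by rcases hε with rfl | rfl <;> norm_num) hζ₃⟩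

end Normalization

/-! ### The contact forms on a parametrized equation -/

section Jets

variable {i : Param → Jet2} {y : Param}

/-- The pullback of a coordinate differential of the jet space. -/
def jetForm (i : Param → Jet2) (m : Fin 8) : OneForm Param := fun y =>
  (dCoord m).comp (fderiv ℝ i y)

/-- The pullback of a contact form. -/
def contactPullback (i : Param → Jet2) (k : Fin 3) : OneForm Param := fun y =>
  (contactForm k (i y)).comp (fderiv ℝ i y)

theorem jetForm_apply (m : Fin 8) (v : Param) : jetForm i m y v = fderiv ℝ i y v m := rfl

theorem contactPullback_zero :
    contactPullback i 0 = fun z => jetForm i 2 z - i z 3 • jetForm i 0 z - i z 4 • jetForm i 1 z :=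
  rfl

theorem contactPullback_one :
    contactPullback i 1 = fun z => jetForm i 3 z - i z 5 • jetForm i 0 z - i z 6 • jetForm i 1 z :=
  rfl

theorem contactPullback_two :
    contactPullback i 2 = fun z => jetForm i 4 z - i z 6 • jetForm i 0 z - i z 7 • jetForm i 1 z :=
  rfl

theorem contDiffAt_jetForm (h : ContDiffAt ℝ ∞ i y) (m : Fin 8) :
    ContDiffAt ℝ ∞ (jetForm i m) y :=
  contDiffAt_const.clm_comp h.smooth_fderiv

theorem contDiffAt_coord (h : ContDiffAt ℝ ∞ i y) (m : Fin 8) :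
    ContDiffAt ℝ ∞ (fun z => i z m) y :=
  contDiffAt_pi.1 h m

theorem fderiv_coord (h : ContDiffAt ℝ ∞ i y) (m : Fin 8) :
    fderiv ℝ (fun z => i z m) y = jetForm i m y :=
  (((dCoord m).hasFDerivAt (x := i y)).comp y h.dAt.hasFDerivAt).fderiv

theorem dOne_jetForm (h : ContDiffAt ℝ ∞ i y) (m : Fin 8) (v w : Param) :
    dOne (jetForm i m) y v w = 0 := by
  have e : HasFDerivAt (jetForm i m) _ y :=
    (hasFDerivAt_const (dCoord m) y).clm_comp h.smooth_fderiv.dAt.hasFDerivAt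
  rw [dOne_eq e.differentiableAt, e.fderiv]
  simp [h.isSymm v w]

theorem dOne_jetForm_sub (h : ContDiffAt ℝ ∞ i y) (a b c : Fin 8) (v w : Param) :
    dOne (fun z => jetForm i c z - i z a • jetForm i 0 z - i z b • jetForm i 1 z) y v w
      = wedge (jetForm i 0 y) (jetForm i a y) v w + wedge (jetForm i 1 y) (jetForm i b y) v w := by
  have e : (fun z => jetForm i c z - i z a • jetForm i 0 z - i z b • jetForm i 1 z)
      = fun z => jetForm i c z + ((-i z a) • jetForm i 0 z + (-i z b) • jetForm i 1 z) := by
    funext z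
    module
  have sa := (contDiffAt_coord h a).neg.dAt
  have sb := (contDiffAt_coord h b).neg.dAt
  have s0 := (contDiffAt_jetForm h 0).dAt
  have s1 := (contDiffAt_jetForm h 1).dAt
  rw [e, dOne_add (contDiffAt_jetForm h c).dAt ((sa.fun_smul s0).fun_add (sb.fun_smul s1)),
    dOne_add (sa.fun_smul s0) (sb.fun_smul s1), dOne_mul sa s0, dOne_mul sb s1]
  simp only [dOne_jetForm h, fderiv_fun_neg, fderiv_coord h, neg_apply, wedge]
  ring

theorem dOne_contactPullback_zero (h : ContDiffAt ℝ ∞ i y) (v w : Param) :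
    dOne (contactPullback i 0) y v w = wedge (jetForm i 0 y) (contactPullback i 1 y) v w
      + wedge (jetForm i 1 y) (contactPullback i 2 y) v w := by
  rw [contactPullback_zero, dOne_jetForm_sub h, contactPullback_one, contactPullback_two]
  simp [wedge]
  ring

theorem contDiffAt_contactPullback (h : ContDiffAt ℝ ∞ i y) (k : Fin 3) :
    ContDiffAt ℝ ∞ (contactPullback i k) y := by
  have key : ∀ a b c : Fin 8, ContDiffAt ℝ ∞
      (fun z => jetForm i c z - i z a • jetForm i 0 z - i z b • jetForm i 1 z) y := fun a b c =>
    ((contDiffAt_jetForm h c).sub ((contDiffAt_coord h a).smul (contDiffAt_jetForm h 0))).sub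
      ((contDiffAt_coord h b).smul (contDiffAt_jetForm h 1))
  fin_cases k
  exacts [key _ _ _, key _ _ _, key _ _ _]

theorem linearIndependent_of_forall_exists {ι : Type*} [Fintype ι] [DecidableEq ι]
    {f : ι → Param →L[ℝ] ℝ} (h : ∀ c : ι → ℝ, ∃ v, ∀ k, f k v = c k) : LinearIndependent ℝ f := by
  rw [Fintype.linearIndependent_iff]
  intro g hg k
  obtain ⟨v, hv⟩ := h (Pi.single k 1)
  have := congrArg (fun α => α v) hg
  simpa [hv, Pi.single_apply] using this

variable {F : Jet2 → ℝ} {W : Set Jet2} {S : Set Param}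

theorem IsNondegParam.contDiffAt (h : IsNondegParam F W S i) (hy : y ∈ S) : ContDiffAt ℝ ∞ i y :=
  h.smooth_param.contDiffAt (h.isOpen_param.mem_nhds hy)

/-- Transversality to the fibres of `J² → J¹`. -/
theorem IsNondegParam.exists_first_order (h : IsNondegParam F W S i) (hy : y ∈ S)
    (c : Fin 5 → ℝ) : ∃ v, ∀ k : Fin 5,
      (![contactPullback i 0, contactPullback i 1, contactPullback i 2, jetForm i 0,
        jetForm i 1] : Fin 5 → OneForm Param) k y v = c k := by
  let a : Jet2 := ![c 3, c 4, c 0 + i y 3 * c 3 + i y 4 * c 4, c 1 + i y 5 * c 3 + i y 6 * c 4,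
    c 2 + i y 6 * c 3 + i y 7 * c 4, 0, 0, 0]
  have ha : a ∈ LinearMap.range (fderiv ℝ i y : Param →ₗ[ℝ] Jet2) ⊔ LinearMap.ker jetProj := by
    rw [h.transverse y hy]
    trivial
  obtain ⟨_, ⟨v, rfl⟩, b, hb, hab⟩ := Submodule.mem_sup.1 ha
  have hb' : ∀ k : Fin 5, b (Fin.castLE (by norm_num) k) = 0 := fun k => congrFun hb k
  have hv : ∀ k : Fin 5, fderiv ℝ i y v (Fin.castLE (by norm_num) k)
      = a (Fin.castLE (by norm_num) k) := fun k => by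
    have := congrFun hab (Fin.castLE (by norm_num) k)
    rw [← this, Pi.add_apply, hb' k, add_zero]
    rfl
  have v0 : fderiv ℝ i y v 0 = c 3 := hv 0
  have v1 : fderiv ℝ i y v 1 = c 4 := hv 1
  have v2 : fderiv ℝ i y v 2 = c 0 + i y 3 * c 3 + i y 4 * c 4 := hv 2
  have v3 : fderiv ℝ i y v 3 = c 1 + i y 5 * c 3 + i y 6 * c 4 := hv 3
  have v4 : fderiv ℝ i y v 4 = c 2 + i y 6 * c 3 + i y 7 * c 4 := hv 4
  refine ⟨v, fun k => ?_⟩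
  fin_cases k
  · simp [contactPullback_zero, jetForm_apply, v0, v1, v2]
    ring
  · simp [contactPullback_one, jetForm_apply, v0, v1, v3]
    ring
  · simp [contactPullback_two, jetForm_apply, v0, v1, v4]
    ring
  · exact v0
  · exact v1

/-- The tangent vectors of the parametrized equation that are vertical for `J² → J¹`. -/
theorem IsNondegParam.exists_vertical (h : IsNondegParam F W S i) (hh : IsHyperbolicOn F S i)
    (hy : y ∈ S) {r s t : ℝ}
    (e : partialJet F 5 (i y) * r + partialJet F 6 (i y) * s + partialJet F 7 (i y) * t = 0) :
    ∃ v, fderiv ℝ i y v = ![0, 0, 0, 0, 0, r, s, t] := by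
  have hF : DifferentiableAt ℝ F (i y) :=
    (h.smooth_eqn.contDiffAt (h.isOpen_dom.mem_nhds (h.maps_to y hy).1)).dAt
  have hFi : F ∘ i =ᶠ[𝓝 y] fun _ => 0 := by
    filter_upwards [h.isOpen_param.mem_nhds hy] with z hz using (h.maps_to z hz).2
  have hcomp : (fderiv ℝ F (i y)).comp (fderiv ℝ i y) = 0 := by
    rw [← fderiv_comp y hF (h.contDiffAt hy).dAt, hFi.fderiv_eq (𝕜 := ℝ)]
    simp
  -- The discriminant would be 0 if dF vanished.
  have hne : (fderiv ℝ F (i y) : Jet2 →ₗ[ℝ] ℝ) ≠ 0 := by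
    intro h0
    have z : ∀ k, partialJet F k (i y) = 0 := fun k =>
      congrArg (fun l => l (Pi.single k (1 : ℝ))) h0
    have := hh y hy
    simp [z] at this
  have hle : LinearMap.range (fderiv ℝ i y : Param →ₗ[ℝ] Jet2)
      ≤ LinearMap.ker (fderiv ℝ F (i y) : Jet2 →ₗ[ℝ] ℝ) := by
    rintro _ ⟨v, rfl⟩
    exact congrArg (fun l => l v) hcomp
  have h1 := LinearMap.finrank_range_of_inj (f := (fderiv ℝ i y : Param →ₗ[ℝ] Jet2))
    (h.max_rank y hy)
  have h2 := LinearMap.finrank_range_add_finrank_ker (fderiv ℝ F (i y) : Jet2 →ₗ[ℝ] ℝ)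
  rw [LinearMap.range_eq_top.2 (LinearMap.surjective hne)] at h2
  simp at h1 h2
  -- The image of the derivative of i lies in the kernel of dF and both have dimension 7, so every
  -- vector killed by dF is tangent.
  have hr := Submodule.eq_of_le_of_finrank_eq hle (by omega)
  have hmem : (![0, 0, 0, 0, 0, r, s, t] : Jet2)
      ∈ LinearMap.ker (fderiv ℝ F (i y) : Jet2 →ₗ[ℝ] ℝ) := by
    have : (![0, 0, 0, 0, 0, r, s, t] : Jet2) = r • Pi.single 5 1 + s • Pi.single 6 1
        + t • Pi.single 7 1 := by
      ext k
      fin_cases k <;> simp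
    rw [LinearMap.mem_ker, this]
    simp only [ContinuousLinearMap.coe_coe, map_add, map_smul, smul_eq_mul]
    simp only [partialJet] at e
    linarith
  rw [← hr] at hmem
  exact hmem

/-- A coframe adapted to a hyperbolic system, with the coefficients of the conformal form. -/
structure IsHyperbolicCoframeAt (I : CotangentField Param) (ζ : Fin 7 → OneForm Param) (a b c : ℝ)
    (y : Param) : Prop extends IsCoframeAt ζ y where
  d_zero : ∀ v w, dOne (ζ 0) y v w = wedge (ζ 3 y) (ζ 1 y) v w + wedge (ζ 4 y) (ζ 2 y) v w
  eq_I : I y = genBy ζ {0, 1, 2} y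
  disc : 4 * a * c - b ^ 2 < 0
  quad : ∀ A B A' B' : ℝ, (∀ v₁ v₂ v₃ v₄, InAnn (I y) v₁ → InAnn (I y) v₂ → InAnn (I y) v₃ →
    InAnn (I y) v₄ → wedgeTwo (fun v w => A * dOne (ζ 1) y v w + B * dOne (ζ 2) y v w)
      (fun v w => A' * dOne (ζ 1) y v w + B' * dOne (ζ 2) y v w) v₁ v₂ v₃ v₄ = 0) →
    2 * A * A' * c - (A * B' + A' * B) * b + 2 * B * B' * a = 0

theorem pdeSystem_eq (i : Param → Jet2) (κ κ' : OneForm Param) (y : Param) :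
    pdeSystem i y = genBy ![contactPullback i 0, contactPullback i 1, contactPullback i 2,
      jetForm i 0, jetForm i 1, κ, κ'] {0, 1, 2} y := by
  unfold pdeSystem genBy
  congr 1
  ext α
  simp only [Set.mem_range, Fin.exists_fin_succ]
  simp [Set.image_insert_eq, contactPullback, eq_comm]

/-- Two lifts of ∂_x and ∂_y together with two vertical tangent vectors span I^⊥. On them the 4-form
is, up to sign, a multiple of the polarized symbol form, and the factor depends on the vertical
pair. -/
theorem IsNondegParam.quad_eq_zero (h : IsNondegParam F W S i) (hh : IsHyperbolicOn F S i)
    (hy : y ∈ S) {A B A' B' : ℝ} (H : ∀ v₁ v₂ v₃ v₄, InAnn (pdeSystem i y) v₁ →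
      InAnn (pdeSystem i y) v₂ → InAnn (pdeSystem i y) v₃ → InAnn (pdeSystem i y) v₄ →
      wedgeTwo (fun v w => A * dOne (contactPullback i 1) y v w
          + B * dOne (contactPullback i 2) y v w)
        (fun v w => A' * dOne (contactPullback i 1) y v w
          + B' * dOne (contactPullback i 2) y v w) v₁ v₂ v₃ v₄ = 0) :
    2 * A * A' * partialJet F 7 (i y) - (A * B' + A' * B) * partialJet F 6 (i y)
      + 2 * B * B' * partialJet F 5 (i y) = 0 := by
  have hi := h.contDiffAt hy
  have ann : ∀ v, (∀ k, contactPullback i k y v = 0) → InAnn (pdeSystem i y) v := by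
    intro v hv
    rw [pdeSystem_eq i 0 0, inAnn_genBy]
    simp [hv]
  obtain ⟨v, hv⟩ := h.exists_first_order hy ![0, 0, 0, 1, 0]
  obtain ⟨w, hw⟩ := h.exists_first_order hy ![0, 0, 0, 0, 1]
  have av : InAnn (pdeSystem i y) v := ann v fun k => by
    fin_cases k
    exacts [hv 0, hv 1, hv 2]
  have aw : InAnn (pdeSystem i y) w := ann w fun k => by
    fin_cases k
    exacts [hw 0, hw 1, hw 2]
  have v0 : fderiv ℝ i y v 0 = 1 := hv 3
  have v1 : fderiv ℝ i y v 1 = 0 := hv 4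
  have w0 : fderiv ℝ i y w 0 = 0 := hw 3
  have w1 : fderiv ℝ i y w 1 = 1 := hw 4
  have key : ∀ r s t r' s' t' : ℝ,
      partialJet F 5 (i y) * r + partialJet F 6 (i y) * s + partialJet F 7 (i y) * t = 0 →
      partialJet F 5 (i y) * r' + partialJet F 6 (i y) * s' + partialJet F 7 (i y) * t' = 0 →
      - ((A * r + B * s) * (A' * s' + B' * t')) + (A * r' + B * s') * (A' * s + B' * t)
        + (A * s + B * t) * (A' * r' + B' * s') - (A * s' + B * t') * (A' * r + B' * s) = 0 := by
    intro r s t r' s' t' e e'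
    obtain ⟨x, hx⟩ := h.exists_vertical hh hy e
    obtain ⟨x', hx'⟩ := h.exists_vertical hh hy e'
    have ax : InAnn (pdeSystem i y) x := ann x fun k => by
      fin_cases k <;> simp [contactPullback_zero, contactPullback_one, contactPullback_two,
        jetForm_apply, hx]
    have ax' : InAnn (pdeSystem i y) x' := ann x' fun k => by
      fin_cases k <;> simp [contactPullback_zero, contactPullback_one, contactPullback_two,
        jetForm_apply, hx']
    have := H v w x x' av aw ax ax'
    rw [contactPullback_one, contactPullback_two] at this
    simp only [dOne_jetForm_sub hi, wedge, wedgeTwo, jetForm_apply, v0, v1, w0, w1, hx, hx'] at this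
    simp at this
    linear_combination this
  -- Pairs taken from the Koszul solutions of F_r r + F_s s + F_t t = 0. They give the symbol form
  -- multiplied by F_r, F_t and F_s in turn, which do not all vanish.
  have k1 := key (partialJet F 6 (i y)) (-partialJet F 5 (i y)) 0 (partialJet F 7 (i y)) 0
    (-partialJet F 5 (i y)) (by ring) (by ring)
  have k2 := key 0 (partialJet F 7 (i y)) (-partialJet F 6 (i y)) (partialJet F 7 (i y)) 0
    (-partialJet F 5 (i y)) (by ring) (by ring)
  have k3 := key (partialJet F 6 (i y)) (-partialJet F 5 (i y)) 0 0 (partialJet F 7 (i y))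
    (-partialJet F 6 (i y)) (by ring) (by ring)
  have hd := hh y hy
  set a := partialJet F 5 (i y)
  set b := partialJet F 6 (i y)
  set c := partialJet F 7 (i y)
  have m1 : a * (2 * A * A' * c - (A * B' + A' * B) * b + 2 * B * B' * a) = 0 := by
    linear_combination -k1
  have m2 : c * (2 * A * A' * c - (A * B' + A' * B) * b + 2 * B * B' * a) = 0 := by
    linear_combination k2
  have m3 : b * (2 * A * A' * c - (A * B' + A' * B) * b + 2 * B * B' * a) = 0 := by
    linear_combination -k3
  by_contra hQ
  rw [mul_eq_zero, or_iff_left hQ] at m1 m2 m3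
  simp [m1, m3] at hd

/-- Transversality makes the three contact forms, dx and dy independent on Σ₇. Two constant
covectors complete them to a coframe near p. -/
theorem IsNondegParam.exists_hyperbolicCoframe (h : IsNondegParam F W S i)
    (hh : IsHyperbolicOn F S i) {p : Param} (hp : p ∈ S) :
    ∃ ζ, ∀ᶠ y in 𝓝 p, IsHyperbolicCoframeAt (pdeSystem i) ζ (partialJet F 5 (i y))
      (partialJet F 6 (i y)) (partialJet F 7 (i y)) y := by
  obtain ⟨κ, hκ⟩ := exists_linearIndependent_snoc_of_lt_finrank
    (linearIndependent_of_forall_exists (h.exists_first_order hp))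
    (by rw [finrank_dual_param]; norm_num)
  obtain ⟨κ', hκ'⟩ := exists_linearIndependent_snoc_of_lt_finrank hκ
    (by rw [finrank_dual_param]; norm_num)
  let ζ : Fin 7 → OneForm Param := ![contactPullback i 0, contactPullback i 1,
    contactPullback i 2, jetForm i 0, jetForm i 1, fun _ => κ, fun _ => κ']
  have hs : ∀ y ∈ S, ∀ k, ContDiffAt ℝ ∞ (ζ k) y := by
    intro y hy k
    have hi := h.contDiffAt hy
    fin_cases k
    exacts [contDiffAt_contactPullback hi 0, contDiffAt_contactPullback hi 1,
      contDiffAt_contactPullback hi 2, contDiffAt_jetForm hi 0, contDiffAt_jetForm hi 1,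
      contDiffAt_const, contDiffAt_const]
  have hζ : IsCoframeAt ζ p := by
    refine ⟨hs p hp, ?_⟩
    have e : (fun k => ζ k p) = Fin.snoc (Fin.snoc (fun k => (![contactPullback i 0,
        contactPullback i 1, contactPullback i 2, jetForm i 0, jetForm i 1] :
        Fin 5 → OneForm Param) k p) κ) κ' := by
      funext k
      fin_cases k <;> rfl
    rw [e]
    exact hκ'
  refine ⟨ζ, ?_⟩
  filter_upwards [hζ.eventually, h.isOpen_param.mem_nhds hp] with y hy hyS
  refine ⟨⟨hs y hyS, hy⟩, dOne_contactPullback_zero (h.contDiffAt hyS), pdeSystem_eq i _ _ y, ?_,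
    fun A B A' B' => h.quad_eq_zero hh hyS⟩
  have := hh y hyS
  linarith

end Jets

/-! ### Coframes adapted to the characteristic systems -/

section Characteristic

variable {I M M₁ M₂ : CotangentField Param} {η ζ : Fin 7 → OneForm Param} {y p : Param}
  {S : Set Param} {a b c : Param → ℝ}

theorem dOne_section_ann {K : Set (Fin 7)} (hη : ∀ᶠ z in 𝓝 y, IsCoframeAt η z) {θ : OneForm Param}
    (hθ : IsLocalSection (genBy η K) y θ) {v w : Param} (hv : ∀ k ∈ K, η k y v = 0)
    (hw : ∀ k ∈ K, η k y w = 0) :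
    dOne θ y v w = ∑ m, θ y (frame η m y) * dOne (η m) y v w := by
  have hi := hη.self_of_nhds.indep
  rw [dOne_expand hi]
  simp only [dOne_expand hi (η _) v w, Finset.mul_sum]
  refine Eq.trans (Finset.sum_congr rfl fun i _ => ?_) Finset.sum_comm
  refine Eq.trans (Finset.sum_congr rfl fun j _ => ?_) Finset.sum_comm
  by_cases hiK : i ∈ K
  · simp [hv i hiK]
  by_cases hjK : j ∈ K
  · simp [hw j hjK]
  rw [dOne_section hη hθ hiK hjK, Finset.mul_sum, Finset.mul_sum]
  exact Finset.sum_congr rfl fun m _ => by rw [structFn]; ring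

theorem wedgeTwo_eq_zero_of_conformalCoeff (h : LinearIndependent ℝ (fun k => η k y)) {k l : Fin 7}
    (hkl : conformalCoeff η k l y = 0) {v : Fin 4 → Param}
    (hv : ∀ n, η 0 y (v n) = 0 ∧ η 1 y (v n) = 0 ∧ η 2 y (v n) = 0) :
    wedgeTwo (dOne (η k) y) (dOne (η l) y) (v 0) (v 1) (v 2) (v 3) = 0 := by
  have e := fun m i j => dOne_mod_I h (η m) (c := fun i j => structFn η m i j y)
    (fun _ _ => rfl) (hv i) (hv j)
  obtain ⟨x, hx⟩ : ∃ x : Fin 7 → Fin 4 → ℝ, ∀ m n, η m y (v n) = x m n :=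
    ⟨_, fun _ _ => rfl⟩
  obtain ⟨s, hs⟩ : ∃ s : Fin 7 → Fin 7 → Fin 7 → ℝ, ∀ m i j, structFn η m i j y = s m i j :=
    ⟨_, fun _ _ _ => rfl⟩
  simp only [conformalCoeff, hs] at hkl
  simp only [wedgeTwo, e, wedge, hx, hs]
  -- On I^⊥ the product is the conformal coefficient times η³∧η⁴∧η⁵∧η⁶; the factor is the 4×4
  -- determinant of these forms on the four vectors.
  linear_combination (
    x 3 0 * (x 4 1 * (x 5 2 * x 6 3 - x 6 2 * x 5 3) - x 5 1 * (x 4 2 * x 6 3 - x 6 2 * x 4 3)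
      + x 6 1 * (x 4 2 * x 5 3 - x 5 2 * x 4 3))
    - x 4 0 * (x 3 1 * (x 5 2 * x 6 3 - x 6 2 * x 5 3) - x 5 1 * (x 3 2 * x 6 3 - x 6 2 * x 3 3)
      + x 6 1 * (x 3 2 * x 5 3 - x 5 2 * x 3 3))
    + x 5 0 * (x 3 1 * (x 4 2 * x 6 3 - x 6 2 * x 4 3) - x 4 1 * (x 3 2 * x 6 3 - x 6 2 * x 3 3)
      + x 6 1 * (x 3 2 * x 4 3 - x 4 2 * x 3 3))
    - x 6 0 * (x 3 1 * (x 4 2 * x 5 3 - x 5 2 * x 4 3) - x 4 1 * (x 3 2 * x 5 3 - x 5 2 * x 3 3)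
      + x 5 1 * (x 3 2 * x 4 3 - x 4 2 * x 3 3))) * hkl

/-- The quadratic form of `IsHyperbolicCoframeAt` on the characteristic systems. -/
theorem quad_section (hζ : ∀ᶠ z in 𝓝 y, IsHyperbolicCoframeAt I ζ (a z) (b z) (c z) z)
    {φ ψ : OneForm Param} (hφ : IsLocalSection I y φ) (hψ : IsLocalSection I y ψ)
    (H : ∀ v₁ v₂ v₃ v₄, InAnn (I y) v₁ → InAnn (I y) v₂ → InAnn (I y) v₃ → InAnn (I y) v₄ →
      wedgeTwo (dOne φ y) (dOne ψ y) v₁ v₂ v₃ v₄ = 0) :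
    2 * φ y (frame ζ 1 y) * ψ y (frame ζ 1 y) * c y
      - (φ y (frame ζ 1 y) * ψ y (frame ζ 2 y) + ψ y (frame ζ 1 y) * φ y (frame ζ 2 y)) * b y
      + 2 * φ y (frame ζ 2 y) * ψ y (frame ζ 2 y) * a y = 0 := by
  have hy := hζ.self_of_nhds
  have hI : I =ᶠ[𝓝 y] genBy ζ {0, 1, 2} := hζ.mono fun z hz => hz.eq_I
  -- Modulo I, dζ⁰ vanishes, so only the coefficients of ζ¹ and ζ² contribute to dθ.
  have key : ∀ θ, IsLocalSection I y θ → ∀ v w, InAnn (I y) v → InAnn (I y) w →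
      θ y (frame ζ 1 y) * dOne (ζ 1) y v w + θ y (frame ζ 2 y) * dOne (ζ 2) y v w
        = dOne θ y v w := by
    intro θ hθ v w hv hw
    rw [hy.eq_I, inAnn_genBy] at hv hw
    have hz := (mem_genBy_iff hy.indep).1 (hθ.congr hI).self_of_nhds.2
    rw [dOne_section_ann (hζ.mono fun z hz => hz.toIsCoframeAt) (hθ.congr hI) hv hw]
    simp [Fin.sum_univ_seven, hy.d_zero, wedge, hv 1 (by simp), hv 2 (by simp), hw 1 (by simp),
      hw 2 (by simp), hz 3 (by simp), hz 4 (by simp), hz 5 (by simp), hz 6 (by simp)]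
  refine hy.quad _ _ _ _ fun v₁ v₂ v₃ v₄ h₁ h₂ h₃ h₄ => ?_
  rw [← H v₁ v₂ v₃ v₄ h₁ h₂ h₃ h₄]
  simp only [wedgeTwo, key φ hφ, key ψ hψ, h₁, h₂, h₃, h₄]

theorem IsHyperbolicCoframeAt.apply_eq {a b c : ℝ} (h : IsHyperbolicCoframeAt I ζ a b c y)
    {α : Param →L[ℝ] ℝ} (hα : α ∈ I y) (v : Param) :
    α v = α (frame ζ 0 y) * ζ 0 y v + α (frame ζ 1 y) * ζ 1 y v + α (frame ζ 2 y) * ζ 2 y v := by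
  rw [h.eq_I] at hα
  have hz := (mem_genBy_iff h.indep).1 hα
  conv_lhs => rw [← sum_coframe h.indep α]
  simp [Fin.sum_univ_seven, hz 3 (by simp), hz 4 (by simp), hz 5 (by simp), hz 6 (by simp)]

theorem IsHyperbolicCoframeAt.mem_span {a b c : ℝ} (h : IsHyperbolicCoframeAt I ζ a b c y)
    {α β : Param →L[ℝ] ℝ} (hα : α ∈ I y) (hβ : β ∈ I y)
    (hne : α (frame ζ 1 y) ≠ 0 ∨ α (frame ζ 2 y) ≠ 0)
    (hp : α (frame ζ 1 y) * β (frame ζ 2 y) - α (frame ζ 2 y) * β (frame ζ 1 y) = 0) :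
    β ∈ Submodule.span ℝ {ζ 0 y, α} := by
  obtain ⟨r, h1, h2⟩ : ∃ r, β (frame ζ 1 y) = r * α (frame ζ 1 y)
      ∧ β (frame ζ 2 y) = r * α (frame ζ 2 y) := by
    rcases hne with hne | hne
    · exact ⟨β (frame ζ 1 y) / α (frame ζ 1 y), by field_simp, by
        field_simp; linear_combination hp⟩
    · exact ⟨β (frame ζ 2 y) / α (frame ζ 2 y), by field_simp; linear_combination -hp, by
        field_simp⟩
  refine Submodule.mem_span_pair.2 ⟨β (frame ζ 0 y) - r * α (frame ζ 0 y), r, ?_⟩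
  ext v
  simp only [add_apply, smul_apply, smul_eq_mul]
  rw [h.apply_eq hα v, h.apply_eq hβ v, h1, h2]
  ring

/-- Orthogonal vectors are parallel if one of them is isotropic. -/
theorem IsHyperbolicCoframeAt.parallel {a b c : ℝ} (h : IsHyperbolicCoframeAt I ζ a b c y)
    {A B A' B' : ℝ} (h1 : 2 * A * A * c - (A * B + A * B) * b + 2 * B * B * a = 0)
    (h2 : 2 * A * A' * c - (A * B' + A' * B) * b + 2 * B * B' * a = 0) :
    A * B' - B * A' = 0 := by
  -- The Gram determinant of two vectors is the discriminant times the square of their determinant.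
  have : (4 * a * c - b ^ 2) * (A * B' - B * A') ^ 2 = 0 := by
    linear_combination (2 * A' ^ 2 * c - 2 * A' * B' * b + 2 * B' ^ 2 * a) * h1
      - (2 * A * A' * c - (A * B' + A' * B) * b + 2 * B * B' * a) * h2
  exact pow_eq_zero_iff two_ne_zero |>.1 ((mul_eq_zero.1 this).resolve_left h.disc.ne)

theorem IsPfaffianSystem.exists_section {D : CotangentField Param} {n : ℕ}
    (h : IsPfaffianSystem D n S) (hy : y ∈ S) {α : Param →L[ℝ] ℝ} (hα : α ∈ D y) :
    ∃ θ, IsLocalSection D y θ ∧ θ y = α := by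
  obtain ⟨f, hf⟩ := h y hy
  rw [hf.self_of_nhds.2.2, Submodule.mem_span_range_iff_exists_fun] at hα
  obtain ⟨g, hg⟩ := hα
  refine ⟨fun z => ∑ k, g k • f k z, ?_, hg⟩
  filter_upwards [hf] with z hz
  refine ⟨ContDiffAt.sum fun k _ => (hz.1 k).const_smul (g k), ?_⟩
  rw [hz.2.2]
  exact Submodule.sum_mem _ fun k _ => Submodule.smul_mem _ _ (Submodule.subset_span ⟨k, rfl⟩)

theorem IsPfaffianSystem.finrank_eq {D : CotangentField Param} {n : ℕ}
    (h : IsPfaffianSystem D n S) (hy : y ∈ S) : Module.finrank ℝ (D y) = n := by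
  obtain ⟨f, hf⟩ := h y hy
  obtain ⟨-, h1, h2⟩ := hf.self_of_nhds
  rw [h2, finrank_span_eq_card h1, Fintype.card_fin]

theorem IsLocalSection.le {D D' : CotangentField Param} {θ : OneForm Param}
    (hθ : IsLocalSection D y θ) (h : ∀ᶠ z in 𝓝 y, D z ≤ D' z) : IsLocalSection D' y θ := by
  filter_upwards [h, hθ] with z hz hθz
  exact ⟨hθz.1, hz hθz.2⟩

/-- An isotropic rank two system is generated by `ζ⁰` and a section that is independent of it. -/
theorem exists_generator (hS : IsOpen S) (hM : IsPfaffianSystem M 2 S) (hle : ∀ x ∈ S, M x ≤ I x)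
    (hiso : IsIsotropicOn I M S) (hp : p ∈ S)
    (hζ : ∀ᶠ z in 𝓝 p, IsHyperbolicCoframeAt I ζ (a z) (b z) (c z) z) :
    ∃ θ, IsLocalSection M p θ ∧ ∀ᶠ y in 𝓝 p, (θ y (frame ζ 1 y) ≠ 0 ∨ θ y (frame ζ 2 y) ≠ 0) ∧
      M y = Submodule.span ℝ {ζ 0 y, θ y} := by
  have hpζ := hζ.self_of_nhds
  -- Otherwise M would lie in the line of ζ⁰, against rank 2.
  obtain ⟨α, hα, hne⟩ : ∃ α ∈ M p, α (frame ζ 1 p) ≠ 0 ∨ α (frame ζ 2 p) ≠ 0 := by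
    by_contra! hcon
    have hsub : M p ≤ Submodule.span ℝ {ζ 0 p} := by
      intro β hβ
      refine Submodule.mem_span_singleton.2 ⟨β (frame ζ 0 p), ?_⟩
      ext v
      rw [hpζ.apply_eq (hle p hp hβ) v, (hcon β hβ).1, (hcon β hβ).2]
      simp
    have h1 := Submodule.finrank_mono hsub
    have h2 := finrank_span_singleton (K := ℝ) (hpζ.indep.ne_zero 0)
    rw [hM.finrank_eq hp] at h1
    omega
  obtain ⟨θ, hθ, rfl⟩ := hM.exists_section hp hα
  have hcont : ∀ j, ContinuousAt (fun y => θ y (frame ζ j y)) p := fun j =>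
    (hθ.self_of_nhds.1.clm_apply (contDiffAt_frame hpζ.toIsCoframeAt j)).continuousAt
  have hne' : ∀ᶠ y in 𝓝 p, θ y (frame ζ 1 y) ≠ 0 ∨ θ y (frame ζ 2 y) ≠ 0 := by
    rcases hne with hne | hne
    · exact ((hcont 1).eventually_ne hne).mono fun _ => Or.inl
    · exact ((hcont 2).eventually_ne hne).mono fun _ => Or.inr
  refine ⟨θ, hθ, ?_⟩
  filter_upwards [hne', eventually_eventually_nhds.2 hζ, eventually_eventually_nhds.2 hθ,
    hS.mem_nhds hp] with y hy hζy hθy hyS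
  have hyζ := hζy.self_of_nhds
  have hI : ∀ θ, IsLocalSection M y θ → IsLocalSection I y θ := fun θ hθ => hθ.le <| by
    filter_upwards [hS.mem_nhds hyS] with z hz using hle z hz
  -- Isotropy makes every member of M parallel to θ modulo ζ⁰. Equality then follows by rank, so ζ⁰
  -- lies in M.
  have hsub : M y ≤ Submodule.span ℝ {ζ 0 y, θ y} := by
    intro β hβ
    obtain ⟨ψ, hψ, rfl⟩ := hM.exists_section hyS hβ
    have q11 := quad_section hζy (hI θ hθy) (hI θ hθy) (hiso y hyS θ θ hθy hθy)
    have q12 := quad_section hζy (hI θ hθy) (hI ψ hψ) (hiso y hyS θ ψ hθy hψ)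
    refine hyζ.mem_span (hle y hyS hθy.self_of_nhds.2) (hle y hyS hβ) hy ?_
    exact hyζ.parallel q11 q12
  refine ⟨hy, Submodule.eq_of_le_of_finrank_le hsub ?_⟩
  rw [hM.finrank_eq hyS]
  have h1 : Module.finrank ℝ (Submodule.span ℝ (Set.range ![ζ 0 y, θ y])) ≤ 2 :=
    (finrank_range_le_card _).trans (by simp)
  rwa [Matrix.range_cons_cons_empty] at h1

theorem exists_contactCoframe (hS : IsOpen S) (h : IsCharacteristicPair I M₁ M₂ S) (hp : p ∈ S)
    (hζ : ∀ᶠ z in 𝓝 p, IsHyperbolicCoframeAt I ζ (a z) (b z) (c z) z) :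
    ∃ η, ∀ᶠ y in 𝓝 p, IsContactCoframeAt I M₁ M₂ η y ∧ conformalCoeff η 1 1 y = 0 ∧
      conformalCoeff η 2 2 y = 0 ∧ conformalCoeff η 1 2 y ≠ 0 := by
  obtain ⟨θ₁, s₁, hθ₁⟩ := exists_generator hS h.rank_one h.le_one h.isotropic_one hp hζ
  obtain ⟨θ₂, s₂, hθ₂⟩ := exists_generator hS h.rank_two h.le_two h.isotropic_two hp hζ
  let A₁ : Param → ℝ := fun z => θ₁ z (frame ζ 1 z)
  let B₁ : Param → ℝ := fun z => θ₁ z (frame ζ 2 z)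
  let A₂ : Param → ℝ := fun z => θ₂ z (frame ζ 1 z)
  let B₂ : Param → ℝ := fun z => θ₂ z (frame ζ 2 z)
  let D : Param → ℝ := fun z => A₁ z * B₂ z - B₁ z * A₂ z
  -- Cramer's rule writes ζ¹ and ζ² through θ₁ and θ₂ modulo ζ⁰. Collecting the factors of θ₁ and θ₂
  -- in ζ³∧ζ¹ + ζ⁴∧ζ² gives `η 3` and `η 5`.
  let η : Fin 7 → OneForm Param := ![ζ 0, θ₁, θ₂,
    fun z => (A₂ z / D z) • ζ 4 z - (B₂ z / D z) • ζ 3 z, ζ 5,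
    fun z => (B₁ z / D z) • ζ 3 z - (A₁ z / D z) • ζ 4 z, ζ 6]
  -- If the determinant vanished, θ₂ would lie in the span of ζ⁰ and θ₁, so M₁ = M₂.
  have hD : ∀ᶠ y in 𝓝 p, D y ≠ 0 := by
    filter_upwards [hζ, s₁, s₂, hθ₁, hθ₂, hS.mem_nhds hp] with y hy t₁ t₂ hy₁ hy₂ hyS h0
    have hsub : M₂ y ≤ M₁ y := by
      rw [hy₂.2, Submodule.span_le, hy₁.2]
      rintro _ (rfl | rfl)
      · exact Submodule.subset_span (by simp)
      · exact hy.mem_span (h.le_one y hyS t₁.2) (h.le_two y hyS t₂.2) hy₁.1 h0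
    refine h.distinct y hyS (Submodule.eq_of_le_of_finrank_eq hsub ?_).symm
    rw [h.rank_one.finrank_eq hyS, h.rank_two.finrank_eq hyS]
  have hC : ∀ᶠ y in 𝓝 p, IsContactCoframeAt I M₁ M₂ η y := by
    filter_upwards [hζ, s₁, s₂, hθ₁, hθ₂, hS.mem_nhds hp, hD] with y hy t₁ t₂ hy₁ hy₂ hyS hDy
    have e₁ := hy.apply_eq (h.le_one y hyS t₁.2)
    have e₂ := hy.apply_eq (h.le_two y hyS t₂.2)
    change ∀ v, θ₁ y v = θ₁ y (frame ζ 0 y) * ζ 0 y v + A₁ y * ζ 1 y v + B₁ y * ζ 2 y v at e₁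
    change ∀ v, θ₂ y v = θ₂ y (frame ζ 0 y) * ζ 0 y v + A₂ y * ζ 1 y v + B₂ y * ζ 2 y v at e₂
    have hDe : D y = A₁ y * B₂ y - B₁ y * A₂ y := rfl
    -- the linear system for `ζ¹`, `ζ²`
    have r₁ : ∀ v, ζ 0 y v = 0 → D y * ζ 1 y v = B₂ y * θ₁ y v - B₁ y * θ₂ y v := by
      intro v hv
      rw [e₁, e₂, hv, hDe]
      ring
    have r₂ : ∀ v, ζ 0 y v = 0 → D y * ζ 2 y v = A₁ y * θ₂ y v - A₂ y * θ₁ y v := by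
      intro v hv
      rw [e₁, e₂, hv, hDe]
      ring
    have cancel : ∀ {x : ℝ}, D y * x = 0 → x = 0 := fun hx =>
      (mul_eq_zero.1 hx).resolve_left hDy
    have ind : LinearIndependent ℝ (fun k => η k y) := by
      refine indep_of_injective fun v hv => eq_zero_of_coframe hy.indep ?_
      have v0 : ζ 0 y v = 0 := hv 0
      have v1 : θ₁ y v = 0 := hv 1
      have v2 : θ₂ y v = 0 := hv 2
      have v3 : A₂ y / D y * ζ 4 y v - B₂ y / D y * ζ 3 y v = 0 := hv 3
      have v5 : B₁ y / D y * ζ 3 y v - A₁ y / D y * ζ 4 y v = 0 := hv 5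
      have u1 : ζ 1 y v = 0 := cancel (by rw [r₁ v v0, v1, v2]; ring)
      have u2 : ζ 2 y v = 0 := cancel (by rw [r₂ v v0, v1, v2]; ring)
      field_simp at v3 v5
      have u3 : ζ 3 y v = 0 := cancel (by rw [hDe]; linear_combination -A₁ y * v3 - A₂ y * v5)
      have u4 : ζ 4 y v = 0 := cancel (by rw [hDe]; linear_combination -B₁ y * v3 - B₂ y * v5)
      intro k
      fin_cases k
      exacts [v0, u1, u2, u3, u4, hv 4, hv 6]
    have sA₁ : ContDiffAt ℝ ∞ A₁ y := t₁.1.clm_apply (contDiffAt_frame hy.toIsCoframeAt 1)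
    have sB₁ : ContDiffAt ℝ ∞ B₁ y := t₁.1.clm_apply (contDiffAt_frame hy.toIsCoframeAt 2)
    have sA₂ : ContDiffAt ℝ ∞ A₂ y := t₂.1.clm_apply (contDiffAt_frame hy.toIsCoframeAt 1)
    have sB₂ : ContDiffAt ℝ ∞ B₂ y := t₂.1.clm_apply (contDiffAt_frame hy.toIsCoframeAt 2)
    have sD : ContDiffAt ℝ ∞ D y := (sA₁.mul sB₂).sub (sB₁.mul sA₂)
    refine ⟨⟨?_, ind⟩, ?_, ?_, ?_, ?_⟩
    · intro k
      fin_cases k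
      · exact hy.smooth 0
      · exact t₁.1
      · exact t₂.1
      · exact ((sA₂.div sD hDy).smul (hy.smooth 4)).sub ((sB₂.div sD hDy).smul (hy.smooth 3))
      · exact hy.smooth 5
      · exact ((sB₁.div sD hDy).smul (hy.smooth 3)).sub ((sA₁.div sD hDy).smul (hy.smooth 4))
      · exact hy.smooth 6
    · intro v w hv hw
      refine (hy.d_zero v w).trans ?_
      change _ = (θ₂ y v * (B₁ y / D y * ζ 3 y w - A₁ y / D y * ζ 4 y w)
        - θ₂ y w * (B₁ y / D y * ζ 3 y v - A₁ y / D y * ζ 4 y v))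
        + (θ₁ y v * (A₂ y / D y * ζ 4 y w - B₂ y / D y * ζ 3 y w)
        - θ₁ y w * (A₂ y / D y * ζ 4 y v - B₂ y / D y * ζ 3 y v))
      field_simp
      simp only [wedge]
      linear_combination ζ 3 y v * r₁ w hw - ζ 3 y w * r₁ v hv + ζ 4 y v * r₂ w hw
        - ζ 4 y w * r₂ v hv
    · refine hy.eq_I.trans (genBy_eq_of_ann hy.indep ind fun v => ?_)
      simp only [Set.mem_insert_iff, Set.mem_singleton_iff, forall_eq_or_imp, forall_eq]
      change _ ↔ ζ 0 y v = 0 ∧ θ₁ y v = 0 ∧ θ₂ y v = 0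
      refine and_congr_right fun h0 => ⟨fun hv => ?_, fun hv => ?_⟩
      · rw [e₁, e₂, h0, hv.1, hv.2]
        simp
      · exact ⟨cancel (by rw [r₁ v h0, hv.1, hv.2]; ring),
          cancel (by rw [r₂ v h0, hv.1, hv.2]; ring)⟩
    · rw [hy₁.2]
      simp [genBy, Set.image_insert_eq, η]
    · rw [hy₂.2]
      simp [genBy, Set.image_insert_eq, η]
  refine ⟨η, ?_⟩
  filter_upwards [hC, eventually_eventually_nhds.2 hζ, eventually_eventually_nhds.2 s₁,
    eventually_eventually_nhds.2 s₂, hD, hS.mem_nhds hp] with y hy hζy t₁ t₂ hDy hyS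
  have hI₁ : IsLocalSection I y θ₁ := IsLocalSection.le t₁ <| by
    filter_upwards [hS.mem_nhds hyS] with z hz using h.le_one z hz
  have hI₂ : IsLocalSection I y θ₂ := IsLocalSection.le t₂ <| by
    filter_upwards [hS.mem_nhds hyS] with z hz using h.le_two z hz
  have ann : ∀ {v}, InAnn (I y) v ↔ η 0 y v = 0 ∧ η 1 y v = 0 ∧ η 2 y v = 0 := by
    intro v
    rw [hy.eq_I, inAnn_genBy]
    simp
  have fr : ∀ k : Fin 7, k ∉ ({0, 1, 2} : Set (Fin 7)) → InAnn (I y) (frame η k y) := by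
    intro k hk
    have a := frame_annihilated hy.indep hk hk
    exact ann.2 ⟨(a 0 (by simp)).1, (a 1 (by simp)).1, (a 2 (by simp)).1⟩
  have f3 := fr 3 (by simp)
  have f4 := fr 4 (by simp)
  have f5 := fr 5 (by simp)
  have f6 := fr 6 (by simp)
  have i₁ := h.isotropic_one y hyS θ₁ θ₁ t₁ t₁
  have i₂ := h.isotropic_two y hyS θ₂ θ₂ t₂ t₂
  refine ⟨hy, i₁ _ _ _ _ f3 f4 f5 f6, i₂ _ _ _ _ f3 f4 f5 f6, fun h0 => hDy ?_⟩
  -- If the mixed coefficient vanished, the null direction of θ₁ would be orthogonal to θ₂, hence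
  -- parallel to it, against D ≠ 0.
  have q11 := quad_section hζy hI₁ hI₁ i₁
  have q12 := quad_section hζy hI₁ hI₂ fun v₁ v₂ v₃ v₄ h₁ h₂ h₃ h₄ =>
    wedgeTwo_eq_zero_of_conformalCoeff hy.indep h0 (v := ![v₁, v₂, v₃, v₄]) fun n => by
      fin_cases n
      exacts [ann.1 h₁, ann.1 h₂, ann.1 h₃, ann.1 h₄]
  exact IsHyperbolicCoframeAt.parallel hζy.self_of_nhds q11 q12

end Characteristic
end

theorem mainTheorem7 (F : Jet2 → ℝ) (W : Set Jet2) (S : Set Param) (i : Param → Jet2)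
    (M₁ M₂ : CotangentField Param)
    (hparam : IsNondegParam F W S i)
    (hhyp : IsHyperbolicOn F S i)
    (hchar : IsCharacteristicPair (pdeSystem i) M₁ M₂ S)
    (hgen : IsGenericOn M₁ M₂ S)
    (hsym : ∀ p ∈ S, Module.finrank ℝ (symmetryAlgebra (pdeSystem i) p) = 9) :
    -- the second derived systems have rank two and are completely integrable
    (IsPfaffianSystem (derivedSystem (derivedSystem (charSystem (pdeSystem i) M₁))) 2 S ∧
      CompletelyIntegrableOn (derivedSystem (derivedSystem (charSystem (pdeSystem i) M₁))) S) ∧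
    (IsPfaffianSystem (derivedSystem (derivedSystem (charSystem (pdeSystem i) M₂))) 2 S ∧
      CompletelyIntegrableOn (derivedSystem (derivedSystem (charSystem (pdeSystem i) M₂))) S) ∧
    -- Darboux integrability
    IsDarbouxIntegrable (pdeSystem i) M₁ M₂ S ∧
    -- near every point there is an adapted coframe such that the second derived systems are
    -- spanned by the 4th and 5th, resp. 6th and 7th form, and the 5th and the 7th form generate
    -- completely integrable rank one subsystems
    ∀ p ∈ S, ∃ ε : ℝ, (ε = 1 ∨ ε = -1) ∧ ∃ (U : Set Param) (η : Fin 7 → OneForm Param),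
      IsOpen U ∧ p ∈ U ∧ U ⊆ S ∧
      (∀ y ∈ U, IsAdaptedCoframeAt (pdeSystem i) M₁ M₂ ε η y) ∧
      (∀ y ∈ U,
        derivedSystem (derivedSystem (charSystem (pdeSystem i) M₁)) y = genBy η {3, 4} y ∧
        derivedSystem (derivedSystem (charSystem (pdeSystem i) M₂)) y = genBy η {5, 6} y) ∧
      IsPfaffianSystem (genBy η {4}) 1 U ∧ CompletelyIntegrableOn (genBy η {4}) U ∧
      IsPfaffianSystem (genBy η {6}) 1 U ∧ CompletelyIntegrableOn (genBy η {6}) U := by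
  exact structure_of_maximal_symmetry hparam.isOpen_param (fun p hp => by
    obtain ⟨ζ, hζ⟩ := hparam.exists_hyperbolicCoframe hhyp hp
    obtain ⟨η, hη⟩ := exists_contactCoframe hparam.isOpen_param hchar hp hζ
    exact exists_genericCoframe (hη.mono fun y h => h.1) (hη.mono fun y h => h.2.1)
      (hη.mono fun y h => h.2.2.1) (hη.mono fun y h => h.2.2.2) (hgen p hp).1 (hgen p hp).2) hsym
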